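/- Let $d\in\mathbb N$, $T>0$, let $U\subset\mathbb R^d$ be compact and convex, and let $\mathscr P_2(\mathbb R^d)$ be the set of Borel probability measures on $\mathbb R^d$ with finite second moment, with the $2$-Wasserstein distance $W_2$. Let $b:[0,T]\times\mathbb R^d\times\mathscr P_2(\mathbb R^d)\to\mathbb R^d$ be measurable in $t$ and such that, for some constants $M,L>0$, $$|b(t,x,\mu)|\le M\Big(1+|x|+\int_{\mathbb R^d}|y|\,\mu(dy)\Big),\qquad |b(t,x,\mu)-b(t,y,\nu)|\le L\big(|x-y|+W_2(\mu,\nu)\big)$$ for all $t\in[0,T]$, $x,y\in\mathbb R^d$, $\mu,\nu\in\mathscr P_2(\mathbb R^d)$. Let $\mu_0\in\mathscr P_2(\mathbb R^d)$ have compact support. For $\kappa\ge 0$ and a control $w:(0,T)\times\mathbb R^d\to U$, a weak solution of $$\partial_t\mu_t+\operatorname{div}\big[(b(t,x,\mu_t)+w(t,x))\mu_t\big]=\kappa\Delta\mu_t,\qquad \mu|_{t=0}=\mu_0, \tag{$E_{\kappa,w}$}$$ is a map $t\in[0,T]\mapsto\mu_t\in\mathscr P_2(\mathbb R^d)$, continuous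 for the weak convergence of measures, such that $b(t,x,\mu_t)+w(t,x)$ belongs to $L^1((0,T);L^1_{\rm loc}(\mathbb R^d;d\mu_t))$ and, for all $\varphi\in C_c^\infty([0,T)\times\mathbb R^d)$, $$\int_0^T\!\!\int_{\mathbb R^d}\big(\partial_t\varphi+(b(t,x,\mu_t)+w(t,x))\cdot\nabla\varphi+\kappa\Delta\varphi\big)\,\mu_t(dx)\,dt=-\int_{\mathbb R^d}\varphi(0,x)\,\mu_0(dx).$$ Let $u^\varepsilon$ ($\varepsilon>0$) and $u$ be controls in $L^\infty((0,T);W^{1,\infty}(\mathbb R^d,U))$ (represented by maps that are Lipschitz in $x$) such that, for every $1<p<\infty$, $$u^\varepsilon\rightharpoonup u\quad\text{weakly in } L^2\big((0,T);W^{1,p}_{\rm loc}(\mathbb R^d,U)\big)\quad\text{as }\varepsilon\to0^+ .$$ Let $\mu^\varepsilon$ be a weak solution of the viscous equation $(E_{\varepsilon,u^\varepsilon})$ for each $\varepsilon>0$, and let $\mu$ be a weak solution of the inviscid equation $(E_{0,u})$. Then $$\lim_{\varepsilon\to0^+}\ \sup_{t\in(0,T)}W_2(\mu^\varepsilon_t,\mu_t)=0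 .$$ -/

import Mathlib

open MeasureTheory Set Filter Topology
open scoped ENNReal NNReal ContDiff

noncomputable section

namespace VanishingViscosity

/-- The Euclidean space `ℝ^d`. -/
abbrev Rd (d : ℕ) : Type := EuclideanSpace ℝ (Fin d)

/-- The set `𝒫₂(ℝ^d)` of Borel probability measures with finite second moment, with the topology
of weak convergence of measures. -/
abbrev P2 (d : ℕ) : Type :=
  {μ : ProbabilityMeasure (Rd d) // ∫⁻ x, ‖x‖ₑ ^ 2 ∂(μ : Measure (Rd d)) < ⊤}

/-- The underlying Borel measure of an element of `𝒫₂(ℝ^d)`. -/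
def P2.meas {d : ℕ} (μ : P2 d) : Measure (Rd d) := (μ.1 : Measure (Rd d))

/-- The transport plans between `μ` and `ν`: the measures on `ℝ^d × ℝ^d` with marginals `μ`, `ν`. -/
def transportPlans {d : ℕ} (μ ν : P2 d) : Set (Measure (Rd d × Rd d)) :=
  {γ | γ.map Prod.fst = μ.meas ∧ γ.map Prod.snd = ν.meas}

/-- The 2-Wasserstein distance, as an extended nonnegative number (it is finite on `𝒫₂(ℝ^d)`). -/
def W2 {d : ℕ} (μ ν : P2 d) : ℝ≥0∞ :=
  ⨅ γ ∈ transportPlans μ ν, (∫⁻ z, ‖z.1 - z.2‖ₑ ^ 2 ∂γ) ^ (1 / 2 : ℝ)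

/-- The standing assumptions on the nonlocal velocity field `b : [0,T] × ℝ^d × 𝒫₂(ℝ^d) → ℝ^d`
(the values for `t ∉ [0,T]` play no role). Continuity of `b(t,·,·)` for `|·| × W₂` is contained in
the Lipschitz condition. -/
structure IsVelocityField {d : ℕ} (T : ℝ) (b : ℝ → Rd d → P2 d → Rd d) : Prop where
  measurable_time : ∀ (x : Rd d) (μ : P2 d),
    AEMeasurable (fun t => b t x μ) (volume.restrict (Icc 0 T))
  growth : ∃ M : ℝ, ∀ t ∈ Icc 0 T, ∀ (x : Rd d) (μ : P2 d),
    ‖b t x μ‖ ≤ M * (1 + ‖x‖ + ∫ y, ‖y‖ ∂μ.meas)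
  lipschitz : ∃ L : ℝ≥0, ∀ t ∈ Icc 0 T, ∀ (x y : Rd d) (μ ν : P2 d),
    ‖b t x μ - b t y ν‖ₑ ≤ L * (‖x - y‖ₑ + W2 μ ν)

/-- Controls in `L^∞((0,T); W^{1,∞}(ℝ^d, U))`, through the Lipschitz representative in `x`: for
almost every `t` the map `u(t,·)` is `U`-valued and Lipschitz, with a constant independent of `t`.
(Boundedness comes from the boundedness of `U`.) -/
structure IsLipschitzControl {d : ℕ} (T : ℝ) (U : Set (Rd d)) (u : ℝ → Rd d → Rd d) : Prop where
  measurable : Measurable (Function.uncurry u)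
  mem : ∀ᵐ t ∂(volume.restrict (Ioo 0 T)), ∀ x, u t x ∈ U
  lipschitz : ∃ C : ℝ≥0, ∀ᵐ t ∂(volume.restrict (Ioo 0 T)), LipschitzWith C (u t)

/-- `F` is the weak gradient of `f` on the open set `K`. -/
def IsWeakGradient {d : ℕ} (K : Set (Rd d)) (f : Rd d → Rd d) (F : Rd d → Rd d →L[ℝ] Rd d) :
    Prop :=
  ∀ ψ : Rd d → ℝ, ContDiff ℝ ∞ ψ → HasCompactSupport ψ → tsupport ψ ⊆ K → ∀ y : Rd d,
    ∫ x in K, fderiv ℝ ψ x y • f x = - ∫ x in K, ψ x • F x y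

section Sobolev

variable {d : ℕ} {p : ℝ≥0∞} [Fact (1 ≤ p)] {K : Set (Rd d)}

/-- Auxiliary: `L^p` functions are integrable against smooth compactly supported weights. -/
lemma integrable_weight_smul {G : Type*} [NormedAddCommGroup G] [NormedSpace ℝ G]
    (f : Lp G p (volume.restrict K)) {w : Rd d → ℝ} (hw : Continuous w)
    (hc : HasCompactSupport w) : Integrable (fun x => w x • f x) (volume.restrict K) :=
  ((Lp.memLp f).locallyIntegrable (Fact.out)).integrable_smul_left_of_hasCompactSupport hw hc

lemma integrable_weight_smul_apply (F : Lp (Rd d →L[ℝ] Rd d) p (volume.restrict K))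
    {w : Rd d → ℝ} (hw : Continuous w) (hc : HasCompactSupport w) (y : Rd d) :
    Integrable (fun x => w x • F x y) (volume.restrict K) :=
  (integrable_weight_smul F hw hc).apply_continuousLinearMap y

lemma continuous_dirDeriv {ψ : Rd d → ℝ} (h : ContDiff ℝ ∞ ψ) (y : Rd d) :
    Continuous fun x => fderiv ℝ ψ x y :=
  (h.continuous_fderiv (by simp)).clm_apply continuous_const

/-- The Sobolev space `W^{1,p}(K; ℝ^d)`, as the space of pairs `(f, ∇f)` with `f` and its weak
gradient in `L^p(K)`. It carries the norm `max (‖f‖_{L^p}) (‖∇f‖_{L^p})`, which is equivalent to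
the usual one. -/
def sobolev (d : ℕ) (p : ℝ≥0∞) [Fact (1 ≤ p)] (K : Set (Rd d)) :
    Submodule ℝ (Lp (Rd d) p (volume.restrict K) × Lp (Rd d →L[ℝ] Rd d) p (volume.restrict K)) where
  carrier := {q | IsWeakGradient K q.1 q.2}
  zero_mem' := by
    intro ψ _ _ _ y
    have h1 := Lp.coeFn_zero (Rd d) p (volume.restrict K)
    have h2 := Lp.coeFn_zero (Rd d →L[ℝ] Rd d) p (volume.restrict K)
    rw [integral_eq_zero_of_ae, integral_eq_zero_of_ae, neg_zero]
    · filter_upwards [h2] with x hx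
      rw [Prod.snd_zero, hx]
      simp
    · filter_upwards [h1] with x hx
      rw [Prod.fst_zero, hx]
      simp
  add_mem' := by
    intro q r hq hr ψ hψ hc hs y
    have hcd : HasCompactSupport fun x => fderiv ℝ ψ x y :=
      (hc.fderiv (𝕜 := ℝ)).comp_left (g := fun A : Rd d →L[ℝ] ℝ => A y) (by simp)
    have e1 : ∫ x in K, fderiv ℝ ψ x y • (q + r).1 x
        = (∫ x in K, fderiv ℝ ψ x y • q.1 x) + ∫ x in K, fderiv ℝ ψ x y • r.1 x := by
      rw [← integral_add (integrable_weight_smul q.1 (continuous_dirDeriv hψ y) hcd)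
        (integrable_weight_smul r.1 (continuous_dirDeriv hψ y) hcd)]
      refine integral_congr_ae ?_
      filter_upwards [Lp.coeFn_add q.1 r.1] with x hx
      rw [Prod.fst_add, hx, Pi.add_apply, smul_add]
    have e2 : ∫ x in K, ψ x • (q + r).2 x y
        = (∫ x in K, ψ x • q.2 x y) + ∫ x in K, ψ x • r.2 x y := by
      rw [← integral_add (integrable_weight_smul_apply q.2 hψ.continuous hc y)
        (integrable_weight_smul_apply r.2 hψ.continuous hc y)]
      refine integral_congr_ae ?_
      filter_upwards [Lp.coeFn_add q.2 r.2] with x hx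
      rw [Prod.snd_add, hx, Pi.add_apply, add_apply, smul_add]
    rw [e1, e2, hq ψ hψ hc hs y, hr ψ hψ hc hs y, neg_add]
  smul_mem' := by
    intro c q hq ψ hψ hc hs y
    have e1 : ∫ x in K, fderiv ℝ ψ x y • (c • q).1 x
        = c • ∫ x in K, fderiv ℝ ψ x y • q.1 x := by
      rw [← integral_smul]
      refine integral_congr_ae ?_
      filter_upwards [Lp.coeFn_smul c q.1] with x hx
      rw [Prod.smul_fst, hx, Pi.smul_apply, smul_comm]
    have e2 : ∫ x in K, ψ x • (c • q).2 x y = c • ∫ x in K, ψ x • q.2 x y := by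
      rw [← integral_smul]
      refine integral_congr_ae ?_
      filter_upwards [Lp.coeFn_smul c q.2] with x hx
      rw [Prod.smul_snd, hx, Pi.smul_apply, smul_apply, smul_comm]
    rw [e1, e2, hq ψ hψ hc hs y, smul_neg]

end Sobolev

/-- The Bochner space `L²((0,T); W^{1,p}(K; ℝ^d))`. -/
abbrev L2Sobolev (d : ℕ) (T : ℝ) (p : ℝ≥0∞) [Fact (1 ≤ p)] (K : Set (Rd d)) : Type :=
  Lp (sobolev d p K) 2 (volume.restrict (Ioo 0 T))

/-- The element `v` of `L²((0,T); W^{1,p}(K; ℝ^d))` is the class of the map `t ↦ u(t,·)|_K`. -/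
def Represents {d : ℕ} {T : ℝ} {p : ℝ≥0∞} [Fact (1 ≤ p)] {K : Set (Rd d)}
    (v : L2Sobolev d T p K) (u : ℝ → Rd d → Rd d) : Prop :=
  ∀ᵐ t ∂(volume.restrict (Ioo 0 T)), ((v t).1.1 : Rd d → Rd d) =ᵐ[volume.restrict K] u t

/-- `u^ε ⇀ u` weakly in `L²((0,T); W^{1,p}_loc(ℝ^d; ℝ^d))` as `ε → 0⁺`: on every ball `B_r` the
restrictions belong to `L²((0,T); W^{1,p}(B_r; ℝ^d))` and converge in its weak topology. -/
def WeakConvergence {d : ℕ} (T : ℝ) (p : ℝ≥0∞) [Fact (1 ≤ p)] (uε : ℝ → ℝ → Rd d → Rd d)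
    (u : ℝ → Rd d → Rd d) : Prop :=
  ∀ r : ℝ, 0 < r → ∃ (vε : ℝ → L2Sobolev d T p (Metric.ball 0 r))
    (v : L2Sobolev d T p (Metric.ball 0 r)),
    (∀ ε, 0 < ε → Represents (vε ε) (uε ε)) ∧ Represents v u ∧
    Tendsto (fun ε => toWeakSpace ℝ (L2Sobolev d T p (Metric.ball 0 r)) (vε ε)) (𝓝[>] 0)
      (𝓝 (toWeakSpace ℝ (L2Sobolev d T p (Metric.ball 0 r)) v))

/-- `μ ∈ C([0,T]; 𝒫₂(ℝ^d))` is a weak (distributional) solution of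
`∂_t μ_t + div[(b(t,x,μ_t) + u(t,x)) μ_t] = κ Δ μ_t`, `μ|_{t=0} = μ₀`; for `κ = 0` this is the
nonlocal continuity equation. The test functions are those of `C_c^∞([0,T) × ℝ^d)`, and the drift
has to belong to `L¹((0,T); L¹_loc(dμ_t))`, so that the weak formulation makes sense. -/
structure IsWeakSolution {d : ℕ} (T κ : ℝ) (b : ℝ → Rd d → P2 d → Rd d) (u : ℝ → Rd d → Rd d)
    (μ₀ : P2 d) (μ : ℝ → P2 d) : Prop where
  continuousOn : ContinuousOn μ (Icc 0 T)
  integrable_space : ∀ r : ℝ, ∀ᵐ t ∂(volume.restrict (Ioo 0 T)),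
    IntegrableOn (fun x => b t x (μ t) + u t x) (Metric.ball 0 r) (μ t).meas
  integrable_time : ∀ r : ℝ,
    IntegrableOn (fun t => ∫ x in Metric.ball 0 r, ‖b t x (μ t) + u t x‖ ∂(μ t).meas) (Ioo 0 T)
  weak_form : ∀ φ : ℝ × Rd d → ℝ, ContDiff ℝ ∞ φ → HasCompactSupport φ →
    tsupport φ ⊆ Iio T ×ˢ univ →
    ∫ t in (0 : ℝ)..T, ∫ x, (deriv (fun s => φ (s, x)) t
        + inner ℝ (b t x (μ t) + u t x) (gradient (fun z => φ (t, z)) x)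
        + κ * Laplacian.laplacian (fun z => φ (t, z)) x) ∂(μ t).meas
      = - ∫ x, φ (0, x) ∂μ₀.meas

end VanishingViscosity

end

open VanishingViscosity

open MeasureTheory Set Filter Topology
open scoped ENNReal NNReal ContDiff
set_option maxSynthPendingDepth 3

noncomputable section

/-! Weak convergence of the controls suffices because a particle feels its control only through time
integrals. Over a step `[a,b]` a particle near `x` moves by about `∫_a^b (b + u^ε)(s,x) ds`. After
mollification in space at a fixed scale `δ`, the contribution of `u^ε` to this integral converges to
that of `u`, uniformly on balls (`eventually_norm_mollify_sub_le`). No Lipschitz bound on `u^ε`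
uniform in `ε` is available. What replaces it is boundedness in `L²(0,T; W^{1,p})` on balls, which
weak convergence provides. For `p = 2d + 2 > d` a Morrey estimate (`exists_norm_sub_mollify_le`)
then bounds the mollification error of `u^ε` on a ball by `√δ` times a function of time whose
integral is bounded independently of small `ε`.

The argument is quantitative: no compactness of the family of solutions and no uniqueness theorem
enters. Each solution is compared in `W2` with an explicit Euler scheme `eulerFlow` started from
`μ₀`. The velocity of the scheme is the mollification of `b(t,·,μ_t)` along that very solution plus
the mollified limit control. The parameters can be chosen so that the scheme is within `η` of the
solution at the grid times, for the viscous and the inviscid equation alike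
(`exists_euler_parameters`). Consistency is a duality argument: a test function pulled back through
one step is again a test function with controlled derivatives (`IsTestFunction.comp_add`), and the
one-step errors (`IsRegularSolution.abs_euler_step_le`) add up. Closeness against finitely many test
functions becomes closeness in `W2` by `exists_test_functions_W2_le`, because fourth moments are
bounded uniformly in `ε`.

The two schemes use the same control and differ only through `b(t,·,μ^ε_t)` and `b(t,·,μ_t)`, that
is by at most `L * W2 (μ^ε_t) (μ_t)`. A Grönwall argument with an exponential weight in time
(`W2_le_of_eulerFlow_approx`) bounds the distance of the solutions by a constant multiple of `η`.

The preparation consists of the measurability of `t ↦ b(t,x,μ_t)` (`aemeasurable_velocity`), the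
moment bound `exists_uniform_moment_bound`, obtained by testing with truncations of `‖x‖⁴`, and
`exists_regular_representation`, which views every solution as a solution of a linear equation with
constants independent of `ε`. -/

namespace VanishingViscosity

open ProbabilityTheory

/-! ### Wasserstein distance: triangle inequality and upper bounds by explicit plans. -/

section Wasserstein

variable {d : ℕ}

instance P2.isProbabilityMeasure_meas (μ : P2 d) : IsProbabilityMeasure μ.meas :=
  inferInstanceAs (IsProbabilityMeasure (μ.1 : Measure (Rd d)))

lemma isProbabilityMeasure_of_mem_transportPlans {μ ν : P2 d} {γ : Measure (Rd d × Rd d)}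
    (hγ : γ ∈ transportPlans μ ν) : IsProbabilityMeasure γ := by
  constructor
  have h := congrArg (fun m => m univ) hγ.1
  simpa [Measure.map_apply measurable_fst MeasurableSet.univ] using h

lemma W2_le_of_mem_transportPlans {μ ν : P2 d} {γ : Measure (Rd d × Rd d)}
    (hγ : γ ∈ transportPlans μ ν) :
    W2 μ ν ≤ (∫⁻ z, ‖z.1 - z.2‖ₑ ^ 2 ∂γ) ^ (1 / 2 : ℝ) :=
  iInf₂_le γ hγ

lemma W2_comm_le (μ ν : P2 d) : W2 ν μ ≤ W2 μ ν := by
  refine le_iInf₂ fun γ hγ => ?_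
  have h : γ.map Prod.swap ∈ transportPlans ν μ := by
    constructor
    · rw [Measure.map_map measurable_fst measurable_swap]
      exact hγ.2
    · rw [Measure.map_map measurable_snd measurable_swap]
      exact hγ.1
  refine (W2_le_of_mem_transportPlans h).trans (le_of_eq ?_)
  rw [lintegral_map (by fun_prop) measurable_swap]
  congr 1
  refine lintegral_congr fun z => ?_
  rw [← enorm_neg]
  simp

lemma W2_comm (μ ν : P2 d) : W2 μ ν = W2 ν μ :=
  le_antisymm (W2_comm_le ν μ) (W2_comm_le μ ν)

/-- Gluing: both plans are disintegrated over their common marginal `ν`, and the two conditional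
laws are taken independent. The `ν`-variable is the first coordinate of the glued measure, followed
by the `μ`- and `ρ`-variables. -/
lemma exists_glued_plan {μ ν ρ : P2 d} {γ γ' : Measure (Rd d × Rd d)}
    (hγ : γ ∈ transportPlans μ ν) (hγ' : γ' ∈ transportPlans ν ρ) :
    ∃ Θ : Measure (Rd d × Rd d × Rd d),
      Θ.map (fun w => (w.2.1, w.1)) = γ ∧ Θ.map (fun w => (w.1, w.2.2)) = γ' := by
  have := isProbabilityMeasure_of_mem_transportPlans hγ
  have := isProbabilityMeasure_of_mem_transportPlans hγ'
  set σ := γ.map Prod.swap with hσ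
  have : IsProbabilityMeasure σ := Measure.isProbabilityMeasure_map measurable_swap.aemeasurable
  have h1 : σ.fst = ν.meas := by
    rw [Measure.fst, hσ, Measure.map_map measurable_fst measurable_swap]
    exact hγ.2
  have h2 : γ'.fst = ν.meas := hγ'.1
  refine ⟨ν.meas.compProd (σ.condKernel ×ₖ γ'.condKernel), ?_, ?_⟩
  · have e : (ν.meas.compProd (σ.condKernel ×ₖ γ'.condKernel)).map (Prod.map id Prod.fst) = σ := by
      rw [← Measure.compProd_map measurable_fst, ← Kernel.fst_eq, Kernel.fst_prod, ← h1]
      exact Measure.disintegrate σ σ.condKernel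
    have e2 : γ = σ.map Prod.swap := by
      rw [hσ, Measure.map_map measurable_swap measurable_swap]
      simp
    refine Eq.trans ?_ ((congrArg (Measure.map Prod.swap) e).trans e2.symm)
    rw [Measure.map_map measurable_swap (by fun_prop)]
    rfl
  · have e : (ν.meas.compProd (σ.condKernel ×ₖ γ'.condKernel)).map (Prod.map id Prod.snd) = γ' := by
      rw [← Measure.compProd_map measurable_snd, ← Kernel.snd_eq, Kernel.snd_prod, ← h2]
      exact Measure.disintegrate γ' γ'.condKernel
    exact e

/-- Minkowski's inequality in `L²` of a glued plan. -/
theorem W2_triangle (μ ν ρ : P2 d) : W2 μ ρ ≤ W2 μ ν + W2 ν ρ := by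
  have key : ∀ γ ∈ transportPlans μ ν, ∀ γ' ∈ transportPlans ν ρ,
      W2 μ ρ ≤ (∫⁻ z, ‖z.1 - z.2‖ₑ ^ 2 ∂γ) ^ (1 / 2 : ℝ)
        + (∫⁻ z, ‖z.1 - z.2‖ₑ ^ 2 ∂γ') ^ (1 / 2 : ℝ) := by
    intro γ hγ γ' hγ'
    obtain ⟨Θ, h1, h2⟩ := exists_glued_plan hγ hγ'
    have hplan : Θ.map (fun w => (w.2.1, w.2.2)) ∈ transportPlans μ ρ := by
      constructor
      · rw [Measure.map_map measurable_fst (by fun_prop), ← hγ.1, ← h1,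
          Measure.map_map measurable_fst (by fun_prop)]
        rfl
      · rw [Measure.map_map measurable_snd (by fun_prop), ← hγ'.2, ← h2,
          Measure.map_map measurable_snd (by fun_prop)]
        rfl
    refine (W2_le_of_mem_transportPlans hplan).trans ?_
    rw [← h1, ← h2, lintegral_map (by fun_prop) (by fun_prop),
      lintegral_map (by fun_prop) (by fun_prop), lintegral_map (by fun_prop) (by fun_prop)]
    have mink := ENNReal.lintegral_Lp_add_le (μ := Θ) (p := 2)
      (f := fun w => ‖w.2.1 - w.1‖ₑ) (g := fun w => ‖w.1 - w.2.2‖ₑ) (by fun_prop) (by fun_prop)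
      (by norm_num)
    simp only [ENNReal.rpow_ofNat] at mink
    refine le_trans ?_ mink
    gcongr with w
    simp only [Pi.add_apply]
    calc ‖w.2.1 - w.2.2‖ₑ = ‖(w.2.1 - w.1) + (w.1 - w.2.2)‖ₑ := by congr 1; abel
      _ ≤ _ := enorm_add_le _ _
  -- Addition of extended nonnegative numbers commutes with infima, so no optimal plan is needed.
  unfold W2
  simp only [ENNReal.iInf_add, ENNReal.add_iInf]
  exact le_iInf₂ fun γ' hγ' => le_iInf₂ fun γ hγ => key γ hγ γ' hγ'

/-- Pushing a measure forward by two maps gives a transport plan between the two images. -/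
lemma W2_le_of_map_eq {μ ν : P2 d} {m : Measure (Rd d)} {f g : Rd d → Rd d} (hf : Measurable f)
    (hg : Measurable g) (hμ : m.map f = μ.meas) (hν : m.map g = ν.meas) :
    W2 μ ν ≤ (∫⁻ x, ‖f x - g x‖ₑ ^ 2 ∂m) ^ (1 / 2 : ℝ) := by
  have h : m.map (fun x => (f x, g x)) ∈ transportPlans μ ν := by
    constructor
    · rw [Measure.map_map measurable_fst (by fun_prop)]
      exact hμ
    · rw [Measure.map_map measurable_snd (by fun_prop)]
      exact hν
  refine (W2_le_of_mem_transportPlans h).trans (le_of_eq ?_)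
  rw [lintegral_map (by fun_prop) (by fun_prop)]

/-- The normalised product is a plan between two measures of equal mass. Its cost is estimated by
`|x - y|² ≤ 2(|x|² + |y|²)`. Zero mass is harmless, since then the integral vanishes and `⊤ * 0 =
0`. -/
lemma lintegral_prod_dist_sq_le {m₁ m₂ : Measure (Rd d)} [IsFiniteMeasure m₁] [IsFiniteMeasure m₂]
    (h : m₁ univ = m₂ univ) :
    (m₁ univ)⁻¹ * ∫⁻ z, ‖z.1 - z.2‖ₑ ^ 2 ∂(m₁.prod m₂)
      ≤ 2 * (∫⁻ x, ‖x‖ₑ ^ 2 ∂m₁ + ∫⁻ x, ‖x‖ₑ ^ 2 ∂m₂) := by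
  have hpt : ∀ z : Rd d × Rd d, ‖z.1 - z.2‖ₑ ^ 2 ≤ 2 * (‖z.1‖ₑ ^ 2 + ‖z.2‖ₑ ^ 2) := by
    intro z
    have h1 : ‖z.1 - z.2‖ₑ ≤ ‖z.1‖ₑ + ‖z.2‖ₑ := enorm_sub_le
    refine (pow_le_pow_left' h1 2).trans ?_
    have := ENNReal.rpow_add_le_mul_rpow_add_rpow ‖z.1‖ₑ ‖z.2‖ₑ (p := 2) (by norm_num)
    simp only [ENNReal.rpow_ofNat] at this
    norm_num at this
    simpa using this
  have e : ∫⁻ z, 2 * (‖z.1‖ₑ ^ 2 + ‖z.2‖ₑ ^ 2) ∂(m₁.prod m₂)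
      = 2 * (m₁ univ * (∫⁻ x, ‖x‖ₑ ^ 2 ∂m₁ + ∫⁻ x, ‖x‖ₑ ^ 2 ∂m₂)) := by
    rw [lintegral_const_mul _ (by fun_prop), lintegral_add_left (by fun_prop)]
    have e1 : ∫⁻ z, ‖z.1‖ₑ ^ 2 ∂(m₁.prod m₂) = m₂ univ * ∫⁻ x, ‖x‖ₑ ^ 2 ∂m₁ := by
      rw [lintegral_prod _ (by fun_prop)]
      simp only [lintegral_const]
      rw [lintegral_mul_const _ (by fun_prop), mul_comm]
    have e2 : ∫⁻ z, ‖z.2‖ₑ ^ 2 ∂(m₁.prod m₂) = m₁ univ * ∫⁻ x, ‖x‖ₑ ^ 2 ∂m₂ := by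
      rw [lintegral_prod _ (by fun_prop)]
      simp [mul_comm]
    rw [e1, e2, ← h]
    ring
  calc (m₁ univ)⁻¹ * ∫⁻ z, ‖z.1 - z.2‖ₑ ^ 2 ∂(m₁.prod m₂)
      ≤ (m₁ univ)⁻¹ * ∫⁻ z, 2 * (‖z.1‖ₑ ^ 2 + ‖z.2‖ₑ ^ 2) ∂(m₁.prod m₂) := by
        gcongr with z
        exact hpt z
    _ = ((m₁ univ)⁻¹ * m₁ univ) * (2 * (∫⁻ x, ‖x‖ₑ ^ 2 ∂m₁ + ∫⁻ x, ‖x‖ₑ ^ 2 ∂m₂)) := by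
        rw [e]; ring
    _ ≤ 1 * (2 * (∫⁻ x, ‖x‖ₑ ^ 2 ∂m₁ + ∫⁻ x, ‖x‖ₑ ^ 2 ∂m₂)) := by
        gcongr
        exact ENNReal.inv_mul_le_one _
    _ = _ := one_mul _

/-- The transport plan built from a partition of unity `f`: inside each cell the common mass is
transported by a product plan, and the remaining mass by another product plan. -/
lemma W2_sq_le_of_partition {n : ℕ} {μ ν : P2 d} {f : Fin n → Rd d → ℝ≥0∞}
    (hf : ∀ i, Measurable (f i)) (hsum : ∀ x, ∑ i, f i x ≤ 1) {δ k m K : ℝ≥0∞} (hk : k ≠ 0)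
    (hk' : k ≠ ⊤)
    (hδ : ∀ i x y, f i x ≠ 0 → f i y ≠ 0 → ‖x - y‖ₑ ≤ δ)
    (hμ : ∫⁻ x, ‖x‖ₑ ^ 4 ∂μ.meas ≤ K) (hν : ∫⁻ x, ‖x‖ₑ ^ 4 ∂ν.meas ≤ K)
    (hm : 1 ≤ ∑ i, min (∫⁻ x, f i x ∂μ.meas) (∫⁻ x, f i x ∂ν.meas) + m) :
    W2 μ ν ≤ (δ ^ 2 + 4 * (k ^ 2 * m + K / k ^ 2)) ^ (1 / 2 : ℝ) := by
  set a : Fin n → ℝ≥0∞ := fun i => ∫⁻ x, f i x ∂μ.meas with ha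
  set b : Fin n → ℝ≥0∞ := fun i => ∫⁻ x, f i x ∂ν.meas with hb
  have hfle : ∀ i x, f i x ≤ 1 := fun i x =>
    (Finset.single_le_sum (fun j _ => zero_le) (Finset.mem_univ i)).trans (hsum x)
  have hale : ∀ i, a i ≤ 1 := fun i => by
    calc a i ≤ ∫⁻ x, 1 ∂μ.meas := lintegral_mono (hfle i)
      _ = 1 := by simp
  have hble : ∀ i, b i ≤ 1 := fun i => by
    calc b i ≤ ∫⁻ x, 1 ∂ν.meas := lintegral_mono (hfle i)
      _ = 1 := by simp
  -- With masses `a i`, `b i` of a cell, only `min (a i) (b i)` can be transported inside it. The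
  -- fractions kept are `p i = b i / max` for `μ` and `q i = a i / max` for `ν`; both leave the mass
  -- `min`.
  set M : Fin n → ℝ≥0∞ := fun i => max (a i) (b i) with hM
  have hMtop : ∀ i, M i ≠ ⊤ := fun i =>
    ne_top_of_le_ne_top ENNReal.one_ne_top (max_le (hale i) (hble i))
  set p : Fin n → ℝ≥0∞ := fun i => (M i)⁻¹ * b i with hp
  set q : Fin n → ℝ≥0∞ := fun i => (M i)⁻¹ * a i with hq
  have hp1 : ∀ i, p i ≤ 1 := fun i =>
    (mul_le_mul_right (le_max_right _ _) _).trans (ENNReal.inv_mul_le_one (M i))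
  have hq1 : ∀ i, q i ≤ 1 := fun i =>
    (mul_le_mul_right (le_max_left _ _) _).trans (ENNReal.inv_mul_le_one (M i))
  have hpf : ∀ x, ∑ i, p i * f i x ≤ 1 := fun x =>
    (Finset.sum_le_sum fun i _ => mul_le_of_le_one_left' (hp1 i)).trans (hsum x)
  have hqf : ∀ x, ∑ i, q i * f i x ≤ 1 := fun x =>
    (Finset.sum_le_sum fun i _ => mul_le_of_le_one_left' (hq1 i)).trans (hsum x)
  have hmin : ∀ i, p i * a i = min (a i) (b i) := by
    intro i
    rcases eq_or_ne (M i) 0 with h0 | h0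
    · have ha0 : a i = 0 := le_antisymm ((le_max_left _ _).trans h0.le) zero_le
      simp [ha0]
    · have : p i * a i = (M i)⁻¹ * M i * min (a i) (b i) := by
        rw [hp, mul_assoc, mul_assoc, max_mul_min, mul_comm (a i)]
      rw [this, ENNReal.inv_mul_cancel h0 (hMtop i), one_mul]
  have hmin' : ∀ i, q i * b i = min (a i) (b i) := by
    intro i
    rw [← hmin i, hp, hq]
    ring
  set μ' := μ.meas.withDensity (fun x => 1 - ∑ i, p i * f i x) with hμ'
  set ν' := ν.meas.withDensity (fun x => 1 - ∑ i, q i * f i x) with hν'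
  have mass : ∀ (ρ : P2 d) (r : Fin n → ℝ≥0∞), (∀ x, ∑ i, r i * f i x ≤ 1) →
      (∀ i, r i * ∫⁻ x, f i x ∂ρ.meas = min (a i) (b i)) →
      ρ.meas.withDensity (fun x => 1 - ∑ i, r i * f i x) univ = 1 - ∑ i, min (a i) (b i) := by
    intro ρ r hr hr'
    have es : ∫⁻ x, ∑ i, r i * f i x ∂ρ.meas = ∑ i, min (a i) (b i) := by
      rw [lintegral_finsetSum _ (fun i _ => (hf i).const_mul _)]
      exact Finset.sum_congr rfl fun i _ => by rw [lintegral_const_mul _ (hf i), hr' i]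
    rw [withDensity_apply _ MeasurableSet.univ, setLIntegral_univ, lintegral_sub, es]
    · simp
    · fun_prop
    · rw [es]
      refine ne_top_of_le_ne_top (ENNReal.natCast_ne_top n) ?_
      calc ∑ i, min (a i) (b i) ≤ ∑ _i : Fin n, 1 :=
            Finset.sum_le_sum fun i _ => (min_le_left _ _).trans (hale i)
        _ = n := by simp
    · exact ae_of_all _ hr
  have hmμ : μ' univ = 1 - ∑ i, min (a i) (b i) := mass μ p hpf hmin
  have hmν : ν' univ = 1 - ∑ i, min (a i) (b i) := mass ν q hqf hmin'
  have fin : ∀ (ρ : P2 d) (g : Rd d → ℝ≥0∞), (∀ x, g x ≤ 1) →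
      IsFiniteMeasure (ρ.meas.withDensity g) := by
    intro ρ g hg
    refine isFiniteMeasure_withDensity (ne_top_of_le_ne_top ENNReal.one_ne_top ?_)
    calc ∫⁻ x, g x ∂ρ.meas ≤ ∫⁻ _, 1 ∂ρ.meas := lintegral_mono hg
      _ = 1 := by simp
  have : IsFiniteMeasure μ' := fin μ _ fun x => tsub_le_self
  have : IsFiniteMeasure ν' := fin ν _ fun x => tsub_le_self
  have : ∀ i, IsFiniteMeasure (μ.meas.withDensity (f i)) := fun i => fin μ _ (hfle i)
  have : ∀ i, IsFiniteMeasure (ν.meas.withDensity (f i)) := fun i => fin ν _ (hfle i)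
  -- Dividing the product by the larger mass produces exactly the marginals `p i * f i` times `μ`
  -- and `q i * f i` times `ν`.
  set Γ : Fin n → Measure (Rd d × Rd d) := fun i =>
    (M i)⁻¹ • (μ.meas.withDensity (f i)).prod (ν.meas.withDensity (f i)) with hΓ
  set γ := ∑ i, Γ i + (μ' univ)⁻¹ • μ'.prod ν' with hγ
  -- The factor `t⁻¹ * t` is `1` unless the leftover measure is zero, so the cell marginals and the
  -- leftover always recombine to the full measure.
  have mar : ∀ (ρ : P2 d) (r : Fin n → ℝ≥0∞) (ρ' : Measure (Rd d)) (t : ℝ≥0∞),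
      (∀ x, ∑ i, r i * f i x ≤ 1) →
      ρ' = ρ.meas.withDensity (fun x => 1 - ∑ i, r i * f i x) → t = ρ' univ → t ≠ ⊤ →
      ∑ i, r i • ρ.meas.withDensity (f i) + (t⁻¹ * t) • ρ' = ρ.meas := by
    intro ρ r ρ' t hr h1 h2 h3
    have e1 : (t⁻¹ * t) • ρ' = ρ' := by
      rcases eq_or_ne t 0 with h0 | h0
      · have : ρ' = 0 := Measure.measure_univ_eq_zero.1 (h2.symm.trans h0)
        rw [this, smul_zero]
      · rw [ENNReal.inv_mul_cancel h0 h3, one_smul]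
    rw [e1, h1]
    ext s hs
    rw [Measure.add_apply, Measure.finsetSum_apply]
    simp only [Measure.smul_apply, smul_eq_mul, withDensity_apply _ hs]
    simp_rw [← lintegral_const_mul _ (hf _)]
    rw [← lintegral_finsetSum _ (fun i _ => (hf i).const_mul _), ← lintegral_add_left (by fun_prop)]
    simp_rw [add_tsub_cancel_of_le (hr _)]
    simp
  have hplan : γ ∈ transportPlans μ ν := by
    constructor
    · rw [hγ, Measure.map_add _ _ measurable_fst, Measure.map_smul, Measure.map_fst_prod,
        ← Measure.mapₗ_apply_of_measurable measurable_fst, map_sum]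
      simp only [Measure.mapₗ_apply_of_measurable measurable_fst, hΓ, Measure.map_smul,
        Measure.map_fst_prod, smul_smul, withDensity_apply _ MeasurableSet.univ, setLIntegral_univ]
      rw [hmν, ← hmμ]
      exact mar μ p μ' _ hpf rfl rfl (measure_ne_top _ _)
    · rw [hγ, Measure.map_add _ _ measurable_snd, Measure.map_smul, Measure.map_snd_prod,
        ← Measure.mapₗ_apply_of_measurable measurable_snd, map_sum]
      simp only [Measure.mapₗ_apply_of_measurable measurable_snd, hΓ, Measure.map_smul,
        Measure.map_snd_prod, smul_smul, withDensity_apply _ MeasurableSet.univ, setLIntegral_univ]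
      rw [hmμ, ← hmν]
      exact mar ν q ν' _ hqf rfl rfl (measure_ne_top _ _)
  refine (W2_le_of_mem_transportPlans hplan).trans ?_
  gcongr
  have hmle : 1 - ∑ i, min (a i) (b i) ≤ m := by
    rw [tsub_le_iff_left]
    exact hm
  have hcell : ∫⁻ z, ‖z.1 - z.2‖ₑ ^ 2 ∂(∑ i, Γ i) ≤ δ ^ 2 := by
    rw [lintegral_finsetSum_measure]
    have hone : ∀ i, ∫⁻ z, ‖z.1 - z.2‖ₑ ^ 2 ∂(Γ i) ≤ δ ^ 2 * a i := by
      intro i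
      have e : ∫⁻ z, ‖z.1 - z.2‖ₑ ^ 2 ∂((μ.meas.withDensity (f i)).prod (ν.meas.withDensity (f i)))
          ≤ δ ^ 2 * (a i * b i) := by
        rw [prod_withDensity (hf i) (hf i), lintegral_withDensity_eq_lintegral_mul _ (by
          exact ((hf i).comp measurable_fst).mul ((hf i).comp measurable_snd)) (by fun_prop)]
        calc _ ≤ ∫⁻ z, δ ^ 2 * (f i z.1 * f i z.2) ∂(μ.meas.prod ν.meas) := by
              refine lintegral_mono fun z => ?_
              simp only [Pi.mul_apply]
              by_cases h1 : f i z.1 = 0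
              · simp [h1]
              by_cases h2 : f i z.2 = 0
              · simp [h2]
              rw [mul_comm]
              gcongr
              exact hδ i _ _ h1 h2
          _ = _ := by
              rw [lintegral_const_mul _ (by fun_prop), lintegral_prod_mul (hf i).aemeasurable
                (hf i).aemeasurable]
      rw [hΓ, lintegral_smul_measure, smul_eq_mul]
      calc _ ≤ (M i)⁻¹ * (δ ^ 2 * (a i * b i)) := by gcongr
        _ = δ ^ 2 * (p i * a i) := by rw [hp]; ring
        _ ≤ _ := by gcongr; exact mul_le_of_le_one_left' (hp1 i)
    refine (Finset.sum_le_sum fun i _ => hone i).trans ?_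
    rw [← Finset.mul_sum]
    refine mul_le_of_le_one_right' ?_
    rw [ha, ← lintegral_finsetSum _ (fun i _ => hf i)]
    calc _ ≤ ∫⁻ _, 1 ∂μ.meas := lintegral_mono hsum
      _ = 1 := by simp
  -- The leftover has small mass but may sit far away. Splitting at radius `k`, the inner part costs
  -- `k² m` and the outer part is paid by the fourth moment.
  have tail : ∀ (ρ : P2 d) (g : Rd d → ℝ≥0∞), Measurable g → (∀ x, g x ≤ 1) →
      ∫⁻ x, ‖x‖ₑ ^ 4 ∂ρ.meas ≤ K → ρ.meas.withDensity g univ ≤ m →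
      ∫⁻ x, ‖x‖ₑ ^ 2 ∂(ρ.meas.withDensity g) ≤ k ^ 2 * m + K / k ^ 2 := by
    intro ρ g hg hg1 hρ hgm
    have hk2 : k ^ 2 ≠ 0 := pow_ne_zero _ hk
    have hk2' : k ^ 2 ≠ ⊤ := ENNReal.pow_ne_top hk'
    have hpt : ∀ x : Rd d, ‖x‖ₑ ^ 2 ≤ k ^ 2 + ‖x‖ₑ ^ 4 / k ^ 2 := by
      intro x
      rcases le_total (‖x‖ₑ) k with h | h
      · exact (pow_le_pow_left' h 2).trans le_self_add
      · refine le_add_of_le_right ?_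
        rw [ENNReal.le_div_iff_mul_le (Or.inl hk2) (Or.inl hk2')]
        calc ‖x‖ₑ ^ 2 * k ^ 2 ≤ ‖x‖ₑ ^ 2 * ‖x‖ₑ ^ 2 := by gcongr
          _ = _ := by ring
    calc _ ≤ ∫⁻ x, (k ^ 2 + ‖x‖ₑ ^ 4 / k ^ 2) ∂(ρ.meas.withDensity g) := lintegral_mono hpt
      _ = k ^ 2 * ρ.meas.withDensity g univ + (∫⁻ x, ‖x‖ₑ ^ 4 ∂(ρ.meas.withDensity g)) / k ^ 2 := by
          rw [lintegral_add_left (by fun_prop), lintegral_const]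
          simp_rw [div_eq_mul_inv]
          rw [lintegral_mul_const _ (by fun_prop)]
      _ ≤ _ := by
          gcongr
          rw [lintegral_withDensity_eq_lintegral_mul _ hg (by fun_prop)]
          refine le_trans (lintegral_mono fun x => ?_) hρ
          exact mul_le_of_le_one_left' (hg1 x)
  calc ∫⁻ z, ‖z.1 - z.2‖ₑ ^ 2 ∂γ
      = ∫⁻ z, ‖z.1 - z.2‖ₑ ^ 2 ∂(∑ i, Γ i)
        + (μ' univ)⁻¹ * ∫⁻ z, ‖z.1 - z.2‖ₑ ^ 2 ∂(μ'.prod ν') := by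
        rw [hγ, lintegral_add_measure, lintegral_smul_measure, smul_eq_mul]
    _ ≤ δ ^ 2 + 2 * ((k ^ 2 * m + K / k ^ 2) + (k ^ 2 * m + K / k ^ 2)) := by
        refine add_le_add hcell ((lintegral_prod_dist_sq_le (hmμ.trans hmν.symm)).trans ?_)
        gcongr
        · exact tail μ _ (by fun_prop) (fun x => tsub_le_self) hμ (hmμ.le.trans hmle)
        · exact tail ν _ (by fun_prop) (fun x => tsub_le_self) hν (hmν.le.trans hmle)
    _ = δ ^ 2 + 4 * (k ^ 2 * m + K / k ^ 2) := by ring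

end Wasserstein

/-! ### Testing closeness in `W2` on finitely many smooth functions. -/

section TestFunctions

variable {d : ℕ}

lemma exists_smooth_partition (R : ℝ) {δ : ℝ} (hδ : 0 < δ) :
    ∃ (n : ℕ) (f : Fin n → Rd d → ℝ), (∀ i, ContDiff ℝ ∞ (f i)) ∧ (∀ i, HasCompactSupport (f i)) ∧
      (∀ i x, 0 ≤ f i x) ∧ (∀ x, ∑ i, f i x ≤ 1) ∧
      (∀ x, ‖x‖ ≤ R → ∑ i, f i x = 1) ∧ ∀ i x y, f i x ≠ 0 → f i y ≠ 0 → ‖x - y‖ ≤ δ := by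
  obtain ⟨t, -, htf, ht⟩ := (isCompact_closedBall (0 : Rd d) R).finite_cover_balls
    (show 0 < δ / 4 by positivity)
  obtain ⟨n, ⟨e⟩⟩ := htf.exists_equiv_fin
  let g : ∀ i : Fin n, ContDiffBump ((e.symm i : t) : Rd d) := fun i =>
    ⟨δ / 4, δ / 2, by positivity, by linarith⟩
  -- Multiplying each bump by the complements of its predecessors makes the sum telescope to `1 - ∏
  -- (1 - g i)`, which is `1` wherever some bump equals `1`.
  let f : Fin n → Rd d → ℝ := fun i x => g i x * ∏ j ∈ Finset.univ with j < i, (1 - g j x)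
  have hprod : ∀ (s : Finset (Fin n)) x, 0 ≤ ∏ j ∈ s, (1 - g j x) := fun s x =>
    Finset.prod_nonneg fun j _ => sub_nonneg.2 (g j).le_one
  have hsum : ∀ x, ∑ i, f i x = 1 - ∏ i, (1 - g i x) := by
    intro x
    have := Finset.prod_one_sub_ordered (Finset.univ : Finset (Fin n)) (fun i => g i x)
    simp only [f]
    linarith
  refine ⟨n, f, fun i => ?_, fun i => ?_, fun i x => ?_, fun x => ?_, fun x hx => ?_, ?_⟩
  · exact (g i).contDiff.mul (contDiff_prod fun j _ => contDiff_const.sub (g j).contDiff)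
  · exact (g i).hasCompactSupport.mul_right
  · exact mul_nonneg (g i).nonneg (hprod _ x)
  · rw [hsum]
    linarith [hprod Finset.univ x]
  · rw [hsum]
    have hx' := ht (mem_closedBall_zero_iff.2 hx)
    simp only [mem_iUnion] at hx'
    obtain ⟨y, hy, hxy⟩ := hx'
    have h1 : g (e ⟨y, hy⟩) x = 1 := by
      apply (g (e ⟨y, hy⟩)).one_of_mem_closedBall
      simp only [Equiv.symm_apply_apply, g]
      exact Metric.ball_subset_closedBall hxy
    rw [Finset.prod_eq_zero (Finset.mem_univ (e ⟨y, hy⟩)) (by rw [h1, sub_self]), sub_zero]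
  · intro i x y hx hy
    have key : ∀ z, f i z ≠ 0 → dist z ((e.symm i : t) : Rd d) < δ / 2 := by
      intro z hz
      have : z ∈ Function.support (g i) := left_ne_zero_of_mul hz
      rw [(g i).support_eq] at this
      exact this
    rw [← dist_eq_norm]
    linarith [dist_triangle_right x y ((e.symm i : t) : Rd d), key x hx, key y hy]

/-- Closeness in `W₂` of measures with bounded fourth moments can be tested on finitely many
smooth compactly supported functions. -/
theorem exists_test_functions_W2_le (d : ℕ) (K : ℝ≥0) {η : ℝ≥0} (hη : 0 < η) :
    ∃ (n : ℕ) (f : Fin n → Rd d → ℝ) (ρ : ℝ), 0 < ρ ∧ (∀ i, ContDiff ℝ ∞ (f i)) ∧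
      (∀ i, HasCompactSupport (f i)) ∧ ∀ μ ν : P2 d, ∫⁻ x, ‖x‖ₑ ^ 4 ∂μ.meas ≤ K →
        ∫⁻ x, ‖x‖ₑ ^ 4 ∂ν.meas ≤ K →
        (∀ i, |∫ x, f i x ∂μ.meas - ∫ x, f i x ∂ν.meas| ≤ ρ) → W2 μ ν ≤ η := by
  -- The constants make `K / k² ≤ η²/16` and `k² m = η²/16`, so with cells of diameter `η/2` the
  -- squared cost is at most `η²/4 + 4 (η²/8) = 3η²/4`. The unmatched mass `m` is split equally: `R`
  -- keeps the mass outside the ball below `m/2`, and `ρ` makes the sum of the `n` test errors at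
  -- most `m/2`.
  set k : ℝ≥0 := 4 * (K + 1) / η with hk
  have hk0 : 0 < k := by positivity
  set m : ℝ≥0 := η ^ 2 / (16 * k ^ 2) with hm
  have hm0 : 0 < m := by positivity
  set R : ℝ≥0 := 2 * K / m + 1 with hR
  have hR1 : 1 ≤ R := le_add_self
  have hKR : K / R ^ 4 ≤ m / 2 := by
    rw [div_le_iff₀ (by positivity)]
    calc K = m / 2 * (2 * K / m) := by field_simp
      _ ≤ m / 2 * R := by gcongr; exact le_self_add
      _ ≤ m / 2 * R ^ 4 := by gcongr; exact le_self_pow₀ hR1 (by norm_num)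
  have hδ : 0 < η / 2 := by positivity
  obtain ⟨n, f, hfs, hfc, hf0, hf1, hfR, hfδ⟩ :=
    exists_smooth_partition (d := d) R (show (0 : ℝ) < (η / 2 : ℝ≥0) from hδ)
  set ρ : ℝ≥0 := m / (2 * (n + 1)) with hρ
  have hρ0 : 0 < ρ := by positivity
  refine ⟨n, f, ρ, hρ0, hfs, hfc, fun μ ν hμ hν hμν => ?_⟩
  have hfm : ∀ i, Measurable fun x => ENNReal.ofReal (f i x) := fun i =>
    (hfs i).continuous.measurable.ennreal_ofReal
  have hintg : ∀ (τ : P2 d) i, ∫⁻ x, ENNReal.ofReal (f i x) ∂τ.meas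
      = ENNReal.ofReal (∫ x, f i x ∂τ.meas) := fun τ i =>
    (ofReal_integral_eq_lintegral_ofReal ((hfs i).continuous.integrable_of_hasCompactSupport (hfc i))
      (ae_of_all _ (hf0 i))).symm
  have hsum : ∀ x, ∑ i, ENNReal.ofReal (f i x) = ENNReal.ofReal (∑ i, f i x) := fun x =>
    (ENNReal.ofReal_sum_of_nonneg fun i _ => hf0 i x).symm
  have key := W2_sq_le_of_partition (μ := μ) (ν := ν) (f := fun i x => ENNReal.ofReal (f i x))
    hfm (fun x => by rw [hsum]; simpa using hf1 x) (δ := (η / 2 : ℝ≥0)) (k := k) (m := m) (K := K)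
    (by exact_mod_cast hk0.ne') ENNReal.coe_ne_top (fun i x y hx hy => ?_) hμ hν ?_
  · refine key.trans ?_
    have hreal : (η / 2) ^ 2 + 4 * (k ^ 2 * m + K / k ^ 2) ≤ η ^ 2 := by
      have e1 : k ^ 2 * m = η ^ 2 / 16 := by rw [hm]; field_simp
      have e2 : K / k ^ 2 ≤ η ^ 2 / 16 := by
        rw [div_le_iff₀ (by positivity), hk]
        have : η ^ 2 / 16 * (4 * (K + 1) / η) ^ 2 = (K + 1) ^ 2 := by field_simp; norm_num
        rw [this]
        calc K ≤ K + 1 := le_self_add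
          _ ≤ (K + 1) ^ 2 := le_self_pow₀ le_add_self (by norm_num)
      calc (η / 2) ^ 2 + 4 * (k ^ 2 * m + K / k ^ 2)
          ≤ (η / 2) ^ 2 + 4 * (η ^ 2 / 16 + η ^ 2 / 16) := by rw [e1]; gcongr
        _ = 3 / 4 * η ^ 2 := by rw [← NNReal.coe_inj]; push_cast; ring
        _ ≤ 1 * η ^ 2 := by
            gcongr
            rw [← NNReal.coe_le_coe]; norm_num
        _ = η ^ 2 := one_mul _
    have hE : ((η / 2 : ℝ≥0) : ℝ≥0∞) ^ 2 + 4 * ((k : ℝ≥0∞) ^ 2 * m + K / (k : ℝ≥0∞) ^ 2)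
        ≤ (η : ℝ≥0∞) ^ 2 := by
      rw [← ENNReal.coe_pow k, ← ENNReal.coe_div (by positivity)]
      exact_mod_cast hreal
    calc _ ≤ ((η : ℝ≥0∞) ^ 2) ^ (1 / 2 : ℝ) := by gcongr
      _ = η := by
        rw [← ENNReal.rpow_natCast, ← ENNReal.rpow_mul]
        norm_num
  · have hx' : f i x ≠ 0 := fun h => hx (by simp [h])
    have hy' : f i y ≠ 0 := fun h => hy (by simp [h])
    rw [← ofReal_norm, ENNReal.ofReal_le_iff_le_toReal ENNReal.coe_ne_top]
    exact hfδ i x y hx' hy'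
  · have h1 : (1 : ℝ≥0∞) ≤ ∑ i, ∫⁻ x, ENNReal.ofReal (f i x) ∂μ.meas + (m / 2 : ℝ≥0) := by
      have hpt : ∀ x : Rd d, 1 ≤ ∑ i, ENNReal.ofReal (f i x) + ‖x‖ₑ ^ 4 / (R : ℝ≥0∞) ^ 4 := by
        intro x
        rcases le_total ‖x‖ R with h | h
        · rw [hsum, hfR x h]; simp
        · refine le_add_of_le_right ?_
          rw [ENNReal.le_div_iff_mul_le (by left; positivity) (by left; finiteness), one_mul]
          gcongr
          rw [← ofReal_norm]
          simpa using ENNReal.ofReal_le_ofReal h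
      calc (1 : ℝ≥0∞) = ∫⁻ _, 1 ∂μ.meas := by simp
        _ ≤ ∫⁻ x, (∑ i, ENNReal.ofReal (f i x) + ‖x‖ₑ ^ 4 / (R : ℝ≥0∞) ^ 4) ∂μ.meas :=
            lintegral_mono hpt
        _ = ∑ i, ∫⁻ x, ENNReal.ofReal (f i x) ∂μ.meas
              + (∫⁻ x, ‖x‖ₑ ^ 4 ∂μ.meas) / (R : ℝ≥0∞) ^ 4 := by
            rw [lintegral_add_left (by fun_prop), lintegral_finsetSum _ (fun i _ => hfm i)]
            simp_rw [div_eq_mul_inv]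
            rw [lintegral_mul_const _ (by fun_prop)]
        _ ≤ _ := by
            gcongr
            calc _ ≤ (K : ℝ≥0∞) / (R : ℝ≥0∞) ^ 4 := by gcongr
              _ = ((K / R ^ 4 : ℝ≥0) : ℝ≥0∞) := by
                rw [ENNReal.coe_div (by positivity), ENNReal.coe_pow]
              _ ≤ _ := by exact_mod_cast hKR
    have h2 : ∀ i, ∫⁻ x, ENNReal.ofReal (f i x) ∂μ.meas
        ≤ min (∫⁻ x, ENNReal.ofReal (f i x) ∂μ.meas) (∫⁻ x, ENNReal.ofReal (f i x) ∂ν.meas) + ρ := by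
      intro i
      rw [min_add]
      refine le_min le_self_add ?_
      rw [hintg, hintg, ← ENNReal.ofReal_coe_nnreal,
        ← ENNReal.ofReal_add (integral_nonneg fun x => hf0 i x) ρ.coe_nonneg]
      refine ENNReal.ofReal_le_ofReal ?_
      linarith [(abs_le.1 (hμν i)).2]
    refine h1.trans ?_
    calc _ ≤ ∑ i, (min (∫⁻ x, ENNReal.ofReal (f i x) ∂μ.meas)
            (∫⁻ x, ENNReal.ofReal (f i x) ∂ν.meas) + ρ) + (m / 2 : ℝ≥0) := by
          gcongr with i; exact h2 i
      _ = ∑ i, min (∫⁻ x, ENNReal.ofReal (f i x) ∂μ.meas)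
            (∫⁻ x, ENNReal.ofReal (f i x) ∂ν.meas) + ((n * ρ + m / 2 : ℝ≥0) : ℝ≥0∞) := by
          rw [Finset.sum_add_distrib]; simp [add_assoc]
      _ ≤ _ := by
          gcongr
          have : n * ρ ≤ m / 2 := by
            rw [hρ]
            calc n * (m / (2 * (n + 1))) = m / 2 * (n / (n + 1)) := by field_simp
              _ ≤ m / 2 * 1 := by
                gcongr
                exact div_le_one_of_le₀ le_self_add (by positivity)
              _ = m / 2 := mul_one _
          calc n * ρ + m / 2 ≤ m / 2 + m / 2 := by gcongr
            _ = m := add_halves m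

lemma integrable_norm_pow_four {μ : P2 d} {K : ℝ≥0} (h : ∫⁻ x, ‖x‖ₑ ^ 4 ∂μ.meas ≤ K) :
    Integrable (fun x => ‖x‖ ^ 4) μ.meas := by
  refine ⟨by fun_prop, ?_⟩
  rw [hasFiniteIntegral_iff_enorm]
  refine lt_of_le_of_lt (le_of_eq_of_le ?_ h) ENNReal.coe_lt_top
  simp

lemma integral_norm_pow_four_le {μ : P2 d} {K : ℝ≥0} (h : ∫⁻ x, ‖x‖ₑ ^ 4 ∂μ.meas ≤ K) :
    ∫ x, ‖x‖ ^ 4 ∂μ.meas ≤ K := by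
  rw [integral_eq_lintegral_of_nonneg_ae (ae_of_all _ fun x => by positivity) (by fun_prop)]
  refine ENNReal.toReal_le_of_le_ofReal K.2 ?_
  simpa [ENNReal.ofReal_pow] using h

/-- Integrals of locally Lipschitz functions with linearly growing constant are close for measures
which are close in `W₂`. -/
lemma abs_integral_sub_le_of_W2_lt {μ ν : P2 d} {K : ℝ≥0} (hμ : ∫⁻ x, ‖x‖ₑ ^ 4 ∂μ.meas ≤ K)
    {θ : ℝ} (hθ : 0 < θ) (hW : W2 μ ν < ENNReal.ofReal θ) {F : Rd d → ℝ} {C : ℝ} (hC : 0 ≤ C)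
    (hFμ : Integrable F μ.meas) (hFν : Integrable F ν.meas)
    (hF : ∀ x y, |F x - F y| ≤ C * (1 + ‖x‖) * ‖x - y‖) :
    |∫ x, F x ∂μ.meas - ∫ x, F x ∂ν.meas| ≤ C * θ * (4 + K) := by
  unfold W2 at hW
  simp only [iInf_lt_iff] at hW
  obtain ⟨γ, hγ, hγθ⟩ := hW
  have := isProbabilityMeasure_of_mem_transportPlans hγ
  have hcost : ∫⁻ z, ‖z.1 - z.2‖ₑ ^ 2 ∂γ ≤ ENNReal.ofReal (θ ^ 2) := by
    have := ENNReal.rpow_le_rpow hγθ.le (show (0 : ℝ) ≤ 2 by norm_num)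
    rw [← ENNReal.rpow_mul, ENNReal.ofReal_rpow_of_pos hθ] at this
    simpa using this
  have hI2 : Integrable (fun z : Rd d × Rd d => ‖z.1 - z.2‖ ^ 2) γ := by
    refine ⟨by fun_prop, ?_⟩
    rw [hasFiniteIntegral_iff_enorm]
    refine lt_of_le_of_lt (le_of_eq_of_le ?_ hcost) ENNReal.ofReal_lt_top
    simp
  have hB2 : ∫ z, ‖z.1 - z.2‖ ^ 2 ∂γ ≤ θ ^ 2 := by
    rw [integral_eq_lintegral_of_nonneg_ae (ae_of_all _ fun x => by positivity) (by fun_prop)]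
    refine ENNReal.toReal_le_of_le_ofReal (by positivity) ?_
    simpa [ENNReal.ofReal_pow] using hcost
  have hI4 : Integrable (fun z : Rd d × Rd d => ‖z.1‖ ^ 4) γ := by
    have := integrable_norm_pow_four hμ
    rw [← hγ.1] at this
    exact this.comp_measurable measurable_fst
  have hB4 : ∫ z, ‖z.1‖ ^ 4 ∂γ ≤ K := by
    have := integral_norm_pow_four_le hμ
    rw [← hγ.1, integral_map measurable_fst.aemeasurable (by fun_prop)] at this
    exact this
  have e1 : ∫ x, F x ∂μ.meas = ∫ z, F z.1 ∂γ := by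
    rw [← hγ.1] at hFμ ⊢
    exact integral_map measurable_fst.aemeasurable hFμ.aestronglyMeasurable
  have e2 : ∫ x, F x ∂ν.meas = ∫ z, F z.2 ∂γ := by
    rw [← hγ.2] at hFν ⊢
    exact integral_map measurable_snd.aemeasurable hFν.aestronglyMeasurable
  have i1 : Integrable (fun z : Rd d × Rd d => F z.1) γ := by
    rw [← hγ.1] at hFμ
    exact hFμ.comp_measurable measurable_fst
  have i2 : Integrable (fun z : Rd d × Rd d => F z.2) γ := by
    rw [← hγ.2] at hFν
    exact hFν.comp_measurable measurable_snd
  rw [e1, e2, ← integral_sub i1 i2, ← Real.norm_eq_abs]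
  have hI3 : Integrable (fun z : Rd d × Rd d => 3 + ‖z.1‖ ^ 4) γ :=
    (integrable_const (3 : ℝ)).add hI4
  have hdom : Integrable (fun z : Rd d × Rd d =>
      C * (θ * (3 + ‖z.1‖ ^ 4) + θ⁻¹ * ‖z.1 - z.2‖ ^ 2)) γ :=
    ((hI3.const_mul θ).add (hI2.const_mul θ⁻¹)).const_mul C
  refine (norm_integral_le_of_norm_le hdom (ae_of_all _ fun z => ?_)).trans ?_
  · rw [Real.norm_eq_abs]
    refine (hF z.1 z.2).trans ?_
    rw [mul_assoc]
    gcongr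
    -- Young's inequality with weight `θ` balances the two factors: the squared cost is at most
    -- `θ²`, so both terms become of order `θ`.
    have h1 : (1 + ‖z.1‖) * ‖z.1 - z.2‖ ≤ θ * (1 + ‖z.1‖) ^ 2 + θ⁻¹ * ‖z.1 - z.2‖ ^ 2 := by
      have := sq_nonneg (θ * (1 + ‖z.1‖) - ‖z.1 - z.2‖)
      have h0 : 0 ≤ (1 + ‖z.1‖) * ‖z.1 - z.2‖ := by positivity
      have : 0 ≤ θ⁻¹ * (θ * (1 + ‖z.1‖) - ‖z.1 - z.2‖) ^ 2 := by positivity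
      have e : θ⁻¹ * (θ * (1 + ‖z.1‖) - ‖z.1 - z.2‖) ^ 2 = θ * (1 + ‖z.1‖) ^ 2
        - 2 * ((1 + ‖z.1‖) * ‖z.1 - z.2‖) + θ⁻¹ * ‖z.1 - z.2‖ ^ 2 := by field_simp; ring
      linarith
    refine h1.trans ?_
    gcongr
    nlinarith [sq_nonneg (‖z.1‖ ^ 2 - 1), sq_nonneg (‖z.1‖ - 1)]
  · rw [integral_const_mul, integral_add (hI3.const_mul θ) (hI2.const_mul θ⁻¹),
      integral_const_mul, integral_const_mul, integral_add (integrable_const _) hI4]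
    simp only [integral_const, probReal_univ, smul_eq_mul, one_mul]
    rw [mul_assoc]
    gcongr
    calc θ * (3 + ∫ z, ‖z.1‖ ^ 4 ∂γ) + θ⁻¹ * ∫ z, ‖z.1 - z.2‖ ^ 2 ∂γ
        ≤ θ * (3 + K) + θ⁻¹ * θ ^ 2 := by gcongr
      _ = θ * (4 + K) := by field_simp; ring

end TestFunctions

/-! ### Measurability in time along weakly continuous curves. -/

section Measurability

variable {d : ℕ} {T : ℝ}

lemma continuousOn_integral_bounded {s : Set ℝ} {μ : ℝ → P2 d} (hμ : ContinuousOn μ s)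
    {f : Rd d → ℝ} (hf : Continuous f) {C : ℝ} (hC : ∀ x, |f x| ≤ C) :
    ContinuousOn (fun t => ∫ x, f x ∂(μ t).meas) s := by
  let g : BoundedContinuousFunction (Rd d) ℝ := BoundedContinuousFunction.ofNormedAddCommGroup f hf C hC
  intro t ht
  have h1 : Tendsto (fun t => (μ t).1) (𝓝[s] t) (𝓝 (μ t).1) :=
    (continuous_subtype_val.tendsto (μ t)).comp (hμ t ht)
  exact (ProbabilityMeasure.tendsto_iff_forall_integral_tendsto.1 h1) g

/-- Closed sets form a generating π-system, and the measure of a closed set is a limit of integrals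
of continuous functions, each continuous in `t`. -/
lemma measurable_meas_of_continuous {μ : ℝ → P2 d} (hμ : Continuous μ) :
    Measurable fun t => (μ t).meas := by
  have hgen : (inferInstance : MeasurableSpace (Rd d)) = .generateFrom {s | IsClosed s} :=
    (BorelSpace.measurable_eq (α := Rd d)).trans borel_eq_generateFrom_isClosed
  refine Measurable.measure_of_isPiSystem_of_isProbabilityMeasure hgen isPiSystem_isClosed fun F hF => ?_
  have hF' : IsClosed F := hF
  refine measurable_of_tendsto_metrizable
    (f := fun n t => ∫⁻ x, (hF'.apprSeq n x : ℝ≥0∞) ∂(μ t).meas) (fun n => ?_) ?_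
  · have : Continuous fun t => ∫⁻ x, (hF'.apprSeq n x : ℝ≥0∞) ∂(μ t).meas := by
      rw [continuous_iff_continuousAt]
      intro t
      have h1 : Tendsto (fun t => (μ t).1) (𝓝 t) (𝓝 (μ t).1) :=
        (continuous_subtype_val.tendsto (μ t)).comp (hμ.tendsto t)
      exact (ProbabilityMeasure.tendsto_iff_forall_lintegral_tendsto.1 h1) _
    exact this.measurable
  · rw [tendsto_pi_nhds]
    intro t
    exact HasOuterApproxClosed.tendsto_lintegral_apprSeq hF' (μ t).meas

/-- The curve `μ`, extended from `[0,T]` by constants. -/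
def extendCurve (hT : 0 ≤ T) (μ : ℝ → P2 d) (t : ℝ) : P2 d := μ (projIcc 0 T hT t)

lemma continuous_extendCurve (hT : 0 ≤ T) {μ : ℝ → P2 d} (hμ : ContinuousOn μ (Icc 0 T)) :
    Continuous (extendCurve hT μ) :=
  (continuousOn_iff_continuous_domRestrict.1 hμ).comp continuous_projIcc

lemma extendCurve_of_mem (hT : 0 ≤ T) (μ : ℝ → P2 d) {t : ℝ} (ht : t ∈ Icc 0 T) :
    extendCurve hT μ t = μ t := by
  rw [extendCurve, projIcc_of_mem hT ht]

/-- The kernel `t ↦ μ_t` of a weakly continuous curve. -/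
def curveKernel (hT : 0 ≤ T) {μ : ℝ → P2 d} (hμ : ContinuousOn μ (Icc 0 T)) :
    ProbabilityTheory.Kernel ℝ (Rd d) where
  toFun t := (extendCurve hT μ t).meas
  measurable' := measurable_meas_of_continuous (continuous_extendCurve hT hμ)

instance (hT : 0 ≤ T) {μ : ℝ → P2 d} (hμ : ContinuousOn μ (Icc 0 T)) :
    ProbabilityTheory.IsMarkovKernel (curveKernel hT hμ) :=
  ⟨fun t => (extendCurve hT μ t).isProbabilityMeasure_meas⟩

lemma curveKernel_apply (hT : 0 ≤ T) {μ : ℝ → P2 d} (hμ : ContinuousOn μ (Icc 0 T)) {t : ℝ}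
    (ht : t ∈ Icc 0 T) : curveKernel hT hμ t = (μ t).meas := by
  change (extendCurve hT μ t).meas = _
  rw [extendCurve_of_mem hT μ ht]

lemma aestronglyMeasurable_integral_curve {G : Type*} [NormedAddCommGroup G] [NormedSpace ℝ G]
    (hT : 0 ≤ T) {μ : ℝ → P2 d}
    (hμ : ContinuousOn μ (Icc 0 T)) {f : ℝ → Rd d → G}
    (hf : StronglyMeasurable (Function.uncurry f)) :
    AEStronglyMeasurable (fun t => ∫ x, f t x ∂(μ t).meas) (volume.restrict (Icc 0 T)) := by
  refine AEStronglyMeasurable.congr (f := fun t => ∫ x, f t x ∂(curveKernel hT hμ t))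
    (StronglyMeasurable.integral_kernel_prod_right hf).aestronglyMeasurable ?_
  filter_upwards [ae_restrict_mem measurableSet_Icc] with t ht
  rw [curveKernel_apply hT hμ ht]

/-- The image of a measure in `𝒫₂` by a measurable map with linear growth. -/
def P2.map (μ : P2 d) (f : Rd d → Rd d) (hf : Measurable f) (C : ℝ≥0)
    (h : ∀ x, ‖f x‖ ≤ C * (1 + ‖x‖)) : P2 d :=
  ⟨μ.1.map hf.aemeasurable, by
    have hlt : ∫⁻ x, ‖x‖ₑ ^ 2 ∂μ.meas < ⊤ := μ.2
    have e : ∫⁻ x, ‖x‖ₑ ^ 2 ∂(μ.1.map hf.aemeasurable : Measure (Rd d))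
        = ∫⁻ x, ‖f x‖ₑ ^ 2 ∂μ.meas := by
      rw [ProbabilityMeasure.toMeasure_map, lintegral_map (by fun_prop) hf]
      rfl
    rw [e]
    have hle : ∀ x, ‖f x‖ₑ ^ 2 ≤ 2 * (C : ℝ≥0∞) ^ 2 * (1 + ‖x‖ₑ ^ 2) := by
      intro x
      have h1 : ‖f x‖ ^ 2 ≤ 2 * (C : ℝ) ^ 2 * (1 + ‖x‖ ^ 2) := by
        have h2 := pow_le_pow_left₀ (norm_nonneg _) (h x) 2
        have h3 : (C * (1 + ‖x‖)) ^ 2 ≤ 2 * (C : ℝ) ^ 2 * (1 + ‖x‖ ^ 2) := by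
          have := mul_nonneg (sq_nonneg (C : ℝ)) (sq_nonneg (1 - ‖x‖))
          nlinarith
        exact h2.trans h3
      have := ENNReal.ofReal_le_ofReal h1
      rw [ENNReal.ofReal_pow (norm_nonneg _), ofReal_norm,
        ENNReal.ofReal_mul (by positivity), ENNReal.ofReal_mul (by norm_num),
        ENNReal.ofReal_pow C.coe_nonneg, ENNReal.ofReal_add (by norm_num) (by positivity),
        ENNReal.ofReal_pow (norm_nonneg _), ofReal_norm] at this
      simpa using this
    refine lt_of_le_of_lt (lintegral_mono hle) ?_
    rw [lintegral_const_mul _ (by fun_prop), lintegral_add_left (by fun_prop)]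
    simp only [lintegral_const, measure_univ, mul_one]
    exact ENNReal.mul_lt_top (by finiteness) (ENNReal.add_lt_top.2 ⟨by finiteness, hlt⟩)⟩

lemma P2.meas_map (μ : P2 d) (f : Rd d → Rd d) (hf : Measurable f) (C : ℝ≥0)
    (h : ∀ x, ‖f x‖ ≤ C * (1 + ‖x‖)) : (μ.map f hf C h).meas = μ.meas.map f := rfl

/-- A curve continuous for `W₂` on `[0,T]`. -/
def W2ContinuousOn (T : ℝ) (σ : ℝ → P2 d) : Prop :=
  ∀ t ∈ Icc 0 T, ∀ η : ℝ≥0, 0 < η → ∃ δ > 0, ∀ s ∈ Icc 0 T, |s - t| < δ → W2 (σ s) (σ t) ≤ η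

/-- Only finitely many integrals of test functions have to be close, and these are continuous in
time. -/
lemma W2ContinuousOn_of_moment {σ : ℝ → P2 d} (hσ : ContinuousOn σ (Icc 0 T)) {K : ℝ≥0}
    (hK : ∀ t ∈ Icc 0 T, ∫⁻ x, ‖x‖ₑ ^ 4 ∂(σ t).meas ≤ K) : W2ContinuousOn T σ := by
  intro t ht η hη
  obtain ⟨n, f, ρ, hρ, hfs, hfc, hf⟩ := exists_test_functions_W2_le d K hη
  have hev : ∀ i, ∀ᶠ s in 𝓝[Icc 0 T] t,
      |∫ x, f i x ∂(σ s).meas - ∫ x, f i x ∂(σ t).meas| ≤ ρ := by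
    intro i
    obtain ⟨C, hC⟩ := (hfc i).exists_bound_of_continuous (hfs i).continuous
    have := continuousOn_integral_bounded hσ (hfs i).continuous hC t ht
    have := Metric.tendsto_nhds.1 this ρ hρ
    filter_upwards [this] with s hs
    exact hs.le
  rw [← eventually_all, eventually_nhdsWithin_iff] at hev
  obtain ⟨δ, hδ, h⟩ := Metric.eventually_nhds_iff.1 hev
  exact ⟨δ, hδ, fun s hs hst => hf _ _ (hK s hs) (hK t ht) (h hst hs)⟩

lemma tendsto_velocity {b : ℝ → Rd d → P2 d → Rd d} (hb : IsVelocityField T b) {t : ℝ}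
    (ht : t ∈ Icc 0 T) (x : Rd d) {σ : ℕ → P2 d} {σ' : P2 d}
    (h : Tendsto (fun n => W2 (σ n) σ') atTop (𝓝 0)) :
    Tendsto (fun n => b t x (σ n)) atTop (𝓝 (b t x σ')) := by
  obtain ⟨L, hL⟩ := hb.lipschitz
  rw [tendsto_iff_edist_tendsto_0]
  have h2 : Tendsto (fun n => (L : ℝ≥0∞) * W2 (σ n) σ') atTop (𝓝 0) := by
    have := ENNReal.Tendsto.const_mul h (Or.inr (ENNReal.coe_ne_top (r := L)))
    simpa using this
  refine tendsto_of_tendsto_of_tendsto_of_le_of_le tendsto_const_nhds h2 (fun n => zero_le) ?_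
  intro n
  simp only [edist_eq_enorm_sub]
  simpa using hL t ht x x (σ n) σ'

/-- The measure argument is frozen on the grid of mesh `1/(n+1)`. Only countably many frozen
measures occur, so measurability for a fixed measure applies, and `W2`-continuity gives convergence
as `n → ∞`. -/
lemma aemeasurable_velocity_of_W2ContinuousOn {b : ℝ → Rd d → P2 d → Rd d}
    (hb : IsVelocityField T b) {σ : ℝ → P2 d} (hσ : W2ContinuousOn T σ) (x : Rd d) :
    AEMeasurable (fun t => b t x (σ t)) (volume.restrict (Icc 0 T)) := by
  refine aemeasurable_of_tendsto_metrizable_ae atTop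
    (f := fun (n : ℕ) t => b t x (σ (⌊((n : ℝ) + 1) * t⌋₊ / ((n : ℝ) + 1)))) (fun n => ?_) ?_
  · have h : ∀ k : ℕ, ∃ g : ℝ → Rd d, Measurable g ∧
        (fun t => b t x (σ ((k : ℝ) / ((n : ℝ) + 1)))) =ᵐ[volume.restrict (Icc 0 T)] g :=
      fun k => hb.measurable_time x (σ ((k : ℝ) / ((n : ℝ) + 1)))
    choose g hg hgae using h
    refine ⟨fun t => g ⌊((n : ℝ) + 1) * t⌋₊ t, ?_, ?_⟩
    · have h1 : Measurable fun z : ℕ × ℝ => g z.1 z.2 :=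
        measurable_from_prod_countable_right hg
      exact h1.comp ((Nat.measurable_floor.comp (measurable_const_mul _)).prodMk measurable_id)
    · filter_upwards [ae_all_iff.2 hgae] with t ht
      exact ht _
  · filter_upwards [ae_restrict_mem measurableSet_Icc] with t ht
    refine tendsto_velocity hb ht x ?_
    rw [ENNReal.tendsto_nhds_zero]
    intro e he
    obtain ⟨η, hη, hηe⟩ := ENNReal.lt_iff_exists_nnreal_btwn.1 he
    obtain ⟨δ, hδ, h⟩ := hσ t ht η (by exact_mod_cast hη)
    obtain ⟨N, hN⟩ := exists_nat_one_div_lt hδ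
    filter_upwards [eventually_ge_atTop N] with n hn
    have hn0 : (0 : ℝ) < (n : ℝ) + 1 := by positivity
    have hle : (⌊((n : ℝ) + 1) * t⌋₊ : ℝ) ≤ ((n : ℝ) + 1) * t :=
      Nat.floor_le (mul_nonneg hn0.le ht.1)
    have hlt : ((n : ℝ) + 1) * t < ⌊((n : ℝ) + 1) * t⌋₊ + 1 := Nat.lt_floor_add_one _
    have h1 : (⌊((n : ℝ) + 1) * t⌋₊ : ℝ) / ((n : ℝ) + 1) ≤ t := by
      rw [div_le_iff₀ hn0]; linarith
    have h2 : t - 1 / ((n : ℝ) + 1) < (⌊((n : ℝ) + 1) * t⌋₊ : ℝ) / ((n : ℝ) + 1) := by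
      rw [lt_div_iff₀ hn0, sub_mul, one_div_mul_cancel hn0.ne']; linarith
    have h3 : 1 / ((n : ℝ) + 1) ≤ 1 / ((N : ℝ) + 1) := by gcongr
    refine (h _ ⟨by positivity, h1.trans ht.2⟩ ?_).trans hηe.le
    rw [abs_lt]
    constructor <;> linarith

/-- A weakly continuous curve need not be `W2`-continuous, because second moments may jump. The
images of `μ_t` under the bounded maps `y ↦ χ_n(y) y` have bounded fourth moments, hence are
`W2`-continuous in time. For fixed `t` they converge to `μ_t` in `W2` by dominated convergence. -/
lemma aemeasurable_velocity {b : ℝ → Rd d → P2 d → Rd d}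
    (hb : IsVelocityField T b) {μ : ℝ → P2 d} (hμ : ContinuousOn μ (Icc 0 T)) (x : Rd d) :
    AEMeasurable (fun t => b t x (μ t)) (volume.restrict (Icc 0 T)) := by
  let χ : ℕ → ContDiffBump (0 : Rd d) := fun n =>
    ⟨(n : ℝ) + 1, (n : ℝ) + 2, by positivity, by linarith⟩
  let θ : ℕ → Rd d → Rd d := fun n y => χ n y • y
  have hθc : ∀ n, Continuous (θ n) := fun n => (χ n).continuous.smul continuous_id
  have hχ : ∀ n y, |χ n y| ≤ 1 := fun n y => by
    rw [abs_of_nonneg (χ n).nonneg]; exact (χ n).le_one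
  have hθ1 : ∀ n y, ‖θ n y‖ ≤ ((1 : ℝ≥0) : ℝ) * (1 + ‖y‖) := by
    intro n y
    simp only [θ, norm_smul, Real.norm_eq_abs]
    have := mul_le_of_le_one_left (norm_nonneg y) (hχ n y)
    simp
    linarith
  have hθb : ∀ n y, ‖θ n y‖ ≤ (n : ℝ) + 2 := by
    intro n y
    by_cases hy : y ∈ Metric.ball (0 : Rd d) ((n : ℝ) + 2)
    · simp only [θ, norm_smul, Real.norm_eq_abs]
      have := mul_le_of_le_one_left (norm_nonneg y) (hχ n y)
      have := mem_ball_zero_iff.1 hy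
      linarith
    · have : χ n y = 0 := by
        rw [← Function.notMem_support, (χ n).support_eq]
        exact hy
      simp only [θ, this, zero_smul, norm_zero]
      positivity
  let σ : ℕ → ℝ → P2 d := fun n t => (μ t).map (θ n) (hθc n).measurable 1 (hθ1 n)
  have hσ : ∀ n, W2ContinuousOn T (σ n) := by
    intro n
    have hK : ∀ t ∈ Icc 0 T, ∫⁻ x, ‖x‖ₑ ^ 4 ∂(σ n t).meas ≤ (((n : ℝ≥0) + 2) ^ 4 : ℝ≥0) := by
      intro t _
      simp only [σ, P2.meas_map]
      rw [lintegral_map (by fun_prop) (hθc n).measurable]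
      calc _ ≤ ∫⁻ _, (((n : ℝ≥0) + 2) ^ 4 : ℝ≥0) ∂(μ t).meas := by
            refine lintegral_mono fun y => ?_
            rw [← ofReal_norm, ENNReal.coe_pow]
            gcongr
            rw [← ENNReal.ofReal_coe_nnreal]
            exact ENNReal.ofReal_le_ofReal ((hθb n y).trans (by push_cast; rfl))
        _ = _ := by simp
    refine W2ContinuousOn_of_moment ?_ hK
    intro t ht
    have h1 : Tendsto (fun t => (μ t).1) (𝓝[Icc 0 T] t) (𝓝 (μ t).1) :=
      (continuous_subtype_val.tendsto (μ t)).comp (hμ t ht)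
    refine tendsto_subtype_rng.2 ?_
    exact ProbabilityMeasure.tendsto_map_of_tendsto_of_continuous _ _ h1 (hθc n)
  refine aemeasurable_of_tendsto_metrizable_ae atTop (f := fun n t => b t x (σ n t))
    (fun n => aemeasurable_velocity_of_W2ContinuousOn hb (hσ n) x) ?_
  filter_upwards [ae_restrict_mem measurableSet_Icc] with t ht
  refine tendsto_velocity hb ht x ?_
  have hle : ∀ n, W2 (σ n t) (μ t) ≤ (∫⁻ y, ‖θ n y - y‖ₑ ^ 2 ∂(μ t).meas) ^ (1 / 2 : ℝ) := fun n =>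
    W2_le_of_map_eq (hθc n).measurable measurable_id rfl Measure.map_id
  have hlim : Tendsto (fun n => ∫⁻ y, ‖θ n y - y‖ₑ ^ 2 ∂(μ t).meas) atTop (𝓝 0) := by
    have h0 : ∫⁻ _, 0 ∂(μ t).meas = 0 := by simp
    rw [← h0]
    refine tendsto_lintegral_of_dominated_convergence (fun y => ‖y‖ₑ ^ 2)
      (fun n => by have := (hθc n).measurable; fun_prop) (fun n => ae_of_all _ fun y => ?_)
      (μ t).2.ne (ae_of_all _ fun y => ?_)
    · refine pow_le_pow_left' ?_ 2
      rw [enorm_le_iff_norm_le]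
      have : θ n y - y = -((1 - χ n y) • y) := by simp only [θ, sub_smul, one_smul]; abel
      rw [this, norm_neg, norm_smul, Real.norm_eq_abs, abs_of_nonneg (sub_nonneg.2 (χ n).le_one)]
      exact mul_le_of_le_one_left (norm_nonneg y) (by linarith [(χ n).nonneg' y])
    · obtain ⟨N, hN⟩ := exists_nat_ge ‖y‖
      refine tendsto_const_nhds.congr' ?_
      filter_upwards [eventually_ge_atTop N] with n hn
      have : χ n y = 1 := by
        apply (χ n).one_of_mem_closedBall
        rw [mem_closedBall_zero_iff]
        have : (N : ℝ) ≤ n := by exact_mod_cast hn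
        change _ ≤ (n : ℝ) + 1
        linarith
      simp [θ, this]
  have hlim2 := (ENNReal.continuous_rpow_const (y := 1 / 2)).tendsto 0 |>.comp hlim
  rw [ENNReal.zero_rpow_of_pos (by norm_num)] at hlim2
  exact tendsto_of_tendsto_of_tendsto_of_le_of_le tendsto_const_nhds hlim2 (fun n => zero_le) hle

/-- Jointly measurable modifications of Carathéodory functions, keeping a property `P` of the
sections. -/
lemma exists_measurable_modification {m : Measure ℝ} {f : ℝ → Rd d → Rd d}
    (hf : ∀ x, AEMeasurable (fun t => f t x) m) {P : (Rd d → Rd d) → Prop} (hP0 : P 0)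
    (hPc : ∀ h, P h → Continuous h) (hP : ∀ᵐ t ∂m, P (f t)) :
    ∃ g : ℝ → Rd d → Rd d, Measurable (Function.uncurry g) ∧ (∀ t, P (g t)) ∧
      ∀ᵐ t ∂m, f t = g t := by
  classical
  let q := TopologicalSpace.denseSeq (Rd d)
  have hae : ∀ᵐ t ∂m, P (f t) ∧ ∀ n, f t (q n) = (hf (q n)).mk _ t :=
    hP.and (ae_all_iff.2 fun n => (hf (q n)).ae_eq_mk)
  obtain ⟨S, hSsub, hSm, hS0⟩ := exists_measurable_superset_of_null (ae_iff.1 hae)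
  have hSc : ∀ t ∈ Sᶜ, P (f t) ∧ ∀ n, f t (q n) = (hf (q n)).mk _ t := by
    intro t ht
    by_contra h
    exact ht (hSsub h)
  -- On the exceptional null set the section is replaced by zero, which has the property `P`; off it
  -- the values on a dense sequence are measurable in time, and continuity in `x` transfers this to
  -- every point.
  let g : ℝ → Rd d → Rd d := fun t x => if t ∈ Sᶜ then f t x else 0
  have hg1 : ∀ t ∈ Sᶜ, g t = f t := fun t ht => funext fun x => if_pos ht
  have hg2 : ∀ t, t ∉ Sᶜ → g t = 0 := fun t ht => funext fun x => if_neg ht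
  have hgP : ∀ t, P (g t) := by
    intro t
    by_cases ht : t ∈ Sᶜ
    · rw [hg1 t ht]; exact (hSc t ht).1
    · rw [hg2 t ht]; exact hP0
  have hgq : ∀ n, Measurable fun t => g t (q n) := by
    intro n
    have : (fun t => g t (q n)) = fun t => if t ∈ Sᶜ then (hf (q n)).mk _ t else 0 := by
      funext t
      by_cases ht : t ∈ Sᶜ
      · simp only [g, if_pos ht]; exact (hSc t ht).2 n
      · simp only [g, if_neg ht]
    rw [this]
    exact Measurable.ite hSm.compl (hf (q n)).measurable_mk measurable_const
  have hgx : ∀ x, Measurable fun t => g t x := by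
    intro x
    have hx : x ∈ closure (range q) := TopologicalSpace.denseRange_denseSeq (Rd d) x
    obtain ⟨y, hy, hyx⟩ := mem_closure_iff_seq_limit.1 hx
    choose n hn using hy
    refine measurable_of_tendsto_metrizable (f := fun k t => g t (q (n k))) (fun k => hgq _) ?_
    rw [tendsto_pi_nhds]
    intro t
    simp_rw [hn]
    exact ((hPc _ (hgP t)).tendsto x).comp hyx
  refine ⟨g, ?_, hgP, ?_⟩
  · have := measurable_uncurry_of_continuous_of_measurable (u := fun x t => g t x)
      (fun t => hPc _ (hgP t)) hgx
    exact this.comp measurable_swap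
  · have : ∀ᵐ t ∂m, t ∈ Sᶜ := by
      rw [ae_iff]; simpa using hS0
    filter_upwards [this] with t ht
    exact (hg1 t ht).symm

end Measurability

/-! ### From the distributional equation in time to its integrated form. -/

section WeakForm

variable {d : ℕ} {T : ℝ}

/-- A function solving `m' = G`, `m(0) = m₀` in the sense of distributions on `[0,T)` is a primitive. -/
lemma eq_add_integral_of_forall_test (hT : 0 < T) {m G : ℝ → ℝ} {m₀ : ℝ}
    (hm : ContinuousOn m (Icc 0 T)) (hG : IntervalIntegrable G volume 0 T)
    (h : ∀ η : ℝ → ℝ, ContDiff ℝ ∞ η → HasCompactSupport η → tsupport η ⊆ Iio T →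
      ∫ s in (0 : ℝ)..T, (deriv η s * m s + η s * G s) = -(η 0 * m₀)) :
    ∀ t ∈ Icc 0 T, m t = m₀ + ∫ s in (0 : ℝ)..t, G s := by
  have hmi : IntervalIntegrable m volume 0 T := by
    apply ContinuousOn.intervalIntegrable
    rwa [uIcc_of_le hT.le]
  have hopen : ∀ t ∈ Ioo 0 T, m t = m₀ + ∫ s in (0 : ℝ)..t, G s := by
    intro t ht
    -- Smooth step falling from `1` to `0` on `[t - 1/(n+1), t]`. Its derivative is an approximation
    -- of `-δ_t`, so testing with it recovers `m t` by continuity.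
    set a : ℕ → ℝ → ℝ := fun n s => Real.smoothTransition (((n : ℝ) + 1) * (t - s)) with ha
    have has : ∀ n, ContDiff ℝ ∞ (a n) := fun n =>
      Real.smoothTransition.contDiff.comp (contDiff_const.mul (contDiff_const.sub contDiff_id))
    have ha0 : ∀ (n : ℕ) (s : ℝ), t ≤ s → a n s = 0 := fun n s hs =>
      Real.smoothTransition.zero_of_nonpos (mul_nonpos_of_nonneg_of_nonpos (by positivity) (by linarith))
    have ha1 : ∀ (n : ℕ) (s : ℝ), 1 ≤ ((n : ℝ) + 1) * (t - s) → a n s = 1 := fun n s hs =>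
      Real.smoothTransition.one_of_one_le hs
    have hanti : ∀ n, Antitone (a n) := by
      intro n x y hxy
      apply Real.smoothTransition.monotone
      gcongr
    have hda : ∀ n, Continuous (deriv (a n)) := fun n => (has n).continuous_deriv (by simp)
    have hdneg : ∀ (n : ℕ) (s : ℝ), deriv (a n) s ≤ 0 := fun n s => (hanti n).deriv_nonpos
    obtain ⟨N, hN⟩ := exists_nat_one_div_lt ht.1
    have hbig : ∀ n ≥ N, 1 ≤ ((n : ℝ) + 1) * (t - 0) := by
      intro n hn
      have h1 : 1 / ((n : ℝ) + 1) ≤ 1 / ((N : ℝ) + 1) := by gcongr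
      have h2 : 1 / ((n : ℝ) + 1) ≤ t := h1.trans hN.le
      rw [div_le_iff₀ (by positivity)] at h2
      linarith
    have htest : ∀ n ≥ N, ∫ s in (0 : ℝ)..T, (deriv (a n) s * m s + a n s * G s) = -m₀ := by
      intro n hn
      -- The second factor cuts off at the left of `[-2,-1]` for compact support; it equals `1` for
      -- `s > -1` and so changes nothing on `[0,T]`.
      set η : ℝ → ℝ := fun s => a n s * Real.smoothTransition (s + 2) with hη
      have hηs : ContDiff ℝ ∞ η := (has n).mul
        (Real.smoothTransition.contDiff.comp (contDiff_id.add contDiff_const))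
      have hsupp : Function.support η ⊆ Icc (-2) t := by
        intro s hs
        constructor
        · by_contra hlt
          exact hs (by simp [hη, Real.smoothTransition.zero_of_nonpos (show s + 2 ≤ 0 by linarith)])
        · by_contra hlt
          exact hs (by simp [hη, ha0 n s (by linarith)])
      have htsupp : tsupport η ⊆ Icc (-2) t := closure_minimal hsupp isClosed_Icc
      have hηc : HasCompactSupport η := HasCompactSupport.of_support_subset_isCompact isCompact_Icc hsupp
      have := h η hηs hηc (htsupp.trans fun s hs => lt_of_le_of_lt hs.2 ht.2)
      have heq : ∀ s, -1 < s → η =ᶠ[𝓝 s] a n := by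
        intro s hs
        filter_upwards [Ioi_mem_nhds hs] with r hr
        simp [hη, Real.smoothTransition.one_of_one_le (show 1 ≤ r + 2 by linarith [mem_Ioi.1 hr])]
      rw [(heq 0 (by norm_num)).eq_of_nhds, ha1 n 0 (hbig n hn), one_mul] at this
      rw [← this]
      refine intervalIntegral.integral_congr fun s hs => ?_
      rw [uIcc_of_le hT.le] at hs
      have h1 := heq s (by linarith [hs.1])
      simp only [h1.deriv_eq, h1.eq_of_nhds]
    have hi1 : ∀ n, IntervalIntegrable (fun s => deriv (a n) s * m s) volume 0 T := fun n =>
      hmi.continuousOn_mul (hda n).continuousOn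
    have hi2 : ∀ n, IntervalIntegrable (fun s => a n s * G s) volume 0 T := fun n =>
      hG.continuousOn_mul (has n).continuous.continuousOn
    have lim2 : Tendsto (fun n => ∫ s in (0 : ℝ)..T, a n s * G s) atTop
        (𝓝 (∫ s in (0 : ℝ)..t, G s)) := by
      have e : ∫ s in (0 : ℝ)..t, G s = ∫ s in (0 : ℝ)..T, (Iio t).indicator G s := by
        rw [intervalIntegral.integral_of_le ht.1.le, intervalIntegral.integral_of_le hT.le,
          integral_indicator measurableSet_Iio, Measure.restrict_restrict measurableSet_Iio,
          integral_Ioc_eq_integral_Ioo]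
        congr 2
        ext s
        simp only [mem_Ioo, mem_inter_iff, mem_Iio, mem_Ioc]
        constructor
        · intro hs; exact ⟨hs.2, hs.1, by linarith [ht.2]⟩
        · intro hs; exact ⟨hs.2.1, hs.1⟩
      rw [e]
      refine intervalIntegral.tendsto_integral_filter_of_dominated_convergence (fun s => |G s|)
        (Eventually.of_forall fun n => ?_) (Eventually.of_forall fun n => ae_of_all _ fun s _ => ?_)
        hG.abs (ae_of_all _ fun s _ => ?_)
      · exact (hi2 n).def'.aestronglyMeasurable
      · rw [norm_mul, Real.norm_eq_abs, Real.norm_eq_abs]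
        refine mul_le_of_le_one_left (abs_nonneg _) ?_
        rw [abs_of_nonneg (Real.smoothTransition.nonneg _)]
        exact Real.smoothTransition.le_one _
      · by_cases hs : s < t
        · rw [indicator_of_mem (show s ∈ Iio t from hs)]
          obtain ⟨k, hk⟩ := exists_nat_one_div_lt (sub_pos.2 hs)
          refine tendsto_const_nhds.congr' ?_
          filter_upwards [eventually_ge_atTop k] with n hn
          rw [ha1 n s, one_mul]
          have h1 : 1 / ((n : ℝ) + 1) ≤ 1 / ((k : ℝ) + 1) := by gcongr
          have h2 : 1 / ((n : ℝ) + 1) ≤ t - s := h1.trans hk.le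
          rw [div_le_iff₀ (by positivity)] at h2
          linarith
        · rw [indicator_of_notMem (show s ∉ Iio t from hs)]
          refine tendsto_const_nhds.congr fun n => ?_
          rw [ha0 n s (not_lt.1 hs), zero_mul]
    have lim1 : Tendsto (fun n => ∫ s in (0 : ℝ)..T, deriv (a n) s * m s) atTop (𝓝 (-m t)) := by
      rw [Metric.tendsto_atTop]
      intro e he
      obtain ⟨δ, hδ, hδm⟩ := Metric.continuousWithinAt_iff.1 (hm t ⟨ht.1.le, ht.2.le⟩) (e / 2) (by positivity)
      obtain ⟨k, hk⟩ := exists_nat_one_div_lt hδ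
      refine ⟨max N k, fun n hn => ?_⟩
      have hnN : N ≤ n := (le_max_left _ _).trans hn
      have hnk : k ≤ n := (le_max_right _ _).trans hn
      have hid : ∫ s in (0 : ℝ)..T, deriv (a n) s = -1 := by
        rw [intervalIntegral.integral_deriv_eq_sub
          (fun s _ => ((has n).differentiable (by simp)).differentiableAt)
          ((hda n).intervalIntegrable _ _), ha0 n T ht.2.le, ha1 n 0 (hbig n hnN)]
        norm_num
      have hdi : IntervalIntegrable (deriv (a n)) volume 0 T := (hda n).intervalIntegrable _ _
      have e1 : (∫ s in (0 : ℝ)..T, deriv (a n) s * m s) - -m t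
          = ∫ s in (0 : ℝ)..T, deriv (a n) s * (m s - m t) := by
        simp_rw [mul_sub]
        rw [intervalIntegral.integral_sub (hi1 n) (hdi.mul_const _),
          intervalIntegral.integral_mul_const, hid]
        ring
      rw [Real.dist_eq, e1, ← Real.norm_eq_abs]
      have hle : ‖∫ s in (0 : ℝ)..T, deriv (a n) s * (m s - m t)‖
          ≤ ∫ s in (0 : ℝ)..T, -(e / 2) * deriv (a n) s := by
        refine intervalIntegral.norm_integral_le_of_norm_le hT.le (ae_of_all _ fun s hs => ?_)
          (hdi.const_mul _)
        have hs' : s ∈ Icc 0 T := ⟨hs.1.le, hs.2⟩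
        rw [norm_mul, Real.norm_eq_abs, abs_of_nonpos (hdneg n s)]
        have hloc : deriv (a n) s ≠ 0 → |s - t| < δ := by
          intro hne
          have h1 : s ≤ t := by
            by_contra hlt
            refine hne ?_
            have : a n =ᶠ[𝓝 s] fun _ => 0 := by
              filter_upwards [Ioi_mem_nhds (not_le.1 hlt)] with r hr
              exact ha0 n r (le_of_lt hr)
            rw [this.deriv_eq, deriv_const]
          have h2 : ((n : ℝ) + 1) * (t - s) ≤ 1 := by
            by_contra hlt
            refine hne ?_
            have hopen : ∀ᶠ r in 𝓝 s, 1 < ((n : ℝ) + 1) * (t - r) :=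
              (by fun_prop : Continuous fun r => ((n : ℝ) + 1) * (t - r)).continuousAt.eventually
                (lt_mem_nhds (not_le.1 hlt))
            have : a n =ᶠ[𝓝 s] fun _ => 1 := by
              filter_upwards [hopen] with r hr
              exact ha1 n r hr.le
            rw [this.deriv_eq, deriv_const]
          have h3 : t - s ≤ 1 / ((n : ℝ) + 1) := by
            rw [le_div_iff₀ (by positivity)]; linarith
          have h4 : 1 / ((n : ℝ) + 1) ≤ 1 / ((k : ℝ) + 1) := by gcongr
          rw [abs_lt]
          constructor <;> linarith
        by_cases hne : deriv (a n) s = 0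
        · simp [hne]
        · have h5 := hδm hs' (hloc hne)
          rw [Real.dist_eq] at h5
          rw [Real.norm_eq_abs]
          nlinarith [hdneg n s]
      rw [intervalIntegral.integral_const_mul, hid] at hle
      linarith
    have hlim := lim1.add lim2
    have hconst : Tendsto (fun _ : ℕ => -m₀) atTop (𝓝 (-m t + ∫ s in (0 : ℝ)..t, G s)) := by
      refine hlim.congr' ?_
      filter_upwards [eventually_ge_atTop N] with n hn
      rw [← htest n hn, intervalIntegral.integral_add (hi1 n) (hi2 n)]
    have := tendsto_nhds_unique hconst tendsto_const_nhds
    linarith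
  have hc2 : ContinuousOn (fun t => m₀ + ∫ s in (0 : ℝ)..t, G s) (Icc 0 T) := by
    refine continuousOn_const.add ?_
    have := intervalIntegral.continuousOn_primitive_interval' hG left_mem_uIcc
    rwa [uIcc_of_le hT.le] at this
  have hcl : Icc 0 T ⊆ closure (Ioo 0 T) := by rw [closure_Ioo hT.ne]
  intro t ht
  exact (show EqOn m (fun t => m₀ + ∫ s in (0 : ℝ)..t, G s) (Ioo 0 T) from hopen).of_subset_closure
    hm hc2 Ioo_subset_Icc_self hcl ht

end WeakForm

/-! ### Weak solutions as solutions of linear equations with a frozen velocity. -/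

section LinearSolution

variable {d : ℕ} {T : ℝ}

lemma laplacian_eq_sum (ψ : Rd d → ℝ) (x : Rd d) :
    Laplacian.laplacian ψ x = ∑ i, fderiv ℝ (fderiv ℝ ψ) x (EuclideanSpace.basisFun (Fin d) ℝ i)
      (EuclideanSpace.basisFun (Fin d) ℝ i) := by
  rw [InnerProductSpace.laplacian_eq_iteratedFDeriv_orthonormalBasis ψ
    (EuclideanSpace.basisFun (Fin d) ℝ)]
  simp [iteratedFDeriv_two_apply]

lemma abs_laplacian_le {ψ : Rd d → ℝ} {x : Rd d} {B : ℝ}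
    (h : ‖fderiv ℝ (fderiv ℝ ψ) x‖ ≤ B) : |Laplacian.laplacian ψ x| ≤ d * B := by
  rw [laplacian_eq_sum]
  refine (Finset.abs_sum_le_sum_abs _ _).trans ?_
  calc _ ≤ ∑ _i : Fin d, B := by
        refine Finset.sum_le_sum fun i _ => ?_
        have h1 := (fderiv ℝ (fderiv ℝ ψ) x).le_opNorm₂ (EuclideanSpace.basisFun (Fin d) ℝ i)
          (EuclideanSpace.basisFun (Fin d) ℝ i)
        simp only [OrthonormalBasis.norm_eq_one, mul_one, Real.norm_eq_abs] at h1
        exact h1.trans h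
    _ = d * B := by simp

lemma continuous_laplacian {ψ : Rd d → ℝ} (h : ContDiff ℝ ∞ ψ) :
    Continuous (Laplacian.laplacian ψ) := by
  have h1 : ContDiff ℝ ∞ (fderiv ℝ ψ) := h.fderiv_right (by simp)
  have h2 : Continuous (fderiv ℝ (fderiv ℝ ψ)) := h1.continuous_fderiv (by simp)
  have : (Laplacian.laplacian ψ) = fun x => ∑ i, fderiv ℝ (fderiv ℝ ψ) x
      (EuclideanSpace.basisFun (Fin d) ℝ i) (EuclideanSpace.basisFun (Fin d) ℝ i) :=
    funext (laplacian_eq_sum ψ)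
  rw [this]
  fun_prop

lemma hasCompactSupport_laplacian {ψ : Rd d → ℝ} (h : HasCompactSupport ψ) :
    HasCompactSupport (Laplacian.laplacian ψ : Rd d → ℝ) := by
  have h1 := (h.fderiv (𝕜 := ℝ)).fderiv (𝕜 := ℝ)
  refine h1.mono fun x hx => ?_
  contrapose! hx
  simp only [Function.mem_support, not_not] at hx ⊢
  rw [laplacian_eq_sum, hx]
  simp

lemma laplacian_const_mul (c : ℝ) {ψ : Rd d → ℝ} (h : ContDiff ℝ ∞ ψ) (x : Rd d) :
    Laplacian.laplacian (fun z => c * ψ z) x = c * Laplacian.laplacian ψ x := by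
  have h1 : ContDiff ℝ ∞ (fderiv ℝ ψ) := h.fderiv_right (by simp)
  have e1 : fderiv ℝ (fun z => c * ψ z) = fun z => c • fderiv ℝ ψ z :=
    funext fun z => fderiv_const_mul ((h.differentiable (by simp)) z) c
  rw [laplacian_eq_sum, laplacian_eq_sum, e1, Finset.mul_sum]
  refine Finset.sum_congr rfl fun i _ => ?_
  rw [fderiv_fun_const_smul ((h1.differentiable (by simp)) x) c]
  simp

/-- The generator of the diffusion with velocity `v` and viscosity `κ`, applied to `ψ` at `x`. -/
def generator (κ : ℝ) (ψ : Rd d → ℝ) (v x : Rd d) : ℝ :=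
  fderiv ℝ ψ x v + κ * Laplacian.laplacian ψ x

lemma continuous_generator (κ : ℝ) {ψ : Rd d → ℝ} (h : ContDiff ℝ ∞ ψ) :
    Continuous fun z : Rd d × Rd d => generator κ ψ z.1 z.2 := by
  have h1 : Continuous (fderiv ℝ ψ) := h.continuous_fderiv (by simp)
  have h2 := continuous_laplacian h
  unfold generator
  fun_prop

/-- `μ` is a weakly continuous solution of `∂_t μ + div(v μ) = κ Δ μ` on `[0,T]`, in time-integrated
form. -/
structure IsLinearSolution (T κ : ℝ) (v : ℝ → Rd d → Rd d) (μ : ℝ → P2 d) : Prop where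
  measurable : Measurable (Function.uncurry v)
  continuousOn : ContinuousOn μ (Icc 0 T)
  intervalIntegrable : ∀ ψ : Rd d → ℝ, ContDiff ℝ ∞ ψ → HasCompactSupport ψ →
    IntervalIntegrable (fun t => ∫ x, generator κ ψ (v t x) x ∂(μ t).meas) volume 0 T
  integrable : ∀ ψ : Rd d → ℝ, ContDiff ℝ ∞ ψ → HasCompactSupport ψ →
    ∀ᵐ t ∂(volume.restrict (Ioo 0 T)), Integrable (fun x => generator κ ψ (v t x) x) (μ t).meas
  eq : ∀ ψ : Rd d → ℝ, ContDiff ℝ ∞ ψ → HasCompactSupport ψ → ∀ s ∈ Icc 0 T, ∀ t ∈ Icc 0 T,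
    ∫ x, ψ x ∂(μ t).meas - ∫ x, ψ x ∂(μ s).meas
      = ∫ r in s..t, ∫ x, generator κ ψ (v r x) x ∂(μ r).meas

/-- Testing with products `η(t) ψ(x)` gives a distributional equation for `t ↦ ∫ ψ dμ_t`, which is
then integrated. The value at time zero is matched with `μ₀` only against test functions, which is
all that is needed later. -/
lemma IsWeakSolution.isLinearSolution (hT : 0 < T) {κ : ℝ} {b : ℝ → Rd d → P2 d → Rd d}
    {u : ℝ → Rd d → Rd d} {μ₀ : P2 d} {μ : ℝ → P2 d} (h : IsWeakSolution T κ b u μ₀ μ)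
    {v : ℝ → Rd d → Rd d} (hv : Measurable (Function.uncurry v))
    (hae : ∀ᵐ t ∂(volume.restrict (Ioo 0 T)), ∀ x, b t x (μ t) + u t x = v t x) :
    IsLinearSolution T κ v μ ∧ ∀ ψ : Rd d → ℝ, ContDiff ℝ ∞ ψ → HasCompactSupport ψ →
      ∫ x, ψ x ∂(μ 0).meas = ∫ x, ψ x ∂μ₀.meas := by
  have hcore : ∀ ψ : Rd d → ℝ, ContDiff ℝ ∞ ψ → HasCompactSupport ψ →
      (∀ᵐ t ∂(volume.restrict (Ioo 0 T)), Integrable (fun x => generator κ ψ (v t x) x) (μ t).meas) ∧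
      IntervalIntegrable (fun t => ∫ x, generator κ ψ (v t x) x ∂(μ t).meas) volume 0 T ∧
      ∀ t ∈ Icc 0 T, ∫ x, ψ x ∂(μ t).meas
        = ∫ x, ψ x ∂μ₀.meas + ∫ r in (0 : ℝ)..t, ∫ x, generator κ ψ (v r x) x ∂(μ r).meas := by
    intro ψ hψ hψc
    obtain ⟨C₀, hC₀⟩ := hψc.exists_bound_of_continuous hψ.continuous
    obtain ⟨C₁, hC₁⟩ := (hψc.fderiv (𝕜 := ℝ)).exists_bound_of_continuous
      (hψ.continuous_fderiv (by simp))
    obtain ⟨C₂, hC₂⟩ := (hasCompactSupport_laplacian hψc).exists_bound_of_continuous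
      (continuous_laplacian hψ)
    have hC₁0 : 0 ≤ C₁ := (norm_nonneg _).trans (hC₁ 0)
    obtain ⟨r, hr⟩ := hψc.isBounded.subset_ball 0
    have hsm : ∀ t, AEStronglyMeasurable (fun x => generator κ ψ (v t x) x) (μ t).meas := fun t =>
      ((continuous_generator κ hψ).measurable.comp
        ((hv.comp measurable_prodMk_left).prodMk measurable_id)).aestronglyMeasurable
    have hbd : ∀ t x, ‖generator κ ψ (v t x) x‖
        ≤ C₁ * (Metric.ball 0 r).indicator (fun x => ‖v t x‖) x + |κ| * C₂ := by
      intro t x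
      refine (norm_add_le _ _).trans (add_le_add ?_ ?_)
      · by_cases hx : x ∈ Metric.ball 0 r
        · rw [indicator_of_mem hx]
          exact ((fderiv ℝ ψ x).le_opNorm _).trans (by gcongr; exact hC₁ x)
        · have : fderiv ℝ ψ x = 0 := by
            by_contra hne
            exact hx (hr ((support_fderiv_subset ℝ) hne))
          simp [this, indicator_of_notMem hx]
      · rw [norm_mul, Real.norm_eq_abs]
        gcongr
        exact hC₂ x
    have hintg : ∀ᵐ t ∂(volume.restrict (Ioo 0 T)),
        Integrable (fun x => C₁ * (Metric.ball 0 r).indicator (fun x => ‖v t x‖) x + |κ| * C₂)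
          (μ t).meas := by
      filter_upwards [h.integrable_space r, hae] with t ht hvt
      have e : (fun x => b t x (μ t) + u t x) = v t := funext hvt
      rw [e] at ht
      exact (((IntegrableOn.integrable_indicator (μ := (μ t).meas) ht.norm
        Metric.isOpen_ball.measurableSet)).const_mul C₁).add
        (integrable_const _)
    have hgi : ∀ᵐ t ∂(volume.restrict (Ioo 0 T)),
        Integrable (fun x => generator κ ψ (v t x) x) (μ t).meas := by
      filter_upwards [hintg] with t ht
      exact ht.mono' (hsm t) (ae_of_all _ (hbd t))
    have hII : IntervalIntegrable (fun t => ∫ x, generator κ ψ (v t x) x ∂(μ t).meas) volume 0 T := by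
      rw [intervalIntegrable_iff_integrableOn_Ioo_of_le hT.le]
      have hdom : IntegrableOn (fun t => C₁ * ∫ x in Metric.ball 0 r, ‖b t x (μ t) + u t x‖ ∂(μ t).meas
          + |κ| * C₂) (Ioo 0 T) :=
        ((h.integrable_time r).const_mul C₁).add (integrableOn_const (by simp))
      refine hdom.mono' ?_ ?_
      · refine AEStronglyMeasurable.mono_measure (μ := volume.restrict (Icc 0 T)) ?_
          (Measure.restrict_mono Ioo_subset_Icc_self le_rfl)
        refine aestronglyMeasurable_integral_curve (f := fun t x => generator κ ψ (v t x) x)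
          hT.le h.continuousOn ?_
        have : Measurable (Function.uncurry fun t x => generator κ ψ (v t x) x) :=
          (continuous_generator κ hψ).measurable.comp (hv.prodMk measurable_snd)
        exact this.stronglyMeasurable
      · filter_upwards [hintg, hae] with t ht hvt
        refine (norm_integral_le_of_norm_le ht (ae_of_all _ (hbd t))).trans (le_of_eq ?_)
        have e : (fun x => ‖b t x (μ t) + u t x‖) = fun x => ‖v t x‖ := by simp_rw [hvt]
        have hi1 : Integrable (fun x => C₁ * (Metric.ball 0 r).indicator (fun x => ‖v t x‖) x)
            (μ t).meas := by
          refine (ht.sub (integrable_const (|κ| * C₂))).congr (ae_of_all _ fun x => ?_)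
          simp
        rw [integral_add hi1 (integrable_const _), integral_const_mul,
          integral_indicator Metric.isOpen_ball.measurableSet, e]
        simp
    refine ⟨hgi, hII, ?_⟩
    refine eq_add_integral_of_forall_test hT
      (continuousOn_integral_bounded h.continuousOn hψ.continuous hC₀) hII ?_
    intro η hη hηc hηT
    have hsub : tsupport (fun z : ℝ × Rd d => η z.1 * ψ z.2) ⊆ tsupport η ×ˢ tsupport ψ := by
      refine closure_minimal ?_ ((isClosed_tsupport η).prod (isClosed_tsupport ψ))
      intro z hz
      exact ⟨subset_tsupport _ (left_ne_zero_of_mul hz), subset_tsupport _ (right_ne_zero_of_mul hz)⟩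
    have hw := h.weak_form (fun z => η z.1 * ψ z.2)
      ((hη.comp contDiff_fst).mul (hψ.comp contDiff_snd))
      ((hηc.isCompact.prod hψc.isCompact).of_isClosed_subset (isClosed_tsupport _) hsub)
      (hsub.trans (prod_mono hηT (subset_univ _)))
    dsimp only at hw
    rw [integral_const_mul] at hw
    rw [← hw]
    refine intervalIntegral.integral_congr_ae ?_
    rw [uIoc_of_le hT.le, ← ae_restrict_iff' measurableSet_Ioc, ← restrict_Ioo_eq_restrict_Ioc]
    filter_upwards [hgi, hae] with t ht hvt
    have e : ∀ x, deriv (fun s => η s * ψ x) t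
        + inner ℝ (b t x (μ t) + u t x) (gradient (fun z => η t * ψ z) x)
        + κ * Laplacian.laplacian (fun z => η t * ψ z) x
        = deriv η t * ψ x + η t * generator κ ψ (v t x) x := by
      intro x
      have hd1 : deriv (fun s => η s * ψ x) t = deriv η t * ψ x := by simp
      have hd2 : inner ℝ (b t x (μ t) + u t x) (gradient (fun z => η t * ψ z) x)
          = η t * fderiv ℝ ψ x (v t x) := by
        rw [inner_gradient_right, hvt x,
          fderiv_const_mul ((hψ.differentiable (by simp)) x) (η t)]
        simp
      rw [hd1, hd2, laplacian_const_mul _ hψ]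
      unfold generator
      ring
    simp_rw [e]
    rw [integral_add ((hψ.continuous.integrable_of_hasCompactSupport hψc).const_mul _)
      (ht.const_mul _), integral_const_mul, integral_const_mul]
  refine ⟨⟨hv, h.continuousOn, fun ψ h1 h2 => (hcore ψ h1 h2).2.1, fun ψ h1 h2 => (hcore ψ h1 h2).1,
    fun ψ h1 h2 s hs t ht => ?_⟩, ?_⟩
  · obtain ⟨-, hII, heq⟩ := hcore ψ h1 h2
    rw [heq t ht, heq s hs, add_sub_add_left_eq_sub,
      intervalIntegral.integral_interval_sub_left]
    · exact hII.mono_set (uIcc_subset_uIcc left_mem_uIcc (by rwa [uIcc_of_le hT.le]))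
    · exact hII.mono_set (uIcc_subset_uIcc left_mem_uIcc (by rwa [uIcc_of_le hT.le]))
  · intro ψ h1 h2
    have := (hcore ψ h1 h2).2.2 0 (left_mem_Icc.2 hT.le)
    simpa using this

end LinearSolution

/-! ### Truncated weights for fourth moments, and a Grönwall lemma. -/

section MomentWeights

variable {d : ℕ} {T : ℝ}

lemma fderiv_norm_pow_four (x : Rd d) :
    fderiv ℝ (fun z : Rd d => ‖z‖ ^ 4) x = (4 * ‖x‖ ^ 2) • innerSL ℝ x := by
  have h : HasFDerivAt (fun z : Rd d => (‖z‖ ^ 2) ^ 2) _ x :=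
    ((hasStrictFDerivAt_norm_sq x).hasFDerivAt).pow 2
  have e : (fun z : Rd d => ‖z‖ ^ 4) = fun z => (‖z‖ ^ 2) ^ 2 := by
    funext z; ring
  rw [e, h.fderiv]
  ext y
  simp
  ring

lemma norm_fderiv_norm_pow_four (x : Rd d) :
    ‖fderiv ℝ (fun z : Rd d => ‖z‖ ^ 4) x‖ ≤ 4 * ‖x‖ ^ 3 := by
  rw [fderiv_norm_pow_four, norm_smul, innerSL_apply_norm, Real.norm_eq_abs,
    abs_of_nonneg (by positivity)]
  exact le_of_eq (by ring)

lemma norm_fderiv_fderiv_norm_pow_four (x : Rd d) :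
    ‖fderiv ℝ (fderiv ℝ (fun z : Rd d => ‖z‖ ^ 4)) x‖ ≤ 12 * ‖x‖ ^ 2 := by
  let J : Rd d →L[ℝ] Rd d →L[ℝ] ℝ := innerSL ℝ
  have hJ : ∀ y, ‖J y‖ = ‖y‖ := fun y => innerSL_apply_norm (𝕜 := ℝ) y
  have hJ1 : ‖J‖ ≤ 1 := J.opNorm_le_bound zero_le_one fun y => by rw [hJ, one_mul]
  have e : fderiv ℝ (fun z : Rd d => ‖z‖ ^ 4) = fun x => (4 * ‖x‖ ^ 2) • J x :=
    funext fderiv_norm_pow_four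
  have h1 : HasFDerivAt (fun z : Rd d => 4 * ‖z‖ ^ 2) ((4 : ℝ) • (2 • J x)) x :=
    ((hasStrictFDerivAt_norm_sq x).hasFDerivAt).const_mul 4
  rw [e, (h1.fun_smul J.hasFDerivAt).fderiv]
  have n1 : ‖(4 * ‖x‖ ^ 2) • J‖ ≤ 4 * ‖x‖ ^ 2 := by
    rw [norm_smul, Real.norm_eq_abs, abs_of_nonneg (by positivity)]
    exact mul_le_of_le_one_right (by positivity) hJ1
  have n2 : ‖((4 : ℝ) • (2 • J x)).smulRight (J x)‖ ≤ 8 * ‖x‖ ^ 2 := by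
    rw [ContinuousLinearMap.norm_smulRight_apply, hJ, norm_smul]
    have : ‖(2 : ℕ) • J x‖ ≤ 2 * ‖x‖ := by
      refine (norm_nsmul_le).trans ?_
      rw [hJ]
      norm_num
    calc ‖(4 : ℝ)‖ * ‖(2 : ℕ) • J x‖ * ‖x‖ ≤ 4 * (2 * ‖x‖) * ‖x‖ := by
          gcongr; norm_num
      _ = _ := by ring
  refine (norm_add_le _ _).trans ?_
  linarith

/-- The function `‖x‖⁴` is not an admissible test function. The compactly supported `Φ = (1 - ‖x‖⁴)
χ` makes `1 - Φ` equal to `‖x‖⁴` on the ball of radius `2` and to `1` outside the ball of radius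
`3`. -/
lemma exists_base_moment_weight (d : ℕ) : ∃ (Φ : Rd d → ℝ) (C₁ C₂ : ℝ), ContDiff ℝ ∞ Φ ∧
    HasCompactSupport Φ ∧ (∀ x, ‖fderiv ℝ Φ x‖ ≤ C₁) ∧ (∀ x, ‖fderiv ℝ (fderiv ℝ Φ) x‖ ≤ C₂) ∧
    (∀ y, ‖y‖ < 2 → fderiv ℝ Φ y = - fderiv ℝ (fun z : Rd d => ‖z‖ ^ 4) y) ∧
    (∀ y, ‖y‖ < 2 →
      fderiv ℝ (fderiv ℝ Φ) y = - fderiv ℝ (fderiv ℝ (fun z : Rd d => ‖z‖ ^ 4)) y) ∧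
    (∀ y, ‖y‖ < 2 → 1 - Φ y = ‖y‖ ^ 4) ∧
    (∀ y, 2 ≤ ‖y‖ → 1 ≤ 1 - Φ y ∧ 1 - Φ y ≤ ‖y‖ ^ 4) ∧
    ∀ y, 3 < ‖y‖ → fderiv ℝ Φ y = 0 := by
  let χ : ContDiffBump (0 : Rd d) := ⟨2, 3, by norm_num, by norm_num⟩
  let Φ : Rd d → ℝ := fun x => (1 - ‖x‖ ^ 4) * χ x
  have hn4 : ContDiff ℝ ∞ fun x : Rd d => ‖x‖ ^ 4 := by
    have : (fun z : Rd d => ‖z‖ ^ 4) = fun z => (‖z‖ ^ 2) ^ 2 := by funext z; ring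
    rw [this]
    exact (contDiff_norm_sq ℝ).pow 2
  have hΦ : ContDiff ℝ ∞ Φ := (contDiff_const.sub hn4).mul χ.contDiff
  have hΦc : HasCompactSupport Φ := χ.hasCompactSupport.mul_left
  have hΦ' : ContDiff ℝ ∞ (fderiv ℝ Φ) := hΦ.fderiv_right (by simp)
  obtain ⟨C₁, hC₁⟩ := (hΦc.fderiv (𝕜 := ℝ)).exists_bound_of_continuous hΦ'.continuous
  obtain ⟨C₂, hC₂⟩ := ((hΦc.fderiv (𝕜 := ℝ)).fderiv (𝕜 := ℝ)).exists_bound_of_continuous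
    (hΦ'.continuous_fderiv (by simp))
  have hin : ∀ y : Rd d, ‖y‖ < 2 → Φ =ᶠ[𝓝 y] fun z => 1 - ‖z‖ ^ 4 := by
    intro y hy
    have : Metric.ball (0 : Rd d) 2 ∈ 𝓝 y :=
      Metric.isOpen_ball.mem_nhds (mem_ball_zero_iff.2 hy)
    filter_upwards [this] with z hz
    have : χ z = 1 := χ.one_of_mem_closedBall (Metric.ball_subset_closedBall hz)
    simp [Φ, this]
  have hd1 : ∀ y : Rd d, ‖y‖ < 2 → fderiv ℝ Φ y = - fderiv ℝ (fun z : Rd d => ‖z‖ ^ 4) y := by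
    intro y hy
    rw [(hin y hy).fderiv_eq, fderiv_const_sub]
  have hd2 : ∀ y : Rd d, ‖y‖ < 2 →
      fderiv ℝ (fderiv ℝ Φ) y = - fderiv ℝ (fderiv ℝ (fun z : Rd d => ‖z‖ ^ 4)) y := by
    intro y hy
    have : fderiv ℝ Φ =ᶠ[𝓝 y] fun z => - fderiv ℝ (fun z : Rd d => ‖z‖ ^ 4) z := by
      filter_upwards [Metric.isOpen_ball.mem_nhds (mem_ball_zero_iff.2 hy)] with z hz
      exact hd1 z (mem_ball_zero_iff.1 hz)
    rw [this.fderiv_eq, fderiv_fun_neg]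
  have hval1 : ∀ y : Rd d, ‖y‖ < 2 → 1 - Φ y = ‖y‖ ^ 4 := by
    intro y hy
    rw [(hin y hy).eq_of_nhds]; ring
  have hval2 : ∀ y : Rd d, 2 ≤ ‖y‖ → 1 ≤ 1 - Φ y ∧ 1 - Φ y ≤ ‖y‖ ^ 4 := by
    intro y hy
    have h1 : (1 : ℝ) ≤ ‖y‖ ^ 4 := one_le_pow₀ (by linarith)
    have h2 := χ.nonneg' y
    have h3 : χ y ≤ 1 := χ.le_one
    simp only [Φ]
    constructor <;> nlinarith
  have hout : ∀ y : Rd d, 3 < ‖y‖ → fderiv ℝ Φ y = 0 := by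
    intro y hy
    have : Φ =ᶠ[𝓝 y] fun _ => 0 := by
      have ho : IsOpen {z : Rd d | 3 < ‖z‖} := isOpen_lt continuous_const continuous_norm
      filter_upwards [ho.mem_nhds hy] with z hz
      have : χ z = 0 := by
        rw [← Function.notMem_support, χ.support_eq]
        simp only [Metric.mem_ball, dist_zero_right, not_lt]
        exact le_of_lt hz
      simp [Φ, this]
    rw [this.fderiv_eq]
    simp
  exact ⟨Φ, C₁, C₂, hΦ, hΦc, hC₁, hC₂, hd1, hd2, hval1, hval2, hout⟩

/-- Smooth truncations of `‖x‖⁴`, constant at infinity, with controlled first and second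
derivatives. -/
lemma exists_moment_weight (d : ℕ) : ∃ C : ℝ, 0 ≤ C ∧ ∀ R : ℝ, 1 ≤ R → ∃ φ : Rd d → ℝ,
    ContDiff ℝ ∞ φ ∧ HasCompactSupport φ ∧ (∀ x, 0 ≤ R ^ 4 - φ x) ∧
    (∀ x, R ^ 4 - φ x ≤ ‖x‖ ^ 4) ∧ (∀ x, ‖x‖ ≤ R → R ^ 4 - φ x = ‖x‖ ^ 4) ∧
    (∀ x, ‖fderiv ℝ φ x‖ ≤ C * ‖x‖ ^ 3) ∧
    (∀ x, (1 + ‖x‖) * ‖fderiv ℝ φ x‖ ≤ C * (1 + (R ^ 4 - φ x))) ∧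
    ∀ x, |Laplacian.laplacian φ x| ≤ C * (1 + (R ^ 4 - φ x)) := by
  obtain ⟨Φ, C₁, C₂, hΦ, hΦc, hC₁, hC₂, hd1, hd2, hval1, hval2, hout⟩ := exists_base_moment_weight d
  have hΦ' : ContDiff ℝ ∞ (fderiv ℝ Φ) := hΦ.fderiv_right (by simp)
  have hC₁0 : 0 ≤ C₁ := (norm_nonneg _).trans (hC₁ 0)
  have hC₂0 : 0 ≤ C₂ := (norm_nonneg _).trans (hC₂ 0)
  -- The weight is `R⁴ Φ(x/R)`. The constant collects `8` from the gradient of `‖x‖⁴`, `4 C₁` from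
  -- the shell `2R ≤ ‖x‖ ≤ 3R`, where `1 + ‖x‖ ≤ 4R`, and `12 d`, `d C₂` from the Laplacian in the
  -- two regions.
  refine ⟨8 + 4 * C₁ + 12 * d + d * C₂, by positivity, fun R hR => ?_⟩
  have hR0 : 0 < R := by linarith
  have hsc : ∀ x : Rd d, ‖x‖ = R * ‖R⁻¹ • x‖ := by
    intro x
    rw [norm_smul, norm_inv, Real.norm_eq_abs, abs_of_pos hR0]
    field_simp
  have hf1 : ∀ x, fderiv ℝ (fun x => R ^ 4 * Φ (R⁻¹ • x)) x = R ^ 3 • fderiv ℝ Φ (R⁻¹ • x) := by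
    intro x
    have hd : DifferentiableAt ℝ (fun x => Φ (R⁻¹ • x)) x :=
      (hΦ.comp (contDiff_const_smul R⁻¹)).differentiable (by simp) x
    rw [fderiv_const_mul hd, fderiv_comp_smul,
      smul_smul]
    congr 1
    field_simp
  have hf2 : ∀ x, fderiv ℝ (fderiv ℝ (fun x => R ^ 4 * Φ (R⁻¹ • x))) x
      = R ^ 2 • fderiv ℝ (fderiv ℝ Φ) (R⁻¹ • x) := by
    intro x
    have hd : DifferentiableAt ℝ (fun x => fderiv ℝ Φ (R⁻¹ • x)) x :=
      (hΦ'.comp (contDiff_const_smul R⁻¹)).differentiable (by simp) x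
    rw [funext hf1, fderiv_fun_const_smul hd,
      fderiv_comp_smul, smul_smul]
    congr 1
    field_simp
  have hψ : ∀ x, R ^ 4 - R ^ 4 * Φ (R⁻¹ • x) = R ^ 4 * (1 - Φ (R⁻¹ • x)) := fun x => by ring
  refine ⟨fun x => R ^ 4 * Φ (R⁻¹ • x), contDiff_const.mul (hΦ.comp (contDiff_const_smul _)),
    (hΦc.comp_smul (inv_ne_zero hR0.ne')).mul_left, ?_⟩
  have hn1 : ∀ x, ‖fderiv ℝ (fun x => R ^ 4 * Φ (R⁻¹ • x)) x‖ = R ^ 3 * ‖fderiv ℝ Φ (R⁻¹ • x)‖ := by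
    intro x
    rw [hf1, norm_smul, Real.norm_eq_abs, abs_of_pos (by positivity)]
  have hlow : ∀ x : Rd d, 2 ≤ ‖R⁻¹ • x‖ → R ^ 4 ≤ R ^ 4 * (1 - Φ (R⁻¹ • x)) := fun x hx =>
    le_mul_of_one_le_right (by positivity) (hval2 _ hx).1
  have hRR : R ^ 2 ≤ R ^ 4 := pow_le_pow_right₀ hR (by norm_num)
  simp only [hψ, hn1]
  refine ⟨fun x => ?_, fun x => ?_, fun x hx => ?_, fun x => ?_, fun x => ?_, fun x => ?_⟩
  · refine mul_nonneg (by positivity) ?_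
    rcases lt_or_ge ‖R⁻¹ • x‖ 2 with h | h
    · rw [hval1 _ h]; positivity
    · linarith [(hval2 _ h).1]
  · rw [hsc x, mul_pow]
    gcongr
    rcases lt_or_ge ‖R⁻¹ • x‖ 2 with h | h
    · rw [hval1 _ h]
    · exact (hval2 _ h).2
  · have : ‖R⁻¹ • x‖ < 2 := by
      rw [hsc x] at hx
      have : ‖R⁻¹ • x‖ ≤ 1 := by
        by_contra hlt
        nlinarith
      linarith
    rw [hval1 _ this, ← mul_pow, ← hsc x]
  · rcases lt_or_ge ‖R⁻¹ • x‖ 2 with h | h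
    · rw [hd1 _ h, norm_neg]
      calc R ^ 3 * _ ≤ R ^ 3 * (4 * ‖R⁻¹ • x‖ ^ 3) := by
            gcongr; exact norm_fderiv_norm_pow_four _
        _ = 4 * ‖x‖ ^ 3 := by rw [hsc x]; ring
        _ ≤ _ := by
            gcongr
            have : (0 : ℝ) ≤ 4 * C₁ + 12 * d + d * C₂ := by positivity
            linarith
    · calc R ^ 3 * _ ≤ R ^ 3 * (C₁ * 1) := by rw [mul_one]; gcongr; exact hC₁ _
        _ ≤ R ^ 3 * (C₁ * ‖R⁻¹ • x‖ ^ 3) := by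
            gcongr
            exact one_le_pow₀ (by linarith)
        _ = C₁ * ‖x‖ ^ 3 := by rw [hsc x]; ring
        _ ≤ _ := by
            gcongr
            have : (0 : ℝ) ≤ 12 * d + d * C₂ := by positivity
            linarith
  · rcases lt_or_ge ‖R⁻¹ • x‖ 2 with h | h
    · rw [hval1 _ h, hd1 _ h, norm_neg, ← mul_pow, ← hsc x]
      have h1 : R ^ 3 * ‖fderiv ℝ (fun z : Rd d => ‖z‖ ^ 4) (R⁻¹ • x)‖ ≤ 4 * ‖x‖ ^ 3 := by
        calc R ^ 3 * _ ≤ R ^ 3 * (4 * ‖R⁻¹ • x‖ ^ 3) := by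
              gcongr; exact norm_fderiv_norm_pow_four _
          _ = 4 * ‖x‖ ^ 3 := by rw [hsc x]; ring
      have h2 : ‖x‖ ^ 3 ≤ 1 + ‖x‖ ^ 4 := by
        have := norm_nonneg x
        nlinarith [sq_nonneg (‖x‖ ^ 2 - ‖x‖), sq_nonneg (‖x‖ ^ 2 - 1), sq_nonneg (‖x‖ - 1)]
      calc (1 + ‖x‖) * _ ≤ (1 + ‖x‖) * (4 * ‖x‖ ^ 3) := by gcongr
        _ = 4 * ‖x‖ ^ 3 + 4 * ‖x‖ ^ 4 := by ring
        _ ≤ 8 * (1 + ‖x‖ ^ 4) := by nlinarith [norm_nonneg x]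
        _ ≤ _ := by
            gcongr
            have : (0 : ℝ) ≤ 4 * C₁ + 12 * d + d * C₂ := by positivity
            linarith
    · rcases lt_or_ge 3 ‖R⁻¹ • x‖ with h3 | h3
      · rw [hout _ h3]
        have := hlow x h
        have : 0 ≤ R ^ 4 * (1 - Φ (R⁻¹ • x)) := by linarith [pow_pos hR0 4]
        simp only [norm_zero, mul_zero]
        positivity
      · have hx : 1 + ‖x‖ ≤ 4 * R := by rw [hsc x]; nlinarith
        calc (1 + ‖x‖) * (R ^ 3 * _) ≤ (4 * R) * (R ^ 3 * C₁) := by gcongr; exact hC₁ _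
          _ = 4 * C₁ * R ^ 4 := by ring
          _ ≤ (8 + 4 * C₁ + 12 * d + d * C₂) * (1 + R ^ 4 * (1 - Φ (R⁻¹ • x))) := by
              gcongr
              · have : (0 : ℝ) ≤ 12 * d + d * C₂ := by positivity
                linarith
              · linarith [hlow x h]
  · have hlap : ∀ B : ℝ, R ^ 2 * ‖fderiv ℝ (fderiv ℝ Φ) (R⁻¹ • x)‖ ≤ B →
        |Laplacian.laplacian (fun x => R ^ 4 * Φ (R⁻¹ • x)) x| ≤ d * B := by
      intro B hB
      refine abs_laplacian_le ?_
      rw [hf2, norm_smul, Real.norm_eq_abs, abs_of_pos (by positivity)]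
      exact hB
    rcases lt_or_ge ‖R⁻¹ • x‖ 2 with h | h
    · rw [hval1 _ h, ← mul_pow, ← hsc x]
      have h1 : R ^ 2 * ‖fderiv ℝ (fderiv ℝ Φ) (R⁻¹ • x)‖ ≤ 12 * (1 + ‖x‖ ^ 4) := by
        rw [hd2 _ h, norm_neg]
        calc R ^ 2 * _ ≤ R ^ 2 * (12 * ‖R⁻¹ • x‖ ^ 2) := by
              gcongr; exact norm_fderiv_fderiv_norm_pow_four _
          _ = 12 * ‖x‖ ^ 2 := by rw [hsc x]; ring
          _ ≤ _ := by nlinarith [sq_nonneg (‖x‖ ^ 2 - 1)]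
      refine (hlap _ h1).trans ?_
      rw [← mul_assoc]
      gcongr
      have : (0 : ℝ) ≤ 8 + 4 * C₁ + d * C₂ := by positivity
      linarith
    · have h1 : R ^ 2 * ‖fderiv ℝ (fderiv ℝ Φ) (R⁻¹ • x)‖
          ≤ C₂ * (1 + R ^ 4 * (1 - Φ (R⁻¹ • x))) := by
        calc R ^ 2 * _ ≤ R ^ 4 * C₂ := by gcongr; exact hC₂ _
          _ = C₂ * R ^ 4 := by ring
          _ ≤ _ := by gcongr; linarith [hlow x h]
      refine (hlap _ h1).trans ?_
      rw [← mul_assoc]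
      have := hlow x h
      have : 0 ≤ R ^ 4 * (1 - Φ (R⁻¹ • x)) := by linarith [pow_pos hR0 4]
      gcongr
      have : (0 : ℝ) ≤ 8 + 4 * C₁ + 12 * d := by positivity
      linarith

/-- The curve has compact image for weak convergence, so an increasing cover by balls captures half
of the mass uniformly in time. -/
lemma exists_ball_half_mass {μ : ℝ → P2 d} (hμ : ContinuousOn μ (Icc 0 T)) :
    ∃ r : ℝ, 0 < r ∧ ∀ t ∈ Icc 0 T, 1 / 2 ≤ (μ t).meas.real (Metric.ball 0 r) := by
  have hc : IsCompact ((fun t => (μ t).1) '' Icc 0 T) :=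
    isCompact_Icc.image_of_continuousOn (continuous_subtype_val.comp_continuousOn hμ)
  obtain ⟨k, hk⟩ := exists_measure_iUnion_gt_of_isCompact_closure
    (fun n : ℕ => Metric.ball (0 : Rd d) (n + 1)) (fun n => Metric.isOpen_ball)
    (by
      rw [eq_univ_iff_forall]
      intro x
      obtain ⟨n, hn⟩ := exists_nat_ge ‖x‖
      exact mem_iUnion.2 ⟨n, mem_ball_zero_iff.2 (by linarith)⟩)
    hc.closure (1 / 2) (by simp) (by simp)
  refine ⟨k + 1, by positivity, fun t ht => ?_⟩
  have h1 := hk _ (mem_image_of_mem _ ht)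
  have h2 : ⋃ i ≤ k, Metric.ball (0 : Rd d) (i + 1) ⊆ Metric.ball 0 (k + 1) := by
    refine iUnion₂_subset fun i hi => Metric.ball_subset_ball ?_
    have : (i : ℝ) ≤ k := by exact_mod_cast hi
    linarith
  have h3 : (1 / 2 : ℝ≥0∞) ≤ (μ t).meas (Metric.ball 0 (k + 1)) := by
    refine le_trans ?_ (measure_mono h2)
    refine le_trans (le_of_eq ?_) (h1.le.trans (le_of_eq ?_))
    · simp
    · simp [P2.meas]
  rw [Measure.real, ← ENNReal.ofReal_le_iff_le_toReal (measure_ne_top _ _)]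
  simpa using h3

/-- A Grönwall argument on short intervals. -/
lemma le_of_short_time_bound (hT : 0 ≤ T) {z : ℝ → ℝ} {δ : ℝ} (hδ : 0 < δ)
    (hz0 : ∀ t ∈ Icc 0 T, 0 ≤ z t) {B : ℝ} (hB : ∀ t ∈ Icc 0 T, z t ≤ B)
    (h : ∀ s ∈ Icc 0 T, ∀ t ∈ Icc s T, t - s ≤ δ → ∀ Z, (∀ r ∈ Icc s t, z r ≤ Z) →
      z t ≤ z s + Z / 2) :
    ∀ t ∈ Icc 0 T, z t ≤ 2 ^ (⌈T / δ⌉₊) * z 0 := by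
  have hstep : ∀ s ∈ Icc 0 T, ∀ t ∈ Icc s T, t - s ≤ δ → z t ≤ 2 * z s := by
    intro s hs t ht hts
    -- The a priori bound `B` makes the supremum finite, so `Z ≤ z s + Z/2` can be absorbed into `Z
    -- ≤ 2 z s`. No continuity of `z` is needed.
    set Z := sSup (z '' Icc s t) with hZ
    have hbdd : BddAbove (z '' Icc s t) :=
      ⟨B, by rintro _ ⟨r, hr, rfl⟩; exact hB r ⟨hs.1.trans hr.1, hr.2.trans ht.2⟩⟩
    have hle : ∀ r ∈ Icc s t, z r ≤ Z := fun r hr => le_csSup hbdd (mem_image_of_mem _ hr)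
    have hZle : Z ≤ z s + Z / 2 := by
      refine csSup_le ⟨_, mem_image_of_mem _ (left_mem_Icc.2 ht.1)⟩ ?_
      rintro _ ⟨r, hr, rfl⟩
      exact h s hs r ⟨hr.1, hr.2.trans ht.2⟩ (by linarith [hr.2]) Z
        fun q hq => hle q ⟨hq.1, hq.2.trans hr.2⟩
    linarith [hle t (right_mem_Icc.2 ht.1)]
  have hind : ∀ n : ℕ, ∀ t ∈ Icc 0 T, t ≤ n * δ → z t ≤ 2 ^ n * z 0 := by
    intro n
    induction n with
    | zero =>
      intro t ht htn
      have : t = 0 := le_antisymm (by simpa using htn) ht.1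
      simp [this]
    | succ n ih =>
      intro t ht htn
      push_cast at htn
      rcases le_total t (n * δ) with hle | hle
      · refine (ih t ht hle).trans ?_
        gcongr
        · exact hz0 0 (left_mem_Icc.2 hT)
        · norm_num
        · exact Nat.le_succ n
      · have hs : (n : ℝ) * δ ∈ Icc 0 T := ⟨by positivity, hle.trans ht.2⟩
        have h1 := hstep _ hs t ⟨hle, ht.2⟩ (by linarith)
        have h2 := ih _ hs le_rfl
        rw [pow_succ]
        linarith
  intro t ht
  refine hind _ t ht (ht.2.trans ?_)
  rw [← div_le_iff₀ hδ]
  exact Nat.le_ceil _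

end MomentWeights

/-! ### Fourth moment bounds, first qualitative and then uniform. -/

section Moments

variable {d : ℕ} {T : ℝ}

lemma W2_self (μ : P2 d) : W2 μ μ = 0 := by
  have := W2_le_of_map_eq (μ := μ) (ν := μ) (m := μ.meas) measurable_id measurable_id
    Measure.map_id Measure.map_id
  simpa using this

lemma IsLinearSolution.abs_sub_le {κ : ℝ} {v : ℝ → Rd d → Rd d} {μ : ℝ → P2 d}
    (h : IsLinearSolution T κ v μ) {φ : Rd d → ℝ} (hφ : ContDiff ℝ ∞ φ) (hφc : HasCompactSupport φ)
    {s t : ℝ} (hs : 0 ≤ s) (hst : s ≤ t) (ht : t ≤ T) {G : ℝ → ℝ} (hG : IntervalIntegrable G volume s t)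
    (hle : ∀ᵐ r ∂(volume.restrict (Ioo s t)),
      |∫ x, generator κ φ (v r x) x ∂(μ r).meas| ≤ G r) :
    |∫ x, φ x ∂(μ t).meas - ∫ x, φ x ∂(μ s).meas| ≤ ∫ r in s..t, G r := by
  rw [h.eq φ hφ hφc s ⟨hs, hst.trans ht⟩ t ⟨hs.trans hst, ht⟩, ← Real.norm_eq_abs]
  refine intervalIntegral.norm_integral_le_of_norm_le hst ?_ hG
  rw [← ae_restrict_iff' measurableSet_Ioc, ← restrict_Ioo_eq_restrict_Ioc]
  exact hle

lemma ae_restrict_Ioo_mono {P : ℝ → Prop} (h : ∀ᵐ r ∂(volume.restrict (Ioo 0 T)), P r) {s t : ℝ}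
    (hs : 0 ≤ s) (ht : t ≤ T) : ∀ᵐ r ∂(volume.restrict (Ioo s t)), P r :=
  ae_restrict_of_ae_restrict_of_subset (Ioo_subset_Ioo hs ht) h

/-- Fatou's lemma along the truncations of `‖x‖⁴`, which are eventually exact at each point. -/
lemma lintegral_norm_pow_four_le {μ : P2 d} {φ : ℕ → Rd d → ℝ} {D : ℝ}
    (hφ : ∀ n, ContDiff ℝ ∞ (φ n)) (hφc : ∀ n, HasCompactSupport (φ n))
    (h0 : ∀ (n : ℕ) x, 0 ≤ ((n : ℝ) + 1) ^ 4 - φ n x)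
    (heq : ∀ (n : ℕ) x, ‖x‖ ≤ (n : ℝ) + 1 → ((n : ℝ) + 1) ^ 4 - φ n x = ‖x‖ ^ 4)
    (hD : ∀ n : ℕ, ((n : ℝ) + 1) ^ 4 - ∫ x, φ n x ∂μ.meas ≤ D) :
    ∫⁻ x, ‖x‖ₑ ^ 4 ∂μ.meas ≤ ENNReal.ofReal D := by
  have hintg : ∀ n : ℕ, ∫⁻ x, ENNReal.ofReal (((n : ℝ) + 1) ^ 4 - φ n x) ∂μ.meas
      ≤ ENNReal.ofReal D := by
    intro n
    have hi := (hφ n).continuous.integrable_of_hasCompactSupport (μ := μ.meas) (hφc n)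
    have hI : Integrable (fun x => ((n : ℝ) + 1) ^ 4 - φ n x) μ.meas := (integrable_const _).sub hi
    rw [← ofReal_integral_eq_lintegral_ofReal hI (ae_of_all _ (h0 n))]
    refine ENNReal.ofReal_le_ofReal (le_of_eq_of_le ?_ (hD n))
    rw [integral_sub (integrable_const _) hi]
    simp
  have hlim : ∀ x : Rd d, liminf (fun n : ℕ => ENNReal.ofReal (((n : ℝ) + 1) ^ 4 - φ n x)) atTop
      = ‖x‖ₑ ^ 4 := by
    intro x
    refine Tendsto.liminf_eq (tendsto_const_nhds.congr' ?_)
    obtain ⟨N, hN⟩ := exists_nat_ge ‖x‖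
    filter_upwards [eventually_ge_atTop N] with n hn
    have : (N : ℝ) ≤ n := by exact_mod_cast hn
    rw [heq n x (by linarith), ENNReal.ofReal_pow (norm_nonneg _), ofReal_norm]
  calc ∫⁻ x, ‖x‖ₑ ^ 4 ∂μ.meas
      = ∫⁻ x, liminf (fun n : ℕ => ENNReal.ofReal (((n : ℝ) + 1) ^ 4 - φ n x)) atTop ∂μ.meas := by
        simp_rw [hlim]
    _ ≤ liminf (fun n : ℕ => ∫⁻ x, ENNReal.ofReal (((n : ℝ) + 1) ^ 4 - φ n x) ∂μ.meas) atTop :=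
        lintegral_liminf_le fun n =>
          (continuous_const.sub (hφ n).continuous).measurable.ennreal_ofReal
    _ ≤ ENNReal.ofReal D := by
        refine liminf_le_of_le (by isBoundedDefault) fun b hb => ?_
        obtain ⟨n, hn⟩ := hb.exists
        exact hn.trans (hintg n)

lemma const_sub_integral_le {μ : P2 d} {φ : Rd d → ℝ} {c : ℝ} {K : ℝ≥0} (hφ : ContDiff ℝ ∞ φ)
    (hφc : HasCompactSupport φ) (hle : ∀ x, c - φ x ≤ ‖x‖ ^ 4)
    (hK : ∫⁻ x, ‖x‖ₑ ^ 4 ∂μ.meas ≤ K) : c - ∫ x, φ x ∂μ.meas ≤ ∫ x, ‖x‖ ^ 4 ∂μ.meas := by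
  have hi := hφ.continuous.integrable_of_hasCompactSupport (μ := μ.meas) hφc
  have : c - ∫ x, φ x ∂μ.meas = ∫ x, (c - φ x) ∂μ.meas := by
    rw [integral_sub (integrable_const _) hi]; simp
  rw [this]
  exact integral_mono ((integrable_const _).sub hi) (integrable_norm_pow_four hK) hle

/-- A solution whose velocity has linear growth, integrably in time, has bounded fourth moments. -/
lemma IsLinearSolution.exists_moment_bound (hT : 0 < T) {κ : ℝ} (hκ : |κ| ≤ 1)
    {v : ℝ → Rd d → Rd d} {μ : ℝ → P2 d} (h : IsLinearSolution T κ v μ) {g : ℝ → ℝ}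
    (hg : IntegrableOn g (Ioo 0 T)) (hg0 : ∀ t, 0 ≤ g t)
    (hv : ∀ᵐ t ∂(volume.restrict (Ioo 0 T)), ∀ x, ‖v t x‖ ≤ g t * (1 + ‖x‖)) {μ₀ : P2 d}
    (h0 : ∀ ψ : Rd d → ℝ, ContDiff ℝ ∞ ψ → HasCompactSupport ψ →
      ∫ x, ψ x ∂(μ 0).meas = ∫ x, ψ x ∂μ₀.meas) {K₀ : ℝ≥0}
    (hK₀ : ∫⁻ x, ‖x‖ₑ ^ 4 ∂μ₀.meas ≤ K₀) :
    ∃ K : ℝ≥0, ∀ t ∈ Icc 0 T, ∫⁻ x, ‖x‖ₑ ^ 4 ∂(μ t).meas ≤ K := by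
  obtain ⟨C, hC0, hw⟩ := exists_moment_weight d
  choose φ hφ hφc hφ0 hφ4 hφeq hφ1 hφ2 hφ3 using fun n : ℕ =>
    hw ((n : ℝ) + 1) (by linarith [n.cast_nonneg (α := ℝ)])
  set H : ℝ → ℝ := fun r => C * (g r + 1) with hH
  have hHi : IntervalIntegrable H volume 0 T := by
    refine (IntervalIntegrable.add ?_ (intervalIntegrable_const)).const_mul C
    rwa [intervalIntegrable_iff_integrableOn_Ioo_of_le hT.le]
  have hH0 : ∀ r, 0 ≤ H r := fun r => mul_nonneg hC0 (by linarith [hg0 r])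
  have hunif : UniformContinuousOn (fun t => ∫ s in (0 : ℝ)..t, H s) (Icc 0 T) := by
    refine isCompact_Icc.uniformContinuousOn_of_continuous ?_
    have := intervalIntegral.continuousOn_primitive_interval' hHi left_mem_uIcc
    rwa [uIcc_of_le hT.le] at this
  -- The integrable rate `H` has a uniformly continuous primitive, so on all sufficiently short
  -- intervals its integral is at most `1/2`, as the Grönwall lemma requires.
  obtain ⟨δ', hδ', hδ⟩ := Metric.uniformContinuousOn_iff.1 hunif (1 / 2) (by norm_num)
  have hsub : ∀ s ∈ Icc 0 T, ∀ t ∈ Icc 0 T, IntervalIntegrable H volume s t := fun s hs t ht =>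
    hHi.mono_set (uIcc_subset_uIcc (by rwa [uIcc_of_le hT.le]) (by rwa [uIcc_of_le hT.le]))
  have hsmall : ∀ s ∈ Icc 0 T, ∀ t ∈ Icc s T, t - s ≤ δ' / 2 → ∫ r in s..t, H r ≤ 1 / 2 := by
    intro s hs t ht hts
    have ht' : t ∈ Icc 0 T := ⟨hs.1.trans ht.1, ht.2⟩
    have h1 := hδ t ht' s hs (by
      rw [Real.dist_eq, abs_of_nonneg (by linarith [ht.1])]; linarith)
    rw [Real.dist_eq, intervalIntegral.integral_interval_sub_left
      (hsub 0 (left_mem_Icc.2 hT.le) t ht') (hsub 0 (left_mem_Icc.2 hT.le) s hs)] at h1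
    exact (le_abs_self _).trans h1.le
  have hφi : ∀ n t, Integrable (φ n) (μ t).meas := fun n t =>
    (hφ n).continuous.integrable_of_hasCompactSupport (hφc n)
  -- The factor does not depend on the truncation level `n`, so the bound survives the limit `n →
  -- ∞`. The summand `1` absorbs the constant terms in the derivative bounds of the weight.
  have main : ∀ n : ℕ, ∀ t ∈ Icc 0 T, 1 + (((n : ℝ) + 1) ^ 4 - ∫ x, φ n x ∂(μ t).meas)
      ≤ 2 ^ (⌈T / (δ' / 2)⌉₊) * (1 + (((n : ℝ) + 1) ^ 4 - ∫ x, φ n x ∂(μ 0).meas)) := by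
    intro n
    have hz : ∀ t, 1 + (((n : ℝ) + 1) ^ 4 - ∫ x, φ n x ∂(μ t).meas)
        = ∫ x, (1 + (((n : ℝ) + 1) ^ 4 - φ n x)) ∂(μ t).meas := by
      intro t
      have hI : Integrable (fun x => ((n : ℝ) + 1) ^ 4 - φ n x) (μ t).meas :=
        (integrable_const _).sub (hφi n t)
      rw [integral_add (integrable_const _) hI,
        integral_sub (integrable_const _) (hφi n t)]
      simp
    obtain ⟨B, hB⟩ := (hφc n).exists_bound_of_continuous (hφ n).continuous
    refine le_of_short_time_bound hT.le (by positivity)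
      (z := fun t => 1 + (((n : ℝ) + 1) ^ 4 - ∫ x, φ n x ∂(μ t).meas))
      (fun t ht => ?_) (B := 1 + (((n : ℝ) + 1) ^ 4 + B)) (fun t ht => ?_) ?_
    · simp only [hz]
      exact integral_nonneg fun x => show (0 : ℝ) ≤ _ by linarith [hφ0 n x]
    · have : |∫ x, φ n x ∂(μ t).meas| ≤ B := by
        rw [← Real.norm_eq_abs]
        simpa using norm_integral_le_of_norm_le_const (μ := (μ t).meas) (ae_of_all _ hB)
      linarith [neg_abs_le (∫ x, φ n x ∂(μ t).meas)]
    · intro s hs t ht hts Z hZ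
      have hG : IntervalIntegrable (fun r => H r * Z) volume s t :=
        (hsub s hs t ⟨hs.1.trans ht.1, ht.2⟩).mul_const Z
      have hinc := h.abs_sub_le (hφ n) (hφc n) hs.1 ht.1 ht.2 hG (by
        filter_upwards [ae_restrict_Ioo_mono hv hs.1 ht.2, ae_restrict_mem measurableSet_Ioo]
          with r hr hrm
        have hbd : ∀ x, ‖generator κ (φ n) (v r x) x‖ ≤ H r * (1 + (((n : ℝ) + 1) ^ 4 - φ n x)) := by
          intro x
          have e1 : ‖fderiv ℝ (φ n) x (v r x)‖ ≤ g r * (C * (1 + (((n : ℝ) + 1) ^ 4 - φ n x))) := by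
            calc _ ≤ ‖fderiv ℝ (φ n) x‖ * ‖v r x‖ := (fderiv ℝ (φ n) x).le_opNorm _
              _ ≤ ‖fderiv ℝ (φ n) x‖ * (g r * (1 + ‖x‖)) := by gcongr; exact hr x
              _ = g r * ((1 + ‖x‖) * ‖fderiv ℝ (φ n) x‖) := by ring
              _ ≤ _ := mul_le_mul_of_nonneg_left (hφ2 n x) (hg0 r)
          have e2 : ‖κ * Laplacian.laplacian (φ n) x‖ ≤ 1 * (C * (1 + (((n : ℝ) + 1) ^ 4 - φ n x))) := by
            rw [norm_mul, Real.norm_eq_abs, Real.norm_eq_abs]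
            exact mul_le_mul hκ (hφ3 n x) (abs_nonneg _) zero_le_one
          refine (norm_add_le _ _).trans ((add_le_add e1 e2).trans (le_of_eq ?_))
          rw [hH]; ring
        rw [← Real.norm_eq_abs]
        refine (norm_integral_le_of_norm_le (g := fun x => H r * (1 + (((n : ℝ) + 1) ^ 4 - φ n x)))
          (((integrable_const _).add ((integrable_const _).sub (hφi n r))).const_mul _)
          (ae_of_all _ hbd)).trans ?_
        rw [integral_const_mul, ← hz]
        exact mul_le_mul_of_nonneg_left (hZ r (Ioo_subset_Icc_self hrm)) (hH0 r))
      rw [intervalIntegral.integral_mul_const] at hinc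
      have hZ0 : 0 ≤ Z := by
        refine le_trans ?_ (hZ s (left_mem_Icc.2 ht.1))
        simp only [hz]
        exact integral_nonneg fun x => show (0 : ℝ) ≤ _ by linarith [hφ0 n x]
      have h3 : (∫ r in s..t, H r) * Z ≤ 1 / 2 * Z := by
        gcongr
        exact hsmall s hs t ht hts
      have := (abs_le.1 hinc).1
      linarith
  set D : ℝ := 2 ^ (⌈T / (δ' / 2)⌉₊) * (1 + ∫ x, ‖x‖ ^ 4 ∂μ₀.meas) with hD
  refine ⟨D.toNNReal, fun t ht => ?_⟩
  refine lintegral_norm_pow_four_le hφ hφc hφ0 hφeq (D := D) fun n => ?_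
  have h1 := main n t ht
  rw [h0 _ (hφ n) (hφc n)] at h1
  have h2 := const_sub_integral_le (hφ n) (hφc n) (hφ4 n) hK₀
  have h3 : 2 ^ (⌈T / (δ' / 2)⌉₊) * (1 + (((n : ℝ) + 1) ^ 4 - ∫ x, φ n x ∂μ₀.meas)) ≤ D := by
    rw [hD]; gcongr
  linarith

lemma mul_pow_three_le {a b : ℝ} (ha : 0 ≤ a) (hb : 0 ≤ b) : a * b ^ 3 ≤ a ^ 4 + b ^ 4 := by
  rcases le_total a b with h | h
  · calc a * b ^ 3 ≤ b * b ^ 3 := by gcongr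
      _ = b ^ 4 := by ring
      _ ≤ _ := by linarith [pow_nonneg ha 4]
  · calc a * b ^ 3 ≤ a * a ^ 3 := by gcongr
      _ = a ^ 4 := by ring
      _ ≤ _ := by linarith [pow_nonneg hb 4]

lemma integrable_norm (μ : P2 d) : Integrable (fun x => ‖x‖) μ.meas := by
  refine Integrable.mono' (g := fun x => 1 + ‖x‖ ^ 2) ?_ (by fun_prop) (ae_of_all _ fun x => ?_)
  · refine (integrable_const _).add ⟨by fun_prop, ?_⟩
    rw [hasFiniteIntegral_iff_enorm]
    refine lt_of_le_of_lt (le_of_eq ?_) μ.2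
    simp [P2.meas]
  · rw [norm_norm]
    nlinarith [sq_nonneg (‖x‖ - 1)]

/-- Under the growth condition of the nonlocal velocity, the fourth moments are bounded by a
constant depending only on the data. -/
lemma exists_uniform_moment_bound (d : ℕ) (hT : 0 < T) {M : ℝ} (hM : 0 ≤ M) (K₀ : ℝ≥0) :
    ∃ K : ℝ≥0, ∀ (κ : ℝ) (v : ℝ → Rd d → Rd d) (μ : ℝ → P2 d) (μ₀ : P2 d), |κ| ≤ 1 →
      IsLinearSolution T κ v μ →
      (∃ K' : ℝ≥0, ∀ t ∈ Icc 0 T, ∫⁻ x, ‖x‖ₑ ^ 4 ∂(μ t).meas ≤ K') →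
      (∀ᵐ t ∂(volume.restrict (Ioo 0 T)), ∀ x,
        ‖v t x‖ ≤ M * (1 + ‖x‖ + ∫ y, ‖y‖ ∂(μ t).meas)) →
      (∀ ψ : Rd d → ℝ, ContDiff ℝ ∞ ψ → HasCompactSupport ψ →
        ∫ x, ψ x ∂(μ 0).meas = ∫ x, ψ x ∂μ₀.meas) →
      ∫⁻ x, ‖x‖ₑ ^ 4 ∂μ₀.meas ≤ K₀ →
      ∀ t ∈ Icc 0 T, ∫⁻ x, ‖x‖ₑ ^ 4 ∂(μ t).meas ≤ K := by
  obtain ⟨C, hC0, hw⟩ := exists_moment_weight d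
  choose φ hφ hφc hφ0 hφ4 hφeq hφ1 hφ2 hφ3 using fun n : ℕ =>
    hw ((n : ℝ) + 1) (by linarith [n.cast_nonneg (α := ℝ)])
  -- `C'` dominates the growth rate of `1 + ∫ ‖x‖⁴`, and on steps of length `δ` the growth is at
  -- most half of the supremum. The a priori finite bound enters only to allow the absorption and
  -- does not influence the resulting constant.
  set C' : ℝ := 3 * M * C + C with hC'
  have hC'0 : 0 ≤ C' := by positivity
  set δ : ℝ := 1 / (2 * (C' + 1)) with hδ
  have hδ0 : 0 < δ := by positivity
  set D : ℝ := 2 ^ (⌈T / δ⌉₊) * (1 + K₀) with hD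
  refine ⟨D.toNNReal, fun κ v μ μ₀ hκ h hK' hv h0 hK₀ => ?_⟩
  obtain ⟨K', hK'⟩ := hK'
  have hi4 : ∀ t ∈ Icc 0 T, Integrable (fun x => ‖x‖ ^ 4) (μ t).meas := fun t ht =>
    integrable_norm_pow_four (hK' t ht)
  have hstep : ∀ s ∈ Icc 0 T, ∀ t ∈ Icc s T, t - s ≤ δ → ∀ Z,
      (∀ r ∈ Icc s t, 1 + ∫ x, ‖x‖ ^ 4 ∂(μ r).meas ≤ Z) →
      1 + ∫ x, ‖x‖ ^ 4 ∂(μ t).meas ≤ 1 + ∫ x, ‖x‖ ^ 4 ∂(μ s).meas + Z / 2 := by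
    intro s hs t ht hts Z hZ
    have hZ0 : 0 ≤ Z := le_trans (by positivity) (hZ s (left_mem_Icc.2 ht.1))
    have hle : ∫⁻ x, ‖x‖ₑ ^ 4 ∂(μ t).meas
        ≤ ENNReal.ofReal (∫ x, ‖x‖ ^ 4 ∂(μ s).meas + Z / 2) := by
      refine lintegral_norm_pow_four_le hφ hφc hφ0 hφeq fun n => ?_
      have hinc := h.abs_sub_le (hφ n) (hφc n) hs.1 ht.1 ht.2 (G := fun _ => C' * Z)
        intervalIntegrable_const (by
        filter_upwards [ae_restrict_Ioo_mono hv hs.1 ht.2, ae_restrict_mem measurableSet_Ioo]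
          with r hr hrm
        have hrT : r ∈ Icc 0 T := ⟨hs.1.trans hrm.1.le, hrm.2.le.trans ht.2⟩
        set m₁ := ∫ y, ‖y‖ ∂(μ r).meas with hm₁
        set m₄ := ∫ y, ‖y‖ ^ 4 ∂(μ r).meas with hm₄
        have hm₁0 : 0 ≤ m₁ := integral_nonneg fun y => norm_nonneg y
        have hm₄0 : 0 ≤ m₄ := integral_nonneg fun y => by positivity
        -- The nonlocal growth term multiplies the first moment by a gradient of size `‖x‖³`;
        -- Young's inequality under the integral returns fourth moments only.
        have hyoung : ∀ x : Rd d, m₁ * ‖x‖ ^ 3 ≤ m₄ + ‖x‖ ^ 4 := by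
          intro x
          have e1 : m₁ * ‖x‖ ^ 3 = ∫ y, ‖y‖ * ‖x‖ ^ 3 ∂(μ r).meas := by rw [integral_mul_const]
          have e2 : m₄ + ‖x‖ ^ 4 = ∫ y, (‖y‖ ^ 4 + ‖x‖ ^ 4) ∂(μ r).meas := by
            rw [integral_add (hi4 r hrT) (integrable_const _)]; simp [hm₄]
          rw [e1, e2]
          exact integral_mono ((integrable_norm _).mul_const _)
            ((hi4 r hrT).add (integrable_const _))
            fun y => mul_pow_three_le (norm_nonneg y) (norm_nonneg x)
        have hbd : ∀ x, ‖generator κ (φ n) (v r x) x‖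
            ≤ (2 * M * C + C) * ‖x‖ ^ 4 + (M * C + M * C * m₄ + C) := by
          intro x
          have e1 : ‖fderiv ℝ (φ n) x (v r x)‖ ≤ M * (C * (1 + ‖x‖ ^ 4) + C * (m₄ + ‖x‖ ^ 4)) := by
            calc _ ≤ ‖fderiv ℝ (φ n) x‖ * ‖v r x‖ := (fderiv ℝ (φ n) x).le_opNorm _
              _ ≤ ‖fderiv ℝ (φ n) x‖ * (M * (1 + ‖x‖ + m₁)) := by gcongr; exact hr x
              _ = M * ((1 + ‖x‖) * ‖fderiv ℝ (φ n) x‖ + m₁ * ‖fderiv ℝ (φ n) x‖) := by ring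
              _ ≤ M * (C * (1 + (((n : ℝ) + 1) ^ 4 - φ n x)) + m₁ * (C * ‖x‖ ^ 3)) := by
                  exact mul_le_mul_of_nonneg_left
                    (add_le_add (hφ2 n x) (mul_le_mul_of_nonneg_left (hφ1 n x) hm₁0)) hM
              _ ≤ M * (C * (1 + ‖x‖ ^ 4) + C * (m₁ * ‖x‖ ^ 3)) := by
                  rw [show m₁ * (C * ‖x‖ ^ 3) = C * (m₁ * ‖x‖ ^ 3) by ring]
                  gcongr
                  exact hφ4 n x
              _ ≤ _ := by gcongr; exact hyoung x
          have e2 : ‖κ * Laplacian.laplacian (φ n) x‖ ≤ 1 * (C * (1 + ‖x‖ ^ 4)) := by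
            rw [norm_mul, Real.norm_eq_abs, Real.norm_eq_abs]
            refine mul_le_mul hκ ((hφ3 n x).trans ?_) (abs_nonneg _) zero_le_one
            gcongr
            exact hφ4 n x
          refine (norm_add_le _ _).trans ((add_le_add e1 e2).trans (le_of_eq ?_))
          ring
        rw [← Real.norm_eq_abs]
        refine (norm_integral_le_of_norm_le
          (g := fun x => (2 * M * C + C) * ‖x‖ ^ 4 + (M * C + M * C * m₄ + C))
          (((hi4 r hrT).const_mul _).add (integrable_const _))
          (ae_of_all _ hbd)).trans ?_
        rw [integral_add ((hi4 r hrT).const_mul _) (integrable_const _), integral_const_mul]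
        simp only [integral_const, probReal_univ, smul_eq_mul, one_mul]
        have h1 := hZ r (Ioo_subset_Icc_self hrm)
        calc (2 * M * C + C) * m₄ + (M * C + M * C * m₄ + C)
            ≤ C' * (1 + m₄) := by rw [hC']; nlinarith [mul_nonneg hM hC0]
          _ ≤ C' * Z := by gcongr)
      have hts' : (∫ _r in s..t, C' * Z) ≤ Z / 2 := by
        rw [intervalIntegral.integral_const, smul_eq_mul]
        calc (t - s) * (C' * Z) ≤ δ * ((C' + 1) * Z) := by
              gcongr
              linarith
          _ = Z / 2 := by rw [hδ]; field_simp
      have h2 := const_sub_integral_le (hφ n) (hφc n) (hφ4 n) (hK' s hs)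
      have := (abs_le.1 hinc).1
      linarith
    have : ∫ x, ‖x‖ ^ 4 ∂(μ t).meas ≤ ∫ x, ‖x‖ ^ 4 ∂(μ s).meas + Z / 2 := by
      have h5 := integral_norm_pow_four_le (μ := μ t)
        (K := (∫ x, ‖x‖ ^ 4 ∂(μ s).meas + Z / 2).toNNReal) hle
      rwa [Real.coe_toNNReal _ (by positivity)] at h5
    linarith
  have hfin := le_of_short_time_bound hT.le hδ0 (z := fun t => 1 + ∫ x, ‖x‖ ^ 4 ∂(μ t).meas)
    (fun t _ => by positivity) (B := 1 + K')
    (fun t ht => by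
      have := integral_norm_pow_four_le (hK' t ht)
      linarith) hstep
  -- The initial measure is known only through test functions, so its moment is again recovered by
  -- Fatou.
  have hstart : ∫ x, ‖x‖ ^ 4 ∂(μ 0).meas ≤ K₀ := by
    have hle : ∫⁻ x, ‖x‖ₑ ^ 4 ∂(μ 0).meas ≤ ENNReal.ofReal K₀ := by
      refine lintegral_norm_pow_four_le hφ hφc hφ0 hφeq fun n => ?_
      rw [h0 _ (hφ n) (hφc n)]
      exact (const_sub_integral_le (hφ n) (hφc n) (hφ4 n) hK₀).trans (integral_norm_pow_four_le hK₀)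
    exact integral_norm_pow_four_le (hle.trans (by simp))
  intro t ht
  have h1 := hfin t ht
  have h2 : 2 ^ (⌈T / δ⌉₊) * (1 + ∫ x, ‖x‖ ^ 4 ∂(μ 0).meas) ≤ D := by rw [hD]; gcongr
  have h3 : ∫ x, ‖x‖ ^ 4 ∂(μ t).meas ≤ D := by linarith
  have h4 := ENNReal.ofReal_le_ofReal h3
  rw [ofReal_integral_eq_lintegral_ofReal (hi4 t ht) (ae_of_all _ fun x => by positivity)] at h4
  change _ ≤ ENNReal.ofReal D
  simpa [ENNReal.ofReal_pow] using h4

end Moments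

/-! ### Reduction to regular solutions with constants independent of viscosity and control. -/

section RegularSolutions

variable {d : ℕ} {T : ℝ}

lemma exists_moment_bound_of_isCompact_support {μ₀ : P2 d} (h : IsCompact μ₀.meas.support) :
    ∃ K : ℝ≥0, ∫⁻ x, ‖x‖ₑ ^ 4 ∂μ₀.meas ≤ K := by
  obtain ⟨R, hR⟩ := h.isBounded.exists_norm_le
  refine ⟨R.toNNReal ^ 4, ?_⟩
  calc ∫⁻ x, ‖x‖ₑ ^ 4 ∂μ₀.meas ≤ ∫⁻ _, (R.toNNReal : ℝ≥0∞) ^ 4 ∂μ₀.meas := by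
        refine lintegral_mono_ae ?_
        filter_upwards [Measure.support_mem_ae (μ := μ₀.meas)] with x hx
        gcongr
        rw [← ofReal_norm]
        exact ENNReal.ofReal_le_ofReal (hR x hx)
    _ = _ := by simp

lemma IsVelocityField.lipschitzWith {b : ℝ → Rd d → P2 d → Rd d} {L : ℝ≥0}
    (h : ∀ t ∈ Icc 0 T, ∀ (x y : Rd d) (μ ν : P2 d),
      ‖b t x μ - b t y ν‖ₑ ≤ L * (‖x - y‖ₑ + W2 μ ν)) {t : ℝ} (ht : t ∈ Icc 0 T) (μ : P2 d) :
    LipschitzWith L (fun x => b t x μ) := by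
  intro x y
  have := h t ht x y μ μ
  rwa [W2_self, add_zero, ← edist_eq_enorm_sub, ← edist_eq_enorm_sub] at this

/-- A function that oscillates at most linearly is controlled everywhere by its average over a ball
carrying half of the mass. This turns local integrability of the drift into linear growth with an
integrable coefficient. The constant `C` leaves room for a bounded part without a Lipschitz bound.
-/
lemma norm_le_of_half_mass {m : Measure (Rd d)} [IsProbabilityMeasure m] {f : Rd d → Rd d}
    {r L C : ℝ} (hL : 0 ≤ L) (hm : 1 / 2 ≤ m.real (Metric.ball 0 r))
    (hf : ∀ x y, ‖f x - f y‖ ≤ L * ‖x - y‖ + C)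
    (hintg : IntegrableOn f (Metric.ball 0 r) m) (hr : 0 ≤ r) (hC : 0 ≤ C) (x : Rd d) :
    ‖f x‖ ≤ (2 * (∫ y in Metric.ball 0 r, ‖f y‖ ∂m) + L * r + L + C) * (1 + ‖x‖) := by
  set I := ∫ y in Metric.ball 0 r, ‖f y‖ ∂m
  have hI : 0 ≤ I := integral_nonneg fun y => norm_nonneg _
  set q := m.real (Metric.ball (0 : Rd d) r)
  have h1 : q * (‖f x‖ - (L * (‖x‖ + r) + C)) ≤ I := by
    have : q * (‖f x‖ - (L * (‖x‖ + r) + C))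
        = ∫ _ in Metric.ball (0 : Rd d) r, (‖f x‖ - (L * (‖x‖ + r) + C)) ∂m := by
      rw [setIntegral_const, smul_eq_mul]
    rw [this]
    refine setIntegral_mono_on (integrable_const _) hintg.norm Metric.isOpen_ball.measurableSet
      fun y hy => ?_
    have hy' : ‖y‖ < r := by simpa using hy
    have h2 := hf x y
    have h3 : ‖f x‖ ≤ ‖f y‖ + ‖f x - f y‖ := by
      have := norm_add_le (f y) (f x - f y)
      rwa [add_sub_cancel] at this
    have h4 : L * ‖x - y‖ ≤ L * (‖x‖ + r) := by
      gcongr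
      exact (norm_sub_le _ _).trans (by linarith)
    linarith
  clear_value I q
  have h2 : ‖f x‖ ≤ 2 * I + (L * (‖x‖ + r) + C) := by
    by_contra! hlt
    nlinarith
  have hx := norm_nonneg x
  have : 0 ≤ (2 * I + L * r + C) * ‖x‖ := by positivity
  nlinarith

/-- A solution of the linear equation with velocity `β + w`, where `β` is Lipschitz in space and `w`
is bounded, with a bound on the fourth moments. -/
structure IsRegularSolution (T κ : ℝ) (L C K : ℝ≥0) (β w : ℝ → Rd d → Rd d)
    (μ : ℝ → P2 d) : Prop where
  sol : IsLinearSolution T κ (fun t x => β t x + w t x) μ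
  measurable_β : Measurable (Function.uncurry β)
  measurable_w : Measurable (Function.uncurry w)
  lipschitz : ∀ t, LipschitzWith L (β t)
  growth : ∀ t x, ‖β t x‖ ≤ C * (1 + ‖x‖)
  bound : ∀ t x, ‖w t x‖ ≤ C
  continuous_w : ∀ t, Continuous (w t)
  moment : ∀ t ∈ Icc 0 T, ∫⁻ x, ‖x‖ₑ ^ 4 ∂(μ t).meas ≤ K

lemma IsLipschitzControl.exists_modification {U : Set (Rd d)} {CU : ℝ} (hCU0 : 0 ≤ CU)
    (hCU : ∀ x ∈ U, ‖x‖ ≤ CU) {u : ℝ → Rd d → Rd d} (hu : IsLipschitzControl T U u) :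
    ∃ (Cu : ℝ≥0) (w : ℝ → Rd d → Rd d), Measurable (Function.uncurry w) ∧
      (∀ t, LipschitzWith Cu (w t)) ∧ (∀ t x, ‖w t x‖ ≤ CU) ∧
      ∀ᵐ t ∂(volume.restrict (Ioo 0 T)), u t = w t := by
  obtain ⟨Cu, hCu⟩ := hu.lipschitz
  obtain ⟨w, hw, hwP, hae⟩ := exists_measurable_modification (m := volume.restrict (Ioo 0 T))
    (f := u) (P := fun h => LipschitzWith Cu h ∧ ∀ x, ‖h x‖ ≤ CU)
    (fun x => (hu.measurable.comp (measurable_id.prodMk measurable_const)).aemeasurable)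
    ⟨LipschitzWith.const' 0, fun x => by simpa using hCU0⟩ (fun h hh => hh.1.continuous)
    (hCu.and (hu.mem.mono fun t ht x => hCU _ (ht x)))
  exact ⟨Cu, w, hw, fun t => (hwP t).1, fun t => (hwP t).2, hae⟩

/-- The constants `C` and `K` come before the viscosity, the control and the solution, hence serve
all `ε` at once. The Lipschitz constant `Cu` of the control comes after them and is not uniform. -/
lemma exists_regular_representation (hT : 0 < T) {U : Set (Rd d)} (hU : IsCompact U)
    {b : ℝ → Rd d → P2 d → Rd d} (hb : IsVelocityField T b) {μ₀ : P2 d}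
    (hμ₀ : IsCompact μ₀.meas.support) {L : ℝ≥0}
    (hL : ∀ t ∈ Icc 0 T, ∀ (x y : Rd d) (μ ν : P2 d),
      ‖b t x μ - b t y ν‖ₑ ≤ L * (‖x - y‖ₑ + W2 μ ν)) :
    ∃ (C K : ℝ≥0), ∫⁻ x, ‖x‖ₑ ^ 4 ∂μ₀.meas ≤ K ∧
      ∀ (κ : ℝ) (u : ℝ → Rd d → Rd d) (μ : ℝ → P2 d), |κ| ≤ 1 → IsLipschitzControl T U u →
        IsWeakSolution T κ b u μ₀ μ → ∃ (β w : ℝ → Rd d → Rd d) (Cu : ℝ≥0),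
        IsRegularSolution T κ L C K β w μ ∧ (∀ t, LipschitzWith Cu (w t)) ∧
        (∀ᵐ t ∂(volume.restrict (Ioo 0 T)), (∀ x, b t x (μ t) = β t x) ∧ u t = w t) ∧
        ∀ ψ : Rd d → ℝ, ContDiff ℝ ∞ ψ → HasCompactSupport ψ →
          ∫ x, ψ x ∂(μ 0).meas = ∫ x, ψ x ∂μ₀.meas := by
  obtain ⟨CU, hCU'⟩ := hU.isBounded.exists_norm_le
  set C₀ := |CU|
  have hC₀ : 0 ≤ C₀ := abs_nonneg _
  have hCU : ∀ x ∈ U, ‖x‖ ≤ C₀ := fun x hx => (hCU' x hx).trans (le_abs_self _)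
  obtain ⟨M, hM⟩ := hb.growth
  obtain ⟨K₀, hK₀⟩ := exists_moment_bound_of_isCompact_support hμ₀
  obtain ⟨K, hK⟩ := exists_uniform_moment_bound d hT (M := |M| + C₀) (by positivity) K₀
  have hM' : ∀ t ∈ Icc 0 T, ∀ (x : Rd d) (μ : P2 d),
      ‖b t x μ‖ ≤ |M| * (1 + ‖x‖ + ∫ y, ‖y‖ ∂μ.meas) := fun t ht x μ => by
    refine (hM t ht x μ).trans ?_
    have : 0 ≤ ∫ y, ‖y‖ ∂μ.meas := integral_nonneg fun y => norm_nonneg y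
    gcongr
    exact le_abs_self M
  -- First moments are at most `1 + K`, so `1 + ‖x‖ + ∫ ‖y‖ ≤ (2 + K)(1 + ‖x‖)`; `C₀` bounds the
  -- control.
  set C := |M| * (2 + K) + C₀ with hC
  refine ⟨⟨C, by positivity⟩, max K K₀, hK₀.trans (by exact_mod_cast le_max_right _ _),
    fun κ u μ hκ hu h => ?_⟩
  obtain ⟨Cu, w, hwm, hwL, hwB, hwae⟩ := hu.exists_modification hC₀ hCU
  have hbm : ∀ x, AEMeasurable (fun t => b t x (μ t)) (volume.restrict (Ioo 0 T)) := fun x =>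
    (aemeasurable_velocity hb h.continuousOn x).mono_measure
      (Measure.restrict_mono Ioo_subset_Icc_self le_rfl)
  have hmem : ∀ᵐ t ∂(volume.restrict (Ioo 0 T)), t ∈ Icc 0 T :=
    (ae_restrict_mem measurableSet_Ioo).mono fun t ht => Ioo_subset_Icc_self ht
  -- The moments are bounded with a modification of `b(t,·,μ_t)` that is only Lipschitz. The
  -- modification with linear growth uniform in time is chosen afterwards, since that growth rests
  -- on the moment bound.
  have hmom : ∀ t ∈ Icc 0 T, ∫⁻ x, ‖x‖ₑ ^ 4 ∂(μ t).meas ≤ K := by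
    obtain ⟨β, hβm, -, hβae⟩ := exists_measurable_modification (f := fun t x => b t x (μ t)) hbm
      (P := fun h => LipschitzWith L h) (LipschitzWith.const' 0) (fun h hh => hh.continuous)
      (hmem.mono fun t ht => IsVelocityField.lipschitzWith hL ht (μ t))
    have hae : ∀ᵐ t ∂(volume.restrict (Ioo 0 T)), ∀ x, b t x (μ t) + u t x = β t x + w t x := by
      filter_upwards [hβae, hwae] with t h1 h2 x
      rw [h2, ← h1]
    obtain ⟨hsol, hstart⟩ := h.isLinearSolution hT (v := fun t x => β t x + w t x) (hβm.add hwm) hae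
    obtain ⟨r, hr, hhalf⟩ := exists_ball_half_mass h.continuousOn
    have hfin := hsol.exists_moment_bound hT hκ
      (g := fun t => 2 * ‖∫ x in Metric.ball 0 r, ‖b t x (μ t) + u t x‖ ∂(μ t).meas‖
        + L * r + L + 2 * C₀)
      ((((h.integrable_time r).norm.const_mul 2).add (integrable_const _)).add
        (integrable_const _) |>.add (integrable_const _))
      (fun t => by positivity) (by
        filter_upwards [hae, hwae, hmem, h.integrable_space r] with t h1 h2 h3 h4 x
        rw [← h1]
        rw [Real.norm_of_nonneg (integral_nonneg fun y => norm_nonneg _)]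
        refine norm_le_of_half_mass (f := fun x => b t x (μ t) + u t x) L.2 (hhalf t h3) ?_ h4 hr.le
          (by positivity) x
        intro x y
        have e1 := (IsVelocityField.lipschitzWith hL h3 (μ t)).norm_sub_le x y
        have e2 : ‖u t x - u t y‖ ≤ 2 * C₀ := by
          rw [h2]
          exact (norm_sub_le _ _).trans (by linarith [hwB t x, hwB t y])
        rw [add_sub_add_comm]
        exact (norm_add_le _ _).trans (add_le_add e1 e2)) hstart hK₀
    refine hK κ _ μ μ₀ hκ hsol hfin ?_ hstart hK₀
    filter_upwards [hae, hwae, hmem] with t h1 h2 h3 x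
    rw [← h1]
    refine (norm_add_le _ _).trans ?_
    have e1 := hM' t h3 x (μ t)
    have e2 := hwB t x
    rw [← h2] at e2
    have : 0 ≤ ∫ y, ‖y‖ ∂(μ t).meas := integral_nonneg fun y => norm_nonneg y
    nlinarith [norm_nonneg x, mul_nonneg hC₀ (norm_nonneg x), mul_nonneg hC₀ this]
  have hm₁ : ∀ t ∈ Icc 0 T, ∫ y, ‖y‖ ∂(μ t).meas ≤ 1 + K := by
    intro t ht
    have h4 := integrable_norm_pow_four (hmom t ht)
    calc ∫ y, ‖y‖ ∂(μ t).meas ≤ ∫ y, (1 + ‖y‖ ^ 4) ∂(μ t).meas := by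
          refine integral_mono (integrable_norm _) ((integrable_const _).add h4) fun y => ?_
          change ‖y‖ ≤ 1 + ‖y‖ ^ 4
          nlinarith [sq_nonneg (‖y‖ - 1), sq_nonneg (‖y‖ ^ 2 - 1)]
      _ = 1 + ∫ y, ‖y‖ ^ 4 ∂(μ t).meas := by
          rw [integral_add (integrable_const _) h4]; simp
      _ ≤ 1 + K := by linarith [integral_norm_pow_four_le (hmom t ht)]
  obtain ⟨β, hβm, hβP, hβae⟩ := exists_measurable_modification (f := fun t x => b t x (μ t)) hbm
    (P := fun h => LipschitzWith L h ∧ ∀ x, ‖h x‖ ≤ C * (1 + ‖x‖))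
    ⟨LipschitzWith.const' 0, fun x => by simp; positivity⟩ (fun h hh => hh.1.continuous)
    (hmem.mono fun t ht => ⟨IsVelocityField.lipschitzWith hL ht (μ t), fun x => by
      refine (hM' t ht x (μ t)).trans ?_
      have e1 := hm₁ t ht
      have e2 := norm_nonneg x
      have e3 : 0 ≤ (K : ℝ) := K.2
      calc |M| * (1 + ‖x‖ + ∫ y, ‖y‖ ∂(μ t).meas) ≤ |M| * ((2 + K) * (1 + ‖x‖)) := by
            gcongr
            nlinarith [mul_nonneg e3 e2]
        _ = |M| * (2 + K) * (1 + ‖x‖) := by ring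
        _ ≤ C * (1 + ‖x‖) := by
            gcongr
            rw [hC]
            linarith⟩)
  have hae : ∀ᵐ t ∂(volume.restrict (Ioo 0 T)), ∀ x, b t x (μ t) + u t x = β t x + w t x := by
    filter_upwards [hβae, hwae] with t h1 h2 x
    rw [h2, ← h1]
  obtain ⟨hsol, hstart⟩ := h.isLinearSolution hT (v := fun t x => β t x + w t x) (hβm.add hwm) hae
  refine ⟨β, w, Cu, ⟨hsol, hβm, hwm, fun t => (hβP t).1, fun t => (hβP t).2,
    fun t x => (hwB t x).trans ?_, fun t => (hwL t).continuous,
    fun t ht => (hmom t ht).trans (by exact_mod_cast le_max_left _ _)⟩, hwL, ?_, hstart⟩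
  · change C₀ ≤ C
    rw [hC]
    have : 0 ≤ |M| * (2 + K) := by positivity
    linarith
  · filter_upwards [hβae, hwae] with t h1 h2
    exact ⟨fun x => congrFun h1 x, h2⟩

end RegularSolutions

/-! ### Mollification and its Lipschitz bounds. -/

section Mollification

variable {d : ℕ}

/-- A smooth probability density on `ℝ^d` supported in the closed unit ball. -/
def baseKernel (d : ℕ) : Rd d → ℝ :=
  (⟨1 / 2, 1, by norm_num, by norm_num⟩ : ContDiffBump (0 : Rd d)).normed volume

lemma contDiff_baseKernel : ContDiff ℝ ∞ (baseKernel d) := ContDiffBump.contDiff_normed _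

lemma baseKernel_nonneg (z : Rd d) : 0 ≤ baseKernel d z := ContDiffBump.nonneg_normed _ _

lemma baseKernel_eq_zero {z : Rd d} (h : 1 ≤ ‖z‖) : baseKernel d z = 0 := by
  have := ContDiffBump.support_normed_eq (⟨1 / 2, 1, by norm_num, by norm_num⟩ :
    ContDiffBump (0 : Rd d)) (μ := volume)
  have hz : z ∉ Function.support (baseKernel d) := by
    unfold baseKernel
    rw [this]
    simpa using h
  simpa using hz

lemma integral_baseKernel : ∫ z : Rd d, baseKernel d z = 1 := ContDiffBump.integral_normed _

/-- The rescaled density `s^{-d} ρ(z / s)`. -/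
def mollKernel (s : ℝ) (z : Rd d) : ℝ := s⁻¹ ^ d * baseKernel d (s⁻¹ • z)

lemma contDiff_mollKernel (s : ℝ) : ContDiff ℝ ∞ (mollKernel s : Rd d → ℝ) :=
  contDiff_const.mul (contDiff_baseKernel.comp (contDiff_const_smul _))

lemma mollKernel_nonneg {s : ℝ} (hs : 0 < s) (z : Rd d) : 0 ≤ mollKernel s z :=
  mul_nonneg (by positivity) (baseKernel_nonneg _)

lemma mollKernel_eq_zero {s : ℝ} (hs : 0 < s) {z : Rd d} (hz : s ≤ ‖z‖) : mollKernel s z = 0 := by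
  unfold mollKernel
  rw [baseKernel_eq_zero, mul_zero]
  rw [norm_smul, Real.norm_of_nonneg (by positivity), ← div_eq_inv_mul, le_div_iff₀ hs]
  simpa using hz

lemma hasCompactSupport_mollKernel {s : ℝ} (hs : 0 < s) :
    HasCompactSupport (mollKernel s : Rd d → ℝ) := by
  refine HasCompactSupport.intro (isCompact_closedBall 0 s) fun z hz => mollKernel_eq_zero hs ?_
  simpa using (not_le.1 (by simpa using hz)).le

lemma integral_mollKernel {s : ℝ} (hs : 0 < s) : ∫ z : Rd d, mollKernel s z = 1 := by
  unfold mollKernel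
  rw [integral_const_mul, Measure.integral_comp_smul, integral_baseKernel]
  simp only [finrank_euclideanSpace, Fintype.card_fin, inv_pow, inv_inv, smul_eq_mul, mul_one]
  rw [abs_of_pos (by positivity)]
  field_simp

lemma integrable_mollKernel {s : ℝ} (hs : 0 < s) : Integrable (mollKernel s : Rd d → ℝ) :=
  (contDiff_mollKernel s).continuous.integrable_of_hasCompactSupport (hasCompactSupport_mollKernel hs)

/-- Convolution with the mollifying kernel at scale `s`. -/
def mollify (s : ℝ) (f : Rd d → Rd d) : Rd d → Rd d :=
  convolution (mollKernel s) f (ContinuousLinearMap.lsmul ℝ ℝ) volume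

lemma mollify_apply (s : ℝ) (f : Rd d → Rd d) (x : Rd d) :
    mollify s f x = ∫ z, mollKernel s z • f (x - z) := rfl

lemma integrable_mollKernel_smul {s : ℝ} (hs : 0 < s) {f : Rd d → Rd d} (hf : Continuous f)
    (x : Rd d) : Integrable fun z => mollKernel s z • f (x - z) :=
  Continuous.integrable_of_hasCompactSupport
    ((contDiff_mollKernel s).continuous.smul (hf.comp (continuous_const.sub continuous_id)))
    (hasCompactSupport_mollKernel hs).smul_right

lemma mollify_add {s : ℝ} (hs : 0 < s) {f g : Rd d → Rd d} (hf : Continuous f) (hg : Continuous g)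
    (x : Rd d) : mollify s (fun y => f y + g y) x = mollify s f x + mollify s g x := by
  simp only [mollify_apply, smul_add]
  exact integral_add (integrable_mollKernel_smul hs hf x) (integrable_mollKernel_smul hs hg x)

lemma mollify_sub {s : ℝ} (hs : 0 < s) {f g : Rd d → Rd d} (hf : Continuous f) (hg : Continuous g)
    (x : Rd d) : mollify s (fun y => f y - g y) x = mollify s f x - mollify s g x := by
  simp only [mollify_apply, smul_sub]
  exact integral_sub (integrable_mollKernel_smul hs hf x) (integrable_mollKernel_smul hs hg x)

lemma norm_mollify_sub_le {s : ℝ} (hs : 0 < s) {f : Rd d → Rd d} (hf : Continuous f) {x a : Rd d}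
    {c : ℝ} (h : ∀ z, ‖z‖ ≤ s → ‖f (x - z) - a‖ ≤ c) : ‖mollify s f x - a‖ ≤ c := by
  have e : mollify s f x - a = ∫ z, mollKernel s z • (f (x - z) - a) := by
    simp only [smul_sub]
    rw [integral_sub (integrable_mollKernel_smul hs hf x)
      ((integrable_mollKernel hs).smul_const a), integral_smul_const, integral_mollKernel hs,
      one_smul, mollify_apply]
  rw [e]
  have : ∀ z : Rd d, ‖mollKernel s z • (f (x - z) - a)‖ ≤ mollKernel s z * c := by
    intro z
    rw [norm_smul, Real.norm_of_nonneg (mollKernel_nonneg hs z)]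
    rcases le_total ‖z‖ s with hz | hz
    · exact mul_le_mul_of_nonneg_left (h z hz) (mollKernel_nonneg hs z)
    · simp [mollKernel_eq_zero hs hz]
  refine (norm_integral_le_of_norm_le ((integrable_mollKernel hs).mul_const c)
    (ae_of_all _ this)).trans ?_
  rw [integral_mul_const, integral_mollKernel hs, one_mul]

lemma norm_mollify_le {s : ℝ} (hs : 0 < s) {f : Rd d → Rd d} (hf : Continuous f) {x : Rd d}
    {c : ℝ} (h : ∀ z, ‖z‖ ≤ s → ‖f (x - z)‖ ≤ c) : ‖mollify s f x‖ ≤ c := by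
  simpa using norm_mollify_sub_le (a := 0) hs hf (by simpa using h)

lemma norm_mollify_sub_self_le {s : ℝ} (hs : 0 < s) {L : ℝ≥0} {f : Rd d → Rd d}
    (hf : LipschitzWith L f) (x : Rd d) : ‖mollify s f x - f x‖ ≤ L * s := by
  refine norm_mollify_sub_le hs hf.continuous fun z hz => ?_
  refine (hf.norm_sub_le _ _).trans ?_
  gcongr
  simpa using hz

lemma lipschitzWith_mollify {s : ℝ} (hs : 0 < s) {L : ℝ≥0} {f : Rd d → Rd d}
    (hf : LipschitzWith L f) : LipschitzWith L (mollify s f) := by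
  refine LipschitzWith.of_dist_le_mul fun x y => ?_
  rw [dist_eq_norm, dist_eq_norm]
  have e : mollify s f x - mollify s f y = mollify s (fun z => f (z + (x - y)) - f z) y := by
    rw [mollify_sub hs (f := fun z => f (z + (x - y)))
      (hf.continuous.comp (continuous_id.add continuous_const)) hf.continuous]
    congr 1
    simp only [mollify_apply]
    congr 1 with z : 1
    congr 2
    abel
  rw [e]
  refine norm_mollify_le hs (by have := hf.continuous; fun_prop) fun z _ => ?_
  refine (hf.norm_sub_le _ _).trans ?_
  simp

lemma contDiff_mollify {s : ℝ} (hs : 0 < s) {f : Rd d → Rd d} (hf : Continuous f) :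
    ContDiff ℝ ∞ (mollify s f) :=
  (hasCompactSupport_mollKernel hs).contDiff_convolution_left _ (contDiff_mollKernel s)
    hf.locallyIntegrable

/-- The total variation of the mollifying kernel. -/
def kernelVariation (d : ℕ) (s : ℝ) : ℝ≥0 :=
  ⟨∫ z : Rd d, ‖fderiv ℝ (mollKernel s) z‖, integral_nonneg fun _ => norm_nonneg _⟩

lemma continuous_fderiv_mollKernel (s : ℝ) : Continuous (fderiv ℝ (mollKernel s : Rd d → ℝ)) :=
  (contDiff_mollKernel s).continuous_fderiv (by simp)

lemma fderiv_mollify {s : ℝ} (hs : 0 < s) {f : Rd d → Rd d} (hf : Continuous f) (x y : Rd d) :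
    fderiv ℝ (mollify s f) x y = ∫ z, fderiv ℝ (mollKernel s) z y • f (x - z) := by
  have h := (hasCompactSupport_mollKernel hs).hasFDerivAt_convolution_left
    (ContinuousLinearMap.lsmul ℝ ℝ) (contDiff_mollKernel s |>.of_le (by simp))
    (hf.locallyIntegrable (μ := volume)) x
  have hex := ((hasCompactSupport_mollKernel hs).fderiv ℝ).convolutionExists_left
    (ContinuousLinearMap.precompL (Rd d) (ContinuousLinearMap.lsmul ℝ ℝ (E := Rd d)))
    (continuous_fderiv_mollKernel s) (hf.locallyIntegrable (μ := volume)) x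
  have h' : HasFDerivAt (mollify s f) _ x := h
  rw [h'.fderiv, convolution, ContinuousLinearMap.integral_apply hex]
  simp only [ContinuousLinearMap.precompL_apply, ContinuousLinearMap.lsmul_apply]

lemma integrable_fderiv_mollKernel {s : ℝ} (hs : 0 < s) :
    Integrable (fderiv ℝ (mollKernel s : Rd d → ℝ)) :=
  (continuous_fderiv_mollKernel s).integrable_of_hasCompactSupport
    ((hasCompactSupport_mollKernel hs).fderiv ℝ)

lemma integrable_fderiv_mollKernel_smul {s : ℝ} (hs : 0 < s) {f : Rd d → Rd d} (hf : Continuous f)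
    (x y : Rd d) : Integrable fun z => fderiv ℝ (mollKernel s) z y • f (x - z) := by
  have h1 : Continuous fun z : Rd d => fderiv ℝ (mollKernel s) z y :=
    continuous_dirDeriv (contDiff_mollKernel s) y
  refine (h1.smul (hf.comp (continuous_const.sub continuous_id))).integrable_of_hasCompactSupport
    (HasCompactSupport.smul_right ?_)
  exact ((hasCompactSupport_mollKernel hs).fderiv ℝ).comp_left (g := fun A : Rd d →L[ℝ] ℝ => A y)
    (by simp)

lemma norm_integral_fderiv_mollKernel_smul_le {s : ℝ} (hs : 0 < s) {g : Rd d → Rd d} {c : ℝ}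
    (h : ∀ z, ‖g z‖ ≤ c) (y : Rd d) :
    ‖∫ z, fderiv ℝ (mollKernel s) z y • g z‖ ≤ kernelVariation d s * c * ‖y‖ := by
  have : ∀ z, ‖fderiv ℝ (mollKernel s) z y • g z‖ ≤ ‖fderiv ℝ (mollKernel s) z‖ * (c * ‖y‖) := by
    intro z
    rw [norm_smul]
    calc _ ≤ (‖fderiv ℝ (mollKernel s) z‖ * ‖y‖) * c :=
          mul_le_mul (ContinuousLinearMap.le_opNorm _ _) (h z) (norm_nonneg _) (by positivity)
      _ = _ := by ring
  refine (norm_integral_le_of_norm_le ((integrable_fderiv_mollKernel hs).norm.mul_const _)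
    (ae_of_all _ this)).trans (le_of_eq ?_)
  rw [integral_mul_const]
  change _ = (∫ z : Rd d, ‖fderiv ℝ (mollKernel s) z‖) * c * ‖y‖
  ring

/-- The derivative falls on the kernel, so the Lipschitz constant depends on the scale and on the
sup norm only. This is how mollified controls become equi-Lipschitz although the controls are not.
-/
lemma lipschitzWith_mollify_of_bounded {s : ℝ} (hs : 0 < s) {c : ℝ≥0} {f : Rd d → Rd d}
    (hf : Continuous f) (h : ∀ x, ‖f x‖ ≤ c) :
    LipschitzWith (kernelVariation d s * c) (mollify s f) := by
  refine lipschitzWith_of_nnnorm_fderiv_le ((contDiff_mollify hs hf).differentiable (by simp))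
    fun x => ?_
  rw [← NNReal.coe_le_coe, coe_nnnorm, NNReal.coe_mul]
  refine ContinuousLinearMap.opNorm_le_bound _ (by positivity) fun y => ?_
  rw [fderiv_mollify hs hf]
  exact norm_integral_fderiv_mollKernel_smul_le hs (fun z => h _) y

/-- One derivative on the kernel and the Lipschitz bound of `f` for the other. This second-order
bound keeps test functions in their class under a step of the scheme. -/
lemma lipschitzWith_fderiv_mollify {s : ℝ} (hs : 0 < s) {L : ℝ≥0} {f : Rd d → Rd d}
    (hf : LipschitzWith L f) :
    LipschitzWith (kernelVariation d s * L) (fderiv ℝ (mollify s f)) := by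
  refine LipschitzWith.of_dist_le_mul fun x x' => ?_
  rw [dist_eq_norm, dist_eq_norm, NNReal.coe_mul]
  refine ContinuousLinearMap.opNorm_le_bound _ (by positivity) fun y => ?_
  rw [sub_apply, fderiv_mollify hs hf.continuous,
    fderiv_mollify hs hf.continuous,
    ← integral_sub (integrable_fderiv_mollKernel_smul hs hf.continuous x y)
      (integrable_fderiv_mollKernel_smul hs hf.continuous x' y)]
  simp only [← smul_sub]
  refine (norm_integral_fderiv_mollKernel_smul_le hs (c := L * ‖x - x'‖) (fun z => ?_) y).trans
    (le_of_eq (by ring))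
  refine (hf.norm_sub_le _ _).trans ?_
  simp

lemma stronglyMeasurable_mollify {α : Type*} [MeasurableSpace α] {s : ℝ} {f : α → Rd d → Rd d}
    (hf : Measurable (Function.uncurry f)) :
    StronglyMeasurable (Function.uncurry fun t x => mollify s (f t) x) := by
  simp only [Function.uncurry_def, mollify_apply]
  have : Measurable fun p : (α × Rd d) × Rd d => mollKernel s p.2 • f p.1.1 (p.1.2 - p.2) :=
    ((contDiff_mollKernel s).continuous.measurable.comp measurable_snd).smul
      (hf.comp ((measurable_fst.comp measurable_fst).prodMk
        ((measurable_snd.comp measurable_fst).sub measurable_snd)))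
  exact this.stronglyMeasurable.integral_prod_right

lemma mollify_intervalIntegral {s : ℝ} (hs : 0 < s) {f : ℝ → Rd d → Rd d}
    (hf : Measurable (Function.uncurry f)) {C : ℝ} (hC : ∀ t x, ‖f t x‖ ≤ C * (1 + ‖x‖)) (a b : ℝ)
    (x : Rd d) :
    mollify s (fun y => ∫ t in a..b, f t y) x = ∫ t in a..b, mollify s (f t) x := by
  have hC0 : 0 ≤ C := by simpa using (norm_nonneg _).trans (hC 0 0)
  simp only [mollify_apply, ← intervalIntegral.integral_smul]
  rw [intervalIntegral_integral_swap]
  have : IsFiniteMeasure (volume.restrict (uIoc a b)) := ⟨by simp [uIoc]⟩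
  refine Integrable.mono' (g := fun p : ℝ × Rd d => C * (1 + ‖x‖ + s) * mollKernel s p.2) ?_ ?_
    (ae_of_all _ fun p => ?_)
  · exact ((integrable_mollKernel hs).comp_snd _).const_mul _
  · have : Measurable fun p : ℝ × Rd d => mollKernel s p.2 • f p.1 (x - p.2) :=
      ((contDiff_mollKernel s).continuous.measurable.comp measurable_snd).smul
        (hf.comp (measurable_fst.prodMk (measurable_const.sub measurable_snd)))
    exact this.aestronglyMeasurable
  · simp only [Function.uncurry, norm_smul]
    rw [Real.norm_of_nonneg (mollKernel_nonneg hs _), mul_comm]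
    rcases le_total ‖p.2‖ s with hz | hz
    · refine mul_le_mul_of_nonneg_right ((hC _ _).trans ?_) (mollKernel_nonneg hs _)
      exact mul_le_mul_of_nonneg_left (by linarith [norm_sub_le x p.2]) hC0
    · simp [mollKernel_eq_zero hs hz]

end Mollification

/-! ### Morrey estimate for the mollification error of Sobolev functions. -/

section Morrey

variable {d : ℕ}

lemma setIntegral_norm_Lp_le {α G : Type*} [MeasurableSpace α] [NormedAddCommGroup G]
    {μ : Measure α} {p : ℝ≥0∞} [hp : Fact (1 ≤ p)] (f : Lp G p μ) {S : Set α} (hS : μ S ≠ ⊤) :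
    ∫ x in S, ‖f x‖ ∂μ ≤ μ.real S ^ (1 - 1 / p.toReal) * ‖f‖ := by
  have hf := Lp.memLp f
  have h1 : eLpNorm f 1 (μ.restrict S) ≤ ENNReal.ofReal (μ.real S ^ (1 - 1 / p.toReal) * ‖f‖) := by
    refine (eLpNorm_le_eLpNorm_mul_rpow_measure_univ hp.out
      hf.aestronglyMeasurable.restrict).trans ?_
    have h2 : eLpNorm f p (μ.restrict S) ≤ ENNReal.ofReal ‖f‖ := by
      rw [Lp.norm_def, ENNReal.ofReal_toReal (Lp.eLpNorm_ne_top f)]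
      exact eLpNorm_mono_measure _ Measure.restrict_le_self
    have he : (0 : ℝ) ≤ 1 - 1 / p.toReal := by
      rcases eq_or_ne p ⊤ with rfl | hp'
      · simp
      · have : 1 ≤ p.toReal := by
          have := ENNReal.toReal_mono hp' hp.out
          simpa using this
        rw [sub_nonneg, div_le_one (by linarith)]
        exact this
    rw [mul_comm, ENNReal.ofReal_mul (by positivity), ← ENNReal.ofReal_rpow_of_nonneg (by positivity) he,
      Measure.restrict_apply_univ, ofReal_measureReal hS, ENNReal.toReal_one, div_one]
    gcongr
  rw [eLpNorm_one_eq_lintegral_enorm] at h1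
  rw [integral_norm_eq_lintegral_enorm hf.aestronglyMeasurable.restrict]
  exact ENNReal.toReal_le_of_le_ofReal (by positivity) h1

/-- `d ρ(z) + Dρ(z) z` for the mollifying kernel `ρ`. -/
def kernelDivergence (d : ℕ) (z : Rd d) : ℝ := d * baseKernel d z + fderiv ℝ (baseKernel d) z z

lemma continuous_kernelDivergence : Continuous (kernelDivergence d) :=
  (continuous_const.mul contDiff_baseKernel.continuous).add
    ((contDiff_baseKernel.continuous_fderiv (by simp)).clm_apply continuous_id)

lemma kernelDivergence_eq_zero {z : Rd d} (h : 1 < ‖z‖) : kernelDivergence d z = 0 := by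
  have : baseKernel d =ᶠ[𝓝 z] fun _ => 0 := by
    filter_upwards [(isOpen_lt continuous_const continuous_norm).mem_nhds h] with y hy
    exact baseKernel_eq_zero (le_of_lt hy)
  rw [kernelDivergence, this.fderiv_eq, this.eq_of_nhds]
  simp

lemma exists_kernelDivergence_bound (d : ℕ) : ∃ A, ∀ z : Rd d, ‖kernelDivergence d z‖ ≤ A :=
  (HasCompactSupport.intro (isCompact_closedBall 0 1) fun z hz => kernelDivergence_eq_zero
    (by simpa using hz)).exists_bound_of_continuous continuous_kernelDivergence

lemma exists_baseKernel_bound (d : ℕ) : ∃ A, 0 ≤ A ∧ ∀ z : Rd d, baseKernel d z ≤ A := by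
  obtain ⟨A, hA⟩ := (HasCompactSupport.intro (isCompact_closedBall 0 1) fun z hz =>
    baseKernel_eq_zero (d := d)
      (le_of_lt (by simpa using hz))).exists_bound_of_continuous contDiff_baseKernel.continuous
  exact ⟨A, (norm_nonneg _).trans (hA 0), fun z => (le_abs_self _).trans (hA z)⟩

lemma hasDerivAt_mollKernel {s : ℝ} (hs : 0 < s) (v : Rd d) :
    HasDerivAt (fun s => mollKernel s v) (-(s⁻¹ ^ (d + 1) * kernelDivergence d (s⁻¹ • v))) s := by
  have h1 : HasDerivAt (fun s : ℝ => s⁻¹) (-(s ^ 2)⁻¹) s := hasDerivAt_inv hs.ne'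
  have h2 := h1.pow d
  have h3 := h1.smul_const v
  have h4 := ((contDiff_baseKernel (d := d)).differentiable (by simp)
    (s⁻¹ • v)).hasFDerivAt.comp_hasDerivAt s h3
  refine (h2.mul h4).congr_deriv ?_
  simp only [kernelDivergence, map_smul, smul_eq_mul, Function.comp]
  rcases d with _ | n
  · simp
    ring
  · simp only [Nat.add_sub_cancel, Pi.pow_apply]
    rw [← inv_pow]
    push_cast
    ring

lemma hasDerivAt_mollify {f : Rd d → Rd d} (hf : Continuous f) (x : Rd d) {s : ℝ} (hs : 0 < s) :
    HasDerivAt (fun s => mollify s f x)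
      (∫ y, (-(s⁻¹ ^ (d + 1) * kernelDivergence d (s⁻¹ • (x - y)))) • f y) s := by
  have e : (fun s => mollify s f x) = fun s => ∫ y, mollKernel s (x - y) • f y := by
    ext1 s
    rw [mollify_apply, ← integral_sub_left_eq_self _ _ x]
    simp
  rw [e]
  obtain ⟨A, hA⟩ := exists_kernelDivergence_bound d
  have hA0 : 0 ≤ A := (norm_nonneg _).trans (hA 0)
  refine (hasDerivAt_integral_of_dominated_loc_of_deriv_le
    (F := fun s y => mollKernel s (x - y) • f y)
    (F' := fun s y => (-(s⁻¹ ^ (d + 1) * kernelDivergence d (s⁻¹ • (x - y)))) • f y)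
    (bound := (Metric.closedBall x (2 * s)).indicator fun y => ((2 / s) ^ (d + 1) * A) * ‖f y‖)
    (Ioo_mem_nhds (show s / 2 < s by linarith) (show s < 2 * s by linarith)) ?_ ?_ ?_ ?_ ?_ ?_).2
  · refine Eventually.of_forall fun s => Continuous.aestronglyMeasurable ?_
    exact ((contDiff_mollKernel s).continuous.comp (continuous_const.sub continuous_id)).smul hf
  · have := integrable_mollKernel_smul hs hf x
    have h2 := this.comp_sub_left x
    simpa using h2
  · refine Continuous.aestronglyMeasurable ?_
    have := continuous_kernelDivergence (d := d)
    fun_prop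
  · refine ae_of_all _ fun y s' hs' => ?_
    have hs0 : 0 < s' := by linarith [hs'.1]
    by_cases hy : y ∈ Metric.closedBall x (2 * s)
    · rw [indicator_of_mem hy, norm_smul, norm_neg, norm_mul]
      refine mul_le_mul_of_nonneg_right (mul_le_mul ?_ (hA _) (norm_nonneg _) (by positivity))
        (norm_nonneg _)
      rw [Real.norm_of_nonneg (by positivity)]
      gcongr
      rw [inv_le_comm₀ hs0 (by positivity), inv_div]
      exact hs'.1.le
    · rw [indicator_of_notMem hy, kernelDivergence_eq_zero]
      · simp
      · rw [norm_smul, Real.norm_of_nonneg (by positivity), ← div_eq_inv_mul, lt_div_iff₀ hs0, one_mul]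
        rw [Metric.mem_closedBall, not_le, dist_comm, dist_eq_norm] at hy
        exact hs'.2.trans hy
  · rw [integrable_indicator_iff Metric.isClosed_closedBall.measurableSet]
    exact (continuous_const.mul hf.norm).continuousOn.integrableOn_compact (isCompact_closedBall _ _)
  · exact ae_of_all _ fun y s' hs' =>
      (hasDerivAt_mollKernel (by linarith [hs'.1]) (x - y)).smul_const (f y)

/-- The components of `s^{-d} ρ((x-y)/s) (x-y)/s`, as functions of `y`. -/
def kernelField (x : Rd d) (s : ℝ) (j : Fin d) (y : Rd d) : ℝ :=
  s⁻¹ ^ d * (baseKernel d (s⁻¹ • (x - y)) * (s⁻¹ • (x - y)) j)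

lemma contDiff_kernelField (x : Rd d) (s : ℝ) (j : Fin d) : ContDiff ℝ ∞ (kernelField x s j) := by
  have h1 : ContDiff ℝ ∞ fun y : Rd d => s⁻¹ • (x - y) := by fun_prop
  refine contDiff_const.mul ((contDiff_baseKernel.comp h1).mul ?_)
  exact (EuclideanSpace.proj j : Rd d →L[ℝ] ℝ).contDiff.comp h1

lemma kernelField_eq_zero {x : Rd d} {s : ℝ} (hs : 0 < s) (j : Fin d) {y : Rd d}
    (h : y ∉ Metric.closedBall x s) : kernelField x s j y = 0 := by
  rw [Metric.mem_closedBall, not_le, dist_comm, dist_eq_norm] at h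
  rw [kernelField, baseKernel_eq_zero]
  · simp
  · rw [norm_smul, Real.norm_of_nonneg (by positivity), ← div_eq_inv_mul, le_div_iff₀ hs, one_mul]
    exact h.le

lemma fderiv_kernelField (x : Rd d) (s : ℝ) (j : Fin d) (y v : Rd d) :
    fderiv ℝ (kernelField x s j) y v = -(s⁻¹ ^ (d + 1) *
      (fderiv ℝ (baseKernel d) (s⁻¹ • (x - y)) v * (s⁻¹ • (x - y)) j
        + baseKernel d (s⁻¹ • (x - y)) * v j)) := by
  have h1 : HasFDerivAt (fun y : Rd d => s⁻¹ • (x - y))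
      (s⁻¹ • (-ContinuousLinearMap.id ℝ (Rd d))) y := by
    exact ((hasFDerivAt_id y).const_sub x).const_smul s⁻¹
  have h2 := ((contDiff_baseKernel (d := d)).differentiable (by simp)
    (s⁻¹ • (x - y))).hasFDerivAt.comp y h1
  have h3 := (EuclideanSpace.proj j : Rd d →L[ℝ] ℝ).hasFDerivAt.comp y h1
  have h4 : HasFDerivAt (kernelField x s j) _ y := (h2.mul h3).const_mul (s⁻¹ ^ d)
  rw [h4.fderiv]
  simp
  ring

lemma sum_apply_single_mul (A : Rd d →L[ℝ] ℝ) (z : Rd d) :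
    ∑ j, A (EuclideanSpace.single j 1) * z j = A z := by
  have hz : z = ∑ j, z j • EuclideanSpace.single j (1 : ℝ) := by
    ext i
    simp [Finset.sum_apply, Pi.single_apply]
  conv_rhs => rw [hz, map_sum]
  simp [mul_comm]

/-- The derivative of the rescaled kernel in the scale `s` is the divergence of a compactly
supported field. Integration by parts therefore bounds the motion of the mollification in `s` by the
weak gradient. -/
lemma sum_fderiv_kernelField (x : Rd d) (s : ℝ) (y : Rd d) :
    ∑ j, fderiv ℝ (kernelField x s j) y (EuclideanSpace.single j 1)
      = -(s⁻¹ ^ (d + 1) * kernelDivergence d (s⁻¹ • (x - y))) := by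
  simp only [fderiv_kernelField]
  have h : ∀ c : ℝ, ∑ j : Fin d, c * (EuclideanSpace.single j (1 : ℝ) : Rd d) j = d * c := by
    intro c
    simp
  rw [Finset.sum_neg_distrib, ← Finset.mul_sum, Finset.sum_add_distrib, sum_apply_single_mul, h,
    kernelDivergence, add_comm (d * _ : ℝ)]

lemma hasCompactSupport_dirDeriv {ψ : Rd d → ℝ} (hc : HasCompactSupport ψ) (y : Rd d) :
    HasCompactSupport fun x => fderiv ℝ ψ x y :=
  (hc.fderiv (𝕜 := ℝ)).comp_left (g := fun A : Rd d →L[ℝ] ℝ => A y) (by simp)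

/-- The divergence form of the scale derivative is paired with the weak gradient, and Hölder's
inequality on the ball of radius `s` yields the power `V ^ e`. The factor `d` counts the components
of the field. -/
lemma norm_deriv_mollify_le {A : ℝ} (hA0 : 0 ≤ A) (hA : ∀ z : Rd d, baseKernel d z ≤ A)
    {p : ℝ≥0∞} [Fact (1 ≤ p)] {B : Set (Rd d)} (q : sobolev d p B) {f : Rd d → Rd d}
    (hf : Continuous f) (hq : q.1.1 =ᵐ[volume.restrict B] f) {x : Rd d} {s : ℝ}
    (hs : 0 < s) (hsub : Metric.closedBall x s ⊆ B) {V e N : ℝ} (hV : volume.real (Metric.closedBall x s) = V)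
    (he : 1 - 1 / p.toReal = e) (hN : ‖q‖ ≤ N) :
    ‖∫ y, (-(s⁻¹ ^ (d + 1) * kernelDivergence d (s⁻¹ • (x - y)))) • f y‖
      ≤ d * (s⁻¹ ^ d * A * (V ^ e * N)) := by
  have hts : ∀ j, tsupport (kernelField x s j) ⊆ Metric.closedBall x s := fun j =>
    closure_minimal (fun y hy => by
      by_contra h
      exact hy (kernelField_eq_zero hs j h)) Metric.isClosed_closedBall
  have hcs : ∀ j, HasCompactSupport (kernelField x s j) := fun j =>
    HasCompactSupport.intro (isCompact_closedBall x s) fun y hy => kernelField_eq_zero hs j hy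
  have e1 : ∫ y, (-(s⁻¹ ^ (d + 1) * kernelDivergence d (s⁻¹ • (x - y)))) • f y
      = -∑ j, ∫ y in B, kernelField x s j y • q.1.2 y (EuclideanSpace.single j 1) := by
    rw [← Finset.sum_neg_distrib]
    have e2 : ∀ j, -∫ y in B, kernelField x s j y • q.1.2 y (EuclideanSpace.single j 1)
        = ∫ y, fderiv ℝ (kernelField x s j) y (EuclideanSpace.single j 1) • f y := by
      intro j
      have e3 : ∫ y in B, fderiv ℝ (kernelField x s j) y (EuclideanSpace.single j 1) • f y
          = ∫ y, fderiv ℝ (kernelField x s j) y (EuclideanSpace.single j 1) • f y := by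
        refine setIntegral_eq_integral_of_forall_compl_eq_zero fun y hy => ?_
        have : y ∉ tsupport (fderiv ℝ (kernelField x s j)) := fun h =>
          hy (hsub (hts j (tsupport_fderiv_subset ℝ h)))
        rw [image_eq_zero_of_notMem_tsupport this]
        simp
      rw [← e3, ← q.2 (kernelField x s j) (contDiff_kernelField x s j) (hcs j)
        ((hts j).trans hsub)]
      refine integral_congr_ae ?_
      filter_upwards [hq] with y hy
      rw [hy]
    simp only [e2]
    rw [← integral_finsetSum]
    · simp only [← Finset.sum_smul, sum_fderiv_kernelField]
    · intro j _
      refine Continuous.integrable_of_hasCompactSupport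
        ((continuous_dirDeriv (contDiff_kernelField x s j) _).smul hf)
        (hasCompactSupport_dirDeriv (hcs j) _).smul_right
  rw [e1, norm_neg]
  refine (norm_sum_le _ _).trans ?_
  have hterm : ∀ j ∈ (Finset.univ : Finset (Fin d)),
      ‖∫ y in B, kernelField x s j y • q.1.2 y (EuclideanSpace.single j 1)‖
      ≤ s⁻¹ ^ d * A * (V ^ e * N) := by
    intro j _
    have hfin : (volume.restrict B) (Metric.closedBall x s) ≠ ⊤ :=
      ((Measure.restrict_apply_le _ _).trans_lt measure_closedBall_lt_top).ne
    have hintg : Integrable (fun y => ‖q.1.2 y‖)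
        ((volume.restrict B).restrict (Metric.closedBall x s)) := by
      have : IsFiniteMeasure ((volume.restrict B).restrict (Metric.closedBall x s)) :=
        ⟨by rw [Measure.restrict_apply_univ]; exact hfin.lt_top⟩
      exact (((Lp.memLp q.1.2).restrict _).integrable Fact.out).norm
    have hle : ∀ y, ‖kernelField x s j y • q.1.2 y (EuclideanSpace.single j 1)‖
        ≤ (Metric.closedBall x s).indicator (fun y => s⁻¹ ^ d * A * ‖q.1.2 y‖) y := by
      intro y
      by_cases hy : y ∈ Metric.closedBall x s
      · rw [indicator_of_mem hy, norm_smul]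
        refine mul_le_mul ?_ ?_ (norm_nonneg _) (by positivity)
        · rw [kernelField, norm_mul, Real.norm_of_nonneg (by positivity), norm_mul,
            Real.norm_of_nonneg (baseKernel_nonneg _)]
          refine mul_le_mul_of_nonneg_left ?_ (by positivity)
          refine (mul_le_mul (hA _) (PiLp.norm_apply_le _ j) (norm_nonneg _) hA0).trans ?_
          refine mul_le_of_le_one_right hA0 ?_
          rw [norm_smul, Real.norm_of_nonneg (by positivity), ← div_eq_inv_mul, div_le_one hs]
          rw [Metric.mem_closedBall, dist_comm, dist_eq_norm] at hy
          exact hy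
        · refine (ContinuousLinearMap.le_opNorm _ _).trans ?_
          simp
      · rw [indicator_of_notMem hy, kernelField_eq_zero hs j hy]
        simp
    refine (norm_integral_le_of_norm_le ?_ (ae_of_all _ hle)).trans ?_
    · rw [integrable_indicator_iff Metric.isClosed_closedBall.measurableSet]
      exact hintg.const_mul _
    · rw [integral_indicator Metric.isClosed_closedBall.measurableSet, integral_const_mul]
      refine mul_le_mul_of_nonneg_left ?_ (by positivity)
      have hV' : (volume.restrict B).real (Metric.closedBall x s) = V := by
        rw [measureReal_restrict_apply Metric.isClosed_closedBall.measurableSet,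
          inter_eq_left.2 hsub, hV]
      have hV0 : 0 ≤ V := hV ▸ measureReal_nonneg
      have h := setIntegral_norm_Lp_le q.1.2 hfin
      rw [hV', he] at h
      exact h.trans (mul_le_mul_of_nonneg_left ((norm_snd_le q.1).trans hN) (Real.rpow_nonneg hV0 _))
  refine (Finset.sum_le_sum hterm).trans ?_
  simp

lemma norm_mollify_sub_self_le_of_deriv {f : Rd d → Rd d} (hf : Continuous f) {x : Rd d} {δ D : ℝ}
    (hδ : 0 < δ) (hD : 0 ≤ D)
    (hder : ∀ s, 0 < s → s ≤ δ →
      ‖∫ y, (-(s⁻¹ ^ (d + 1) * kernelDivergence d (s⁻¹ • (x - y)))) • f y‖ ≤ D * (1 / (2 * √s))) :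
    ‖mollify δ f x - f x‖ ≤ D * √δ := by
  have hinc : ∀ a, 0 < a → a ≤ δ → ‖mollify δ f x - mollify a f x‖ ≤ D * √δ := by
    intro a ha haδ
    have := image_norm_le_of_norm_deriv_right_le_deriv_boundary'
      (f := fun s => mollify s f x - mollify a f x) (f' := fun s =>
        ∫ y, (-(s⁻¹ ^ (d + 1) * kernelDivergence d (s⁻¹ • (x - y)))) • f y) (a := a) (b := δ)
      (B := fun s => D * √s) (B' := fun s => D * (1 / (2 * √s)))
      (fun s hs => ((hasDerivAt_mollify hf x (ha.trans_le hs.1)).sub_const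
        _).continuousAt.continuousWithinAt)
      (fun s hs => ((hasDerivAt_mollify hf x (ha.trans_le hs.1)).sub_const _).hasDerivWithinAt)
      (by simp; positivity)
      (fun s hs => ((Real.hasDerivAt_sqrt (ha.trans_le hs.1).ne').const_mul
        _).continuousAt.continuousWithinAt)
      (fun s hs => ((Real.hasDerivAt_sqrt (ha.trans_le hs.1).ne').const_mul _).hasDerivWithinAt)
      (fun s hs => hder s (ha.trans_le hs.1) hs.2.le)
    exact this ⟨haδ, le_rfl⟩
  -- The derivative bound is singular at `s = 0` but integrable, with primitive `D √s`; continuity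
  -- of `f` at `x` lets the lower scale tend to zero.
  refine le_of_forall_pos_le_add fun η hη => ?_
  obtain ⟨a, ha, haη⟩ := Metric.continuous_iff.1 hf x η hη
  set a' := min (a / 2) δ
  have ha' : 0 < a' := lt_min (by positivity) hδ
  have h1 := hinc a' ha' (min_le_right _ _)
  have h2 : ‖mollify a' f x - f x‖ ≤ η := by
    refine norm_mollify_sub_le ha' hf fun z hz => ?_
    rw [← dist_eq_norm]
    refine (haη _ ?_).le
    have : a' ≤ a / 2 := min_le_left _ _
    rw [dist_eq_norm]
    simp only [sub_sub_cancel_left, norm_neg]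
    linarith
  calc ‖mollify δ f x - f x‖ = ‖(mollify δ f x - mollify a' f x) + (mollify a' f x - f x)‖ := by
        rw [sub_add_sub_cancel]
    _ ≤ D * √δ + η := (norm_add_le _ _).trans (add_le_add h1 h2)

/-- Integrating the derivative of the mollification over the scales in `(0, δ]` gives the estimate.
With `p = 2d + 2` the integrand is at most of order `s^{-1/2}`. -/
lemma exists_norm_sub_mollify_le (d : ℕ) : ∃ C : ℝ, 0 ≤ C ∧
    ∀ (p : ℝ≥0∞) [Fact (1 ≤ p)], p = ENNReal.ofReal (2 * d + 2) → ∀ (R : ℝ)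
    (q : sobolev d p (Metric.ball 0 R)) (f : Rd d → Rd d), Continuous f →
    q.1.1 =ᵐ[volume.restrict (Metric.ball 0 R)] f → ∀ (x : Rd d) (δ : ℝ), 0 < δ → δ ≤ 1 →
    ‖x‖ + δ < R → ∀ N, ‖q‖ ≤ N → ‖mollify δ f x - f x‖ ≤ C * √δ * N := by
  obtain ⟨A, hA0, hA⟩ := exists_baseKernel_bound d
  obtain ⟨v₁, hv₁⟩ : ∃ v₁, v₁ = volume.real (Metric.closedBall (0 : Rd d) 1) := ⟨_, rfl⟩
  have hv₁0 : 0 ≤ v₁ := hv₁ ▸ measureReal_nonneg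
  set e : ℝ := 1 - 1 / (2 * d + 2) with he
  set C : ℝ := d * (A * v₁ ^ e) with hC
  refine ⟨2 * C, by positivity, fun p _ hp R q f hf hq x δ hδ hδ1 hx N hN => ?_⟩
  have hN0 : 0 ≤ N := (norm_nonneg q).trans hN
  have hpr : p.toReal = 2 * d + 2 := by rw [hp, ENNReal.toReal_ofReal (by positivity)]
  have hN' : 0 ≤ 2 * C * N := by positivity
  refine (norm_mollify_sub_self_le_of_deriv hf hδ hN' fun s hs hsδ => ?_).trans
    (le_of_eq (by ring))
  have hvol : volume.real (Metric.closedBall x s) = s ^ d * v₁ := by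
    rw [measureReal_def, Measure.addHaar_closedBall' _ _ hs.le, ENNReal.toReal_mul,
      ENNReal.toReal_ofReal (by positivity)]
    simp [hv₁, measureReal_def]
  refine (norm_deriv_mollify_le hA0 hA q hf hq hs (fun y hy => ?_) hvol (by rw [hpr]) hN).trans ?_
  · have h1 : ‖y - x‖ ≤ s := by simpa [dist_eq_norm] using hy
    have h2 := norm_add_le x (y - x)
    rw [add_sub_cancel] at h2
    rw [Metric.mem_ball, dist_zero_right]
    linarith
  -- The left side is `s^{-d/p}` with `d/p = d/(2d+2) ≤ 1/2`; this uses `s ≤ 1`.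
  have hpow : s⁻¹ ^ d * (s ^ d) ^ e ≤ 1 / √s := by
    rw [Real.sqrt_eq_rpow, ← Real.rpow_natCast, ← Real.rpow_natCast, Real.inv_rpow hs.le,
      ← Real.rpow_mul hs.le, ← Real.rpow_neg hs.le, ← Real.rpow_add hs, one_div,
      ← Real.rpow_neg hs.le]
    refine Real.rpow_le_rpow_of_exponent_ge hs (hsδ.trans hδ1) ?_
    rw [he]
    have hd : (0 : ℝ) ≤ d := d.cast_nonneg
    have : (d : ℝ) / (2 * d + 2) ≤ 1 / 2 := by
      rw [div_le_div_iff₀ (by positivity) (by norm_num)]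
      linarith
    have h2 : -(d : ℝ) + d * (1 - 1 / (2 * d + 2)) = -(d / (2 * d + 2)) := by ring
    rw [h2]
    linarith
  rw [Real.mul_rpow (pow_nonneg hs.le d) hv₁0]
  calc (d : ℝ) * (s⁻¹ ^ d * A * ((s ^ d) ^ e * v₁ ^ e * N))
      = C * N * (s⁻¹ ^ d * (s ^ d) ^ e) := by rw [hC]; ring
    _ ≤ C * N * (1 / √s) := by gcongr
    _ = 2 * C * N * (1 / (2 * √s)) := by
        have : 0 < √s := Real.sqrt_pos.2 hs
        field_simp

end Morrey

/-! ### Consequences of weak convergence of the controls. -/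

section WeakConvergence

lemma tendsto_apply_of_tendsto_weak {E α : Type*} [NormedAddCommGroup E] [NormedSpace ℝ E]
    {l : Filter α} {f : α → E} {x : E}
    (h : Tendsto (fun i => toWeakSpace ℝ E (f i)) l (𝓝 (toWeakSpace ℝ E x))) (ℓ : StrongDual ℝ E) :
    Tendsto (fun i => ℓ (f i)) l (𝓝 (ℓ x)) :=
  ((WeakBilin.eval_continuous (topDualPairing ℝ E).flip ℓ).tendsto _).comp h

/-- Uniform boundedness principle in the bidual. Along a net weak convergence would not bound the
norms; a countable basis of the filter allows extracting an unbounded sequence to contradict it. -/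
lemma exists_eventually_norm_le_of_tendsto_weak {E α : Type*} [NormedAddCommGroup E]
    [NormedSpace ℝ E] {l : Filter α} [l.IsCountablyGenerated] {f : α → E} {x : E}
    (h : Tendsto (fun i => toWeakSpace ℝ E (f i)) l (𝓝 (toWeakSpace ℝ E x))) :
    ∃ N, ∀ᶠ i in l, ‖f i‖ ≤ N := by
  by_contra! hcon
  obtain ⟨s, hs⟩ := l.exists_antitone_basis
  have : ∀ n : ℕ, ∃ i ∈ s n, (n : ℝ) < ‖f i‖ := by
    intro n
    obtain ⟨i, hi, hi'⟩ := ((hcon n).and_eventually (hs.1.mem_of_mem (i := n) trivial)).exists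
    exact ⟨i, hi', hi⟩
  choose i his hin using this
  have hi : Tendsto i atTop l := hs.tendsto his
  obtain ⟨C, hC⟩ := banach_steinhaus
    (g := fun n => NormedSpace.inclusionInDoubleDual ℝ E (f (i n))) (fun ℓ => by
      obtain ⟨C, hC⟩ := ((tendsto_apply_of_tendsto_weak h ℓ).comp hi).norm.bddAbove_range
      exact ⟨C, fun n => hC ⟨n, rfl⟩⟩)
  obtain ⟨n, hn⟩ := exists_nat_gt C
  have h1 := hC n
  rw [show ‖NormedSpace.inclusionInDoubleDual ℝ E (f (i n))‖ = ‖f (i n)‖ from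
    (NormedSpace.inclusionInDoubleDualLi ℝ).norm_map (f (i n))] at h1
  linarith [hin n]

/-- The map `q ↦ ⟨c 1_{(a,b)}, A ∘ q⟩` in `L²` is a continuous functional on the Bochner space. Thus
time integrals of `A ∘ q` converge against fixed vectors, with no description of the dual space
needed. -/
lemma tendsto_inner_setIntegral_of_tendsto_weak {E F α : Type*} [NormedAddCommGroup E]
    [NormedSpace ℝ E] [NormedAddCommGroup F] [InnerProductSpace ℝ F] [CompleteSpace F]
    (A : E →L[ℝ] F) (c : F) {T a b : ℝ} (ha : 0 ≤ a) (hb : b ≤ T)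
    {l : Filter α} {f : α → Lp E 2 (volume.restrict (Ioo 0 T))}
    {g : Lp E 2 (volume.restrict (Ioo 0 T))} {Φ : α → ℝ → F} {Γ : ℝ → F}
    (hΦ : ∀ᶠ i in l, ∀ᵐ s ∂(volume.restrict (Ioo 0 T)), A (f i s) = Φ i s)
    (hΓ : ∀ᵐ s ∂(volume.restrict (Ioo 0 T)), A (g s) = Γ s)
    (h : Tendsto (fun i => toWeakSpace ℝ (Lp E 2 (volume.restrict (Ioo 0 T))) (f i)) l
      (𝓝 (toWeakSpace ℝ (Lp E 2 (volume.restrict (Ioo 0 T))) g))) :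
    Tendsto (fun i => inner ℝ c (∫ s in Ioo a b, Φ i s)) l
      (𝓝 (inner ℝ c (∫ s in Ioo a b, Γ s))) := by
  have hfin : (volume.restrict (Ioo 0 T)) (Ioo a b) ≠ ⊤ :=
    ((Measure.restrict_apply_le _ _).trans_lt (by simp)).ne
  let ℓ : StrongDual ℝ (Lp E 2 (volume.restrict (Ioo 0 T))) :=
    (innerSL ℝ (indicatorConstLp 2 measurableSet_Ioo hfin c)).comp
      (A.compLpL 2 (volume.restrict (Ioo 0 T)))
  have hℓ : ∀ (q : Lp E 2 (volume.restrict (Ioo 0 T))) (Ψ : ℝ → F),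
      (∀ᵐ s ∂(volume.restrict (Ioo 0 T)), A (q s) = Ψ s) →
      ℓ q = inner ℝ c (∫ s in Ioo a b, Ψ s) := by
    intro q Ψ hΨ
    have e1 : ℓ q = inner ℝ (indicatorConstLp 2 measurableSet_Ioo hfin c) (A.compLp q) := rfl
    rw [e1, L2.inner_indicatorConstLp_eq_inner_setIntegral,
      Measure.restrict_restrict measurableSet_Ioo, inter_eq_left.2 (Ioo_subset_Ioo ha hb)]
    congr 1
    refine integral_congr_ae ?_
    filter_upwards [ae_restrict_Ioo_mono (A.coeFn_compLp q) ha hb, ae_restrict_Ioo_mono hΨ ha hb]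
      with s hs hs'
    rw [hs, hs']
  have := tendsto_apply_of_tendsto_weak h ℓ
  rw [hℓ g Γ hΓ] at this
  refine this.congr' ?_
  filter_upwards [hΦ] with i hi
  exact hℓ _ _ hi

lemma integrable_norm_and_integral_le {E : Type*} [NormedAddCommGroup E] {T : ℝ} (hT : 0 ≤ T)
    (f : Lp E 2 (volume.restrict (Ioo 0 T))) {N : ℝ} (hN : ‖f‖ ≤ N) :
    IntegrableOn (fun s => ‖f s‖) (Ioo 0 T) ∧ ∫ s in Ioo 0 T, ‖f s‖ ≤ √T * N := by
  refine ⟨((Lp.memLp f).integrable (by norm_num)).norm, ?_⟩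
  have h := setIntegral_norm_Lp_le f (S := univ) (by simp)
  rw [Measure.restrict_univ] at h
  refine h.trans (mul_le_mul (le_of_eq ?_) hN (norm_nonneg _) (by positivity))
  rw [measureReal_restrict_apply_univ, Real.volume_real_Ioo_of_le hT, sub_zero, Real.sqrt_eq_rpow]
  norm_num

variable {d : ℕ} {T : ℝ} {p : ℝ≥0∞} [Fact (1 ≤ p)]

lemma mollify_eq_integral_sub (s : ℝ) (f : Rd d → Rd d) (x : Rd d) :
    mollify s f x = ∫ y, mollKernel s (x - y) • f y := by
  rw [mollify_apply, ← integral_sub_left_eq_self _ _ x]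
  simp

lemma Represents.congr {K : Set (Rd d)} {v : L2Sobolev d T p K} {u w : ℝ → Rd d → Rd d}
    (h : Represents v u) (h0 : ∀ᵐ t ∂(volume.restrict (Ioo 0 T)), u t = w t) : Represents v w := by
  unfold Represents at *
  filter_upwards [h, h0] with t h1 h2
  exact h1.trans (Eq.eventuallyEq h2)

lemma WeakConvergence.congr {uε wε : ℝ → ℝ → Rd d → Rd d} {u w : ℝ → Rd d → Rd d}
    (h : WeakConvergence T p uε u)
    (hε : ∀ ε, 0 < ε → ∀ᵐ t ∂(volume.restrict (Ioo 0 T)), uε ε t = wε ε t)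
    (h0 : ∀ᵐ t ∂(volume.restrict (Ioo 0 T)), u t = w t) : WeakConvergence T p wε w := by
  intro r hr
  exact (h r hr).imp fun vε H => H.imp fun v H =>
    ⟨fun ε hε' => (H.1 ε hε').congr (hε ε hε'), H.2.1.congr h0, H.2.2⟩

/-- Integration against a continuous compactly supported weight, on the `L^p` space of a ball. -/
def weightCLM (p : ℝ≥0∞) [Fact (1 ≤ p)] (R : ℝ) (k : Rd d → ℝ) (hw : Continuous k)
    (hc : HasCompactSupport k) : Lp (Rd d) p (volume.restrict (Metric.ball (0 : Rd d) R)) →L[ℝ] Rd d :=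
  LinearMap.mkContinuousOfExistsBound
    { toFun := fun f => ∫ y in Metric.ball 0 R, k y • f y
      map_add' := by
        intro f g
        rw [← integral_add (integrable_weight_smul f hw hc) (integrable_weight_smul g hw hc)]
        refine integral_congr_ae ?_
        filter_upwards [Lp.coeFn_add f g] with y hy
        rw [hy, Pi.add_apply, smul_add]
      map_smul' := by
        intro c f
        rw [RingHom.id_apply, ← integral_smul]
        refine integral_congr_ae ?_
        filter_upwards [Lp.coeFn_smul c f] with y hy
        rw [hy, Pi.smul_apply, smul_comm] }
    (by
      obtain ⟨A, hA⟩ := hc.exists_bound_of_continuous hw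
      have hA0 : 0 ≤ A := (norm_nonneg _).trans (hA 0)
      have hfin : (volume.restrict (Metric.ball (0 : Rd d) R)) univ ≠ ⊤ := by
        rw [Measure.restrict_apply_univ]
        exact measure_ball_lt_top.ne
      refine ⟨A * (volume.restrict (Metric.ball (0 : Rd d) R)).real univ ^ (1 - 1 / p.toReal),
        fun f => ?_⟩
      have hintg : Integrable (fun y => ‖f y‖) (volume.restrict (Metric.ball 0 R)) := by
        have : IsFiniteMeasure (volume.restrict (Metric.ball (0 : Rd d) R)) := ⟨hfin.lt_top⟩
        exact ((Lp.memLp f).integrable Fact.out).norm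
      have h1 := setIntegral_norm_Lp_le f hfin
      rw [Measure.restrict_univ] at h1
      have h2 : ‖∫ y in Metric.ball 0 R, k y • f y‖ ≤ ∫ y in Metric.ball 0 R, A * ‖f y‖ := by
        refine norm_integral_le_of_norm_le (hintg.const_mul A) (ae_of_all _ fun y => ?_)
        rw [norm_smul]
        exact mul_le_mul_of_nonneg_right (hA y) (norm_nonneg _)
      rw [integral_const_mul] at h2
      refine h2.trans ?_
      rw [mul_assoc]
      exact mul_le_mul_of_nonneg_left h1 hA0)

/-- The mollification at a point, as a continuous linear map on the Sobolev space of a ball. -/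
def mollifyCLM (p : ℝ≥0∞) [Fact (1 ≤ p)] (R δ : ℝ) (hδ : 0 < δ) (x : Rd d) :
    sobolev d p (Metric.ball 0 R) →L[ℝ] Rd d :=
  (weightCLM p R (fun y : Rd d => mollKernel δ (x - y))
    ((contDiff_mollKernel δ).continuous.comp (continuous_const.sub continuous_id))
    ((hasCompactSupport_mollKernel hδ).comp_homeomorph (Homeomorph.subLeft x))).comp
    ((ContinuousLinearMap.fst ℝ _ _).comp (sobolev d p (Metric.ball 0 R)).subtypeL)

lemma mollifyCLM_apply {R δ : ℝ} (hδ : 0 < δ) {x : Rd d} (hx : ‖x‖ + δ < R)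
    (q : sobolev d p (Metric.ball 0 R)) {f : Rd d → Rd d}
    (hq : q.1.1 =ᵐ[volume.restrict (Metric.ball 0 R)] f) :
    mollifyCLM p R δ hδ x q = mollify δ f x := by
  have e1 : mollifyCLM p R δ hδ x q
      = ∫ y in Metric.ball 0 R, mollKernel δ (x - y) • q.1.1 y := rfl
  have e2 : ∫ y in Metric.ball 0 R, mollKernel δ (x - y) • f y
      = ∫ y, mollKernel δ (x - y) • f y := by
    refine setIntegral_eq_integral_of_forall_compl_eq_zero fun y hy => ?_
    rw [mollKernel_eq_zero hδ, zero_smul]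
    have h1 : R ≤ ‖y‖ := by simpa using hy
    have h2 := norm_sub_norm_le y x
    rw [norm_sub_rev] at h2
    linarith
  rw [e1, mollify_eq_integral_sub, ← e2]
  refine integral_congr_ae ?_
  filter_upwards [hq] with y hy
  rw [hy]

lemma tendsto_inner_mollify {wε : ℝ → ℝ → Rd d → Rd d} {w : ℝ → Rd d → Rd d}
    (h : WeakConvergence T p wε w) {δ : ℝ} (hδ : 0 < δ) (x c : Rd d) {a b : ℝ} (ha : 0 ≤ a)
    (hb : b ≤ T) :
    Tendsto (fun ε => inner ℝ c (∫ s in Ioo a b, mollify δ (wε ε s) x)) (𝓝[>] 0)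
      (𝓝 (inner ℝ c (∫ s in Ioo a b, mollify δ (w s) x))) := by
  refine Exists.elim (h (‖x‖ + δ + 1) (by positivity)) fun vε H => Exists.elim H fun v H => ?_
  have h1 := H.1
  have h2 := H.2.1
  have h3 := H.2.2
  refine tendsto_inner_setIntegral_of_tendsto_weak (mollifyCLM p (‖x‖ + δ + 1) δ hδ x) c ha hb
    ?_ (h2.mono fun s hs => mollifyCLM_apply hδ (by linarith) _ hs) h3
  exact eventually_nhdsWithin_of_forall fun ε hε =>
    (h1 ε hε).mono fun s hs => mollifyCLM_apply hδ (by linarith) _ hs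

/-- Mollification at a point is a continuous linear map on the Sobolev space, so its time integrals
converge at each point. The mollified controls are equi-Lipschitz, and finitely many centres cover
the ball, hence convergence is uniform there. -/
lemma eventually_norm_mollify_sub_le {wε : ℝ → ℝ → Rd d → Rd d} {w : ℝ → Rd d → Rd d}
    (h : WeakConvergence T p wε w) {C : ℝ≥0} (hwε : ∀ ε, 0 < ε → Measurable (Function.uncurry (wε ε)))
    (hw : Measurable (Function.uncurry w)) (hwεC : ∀ ε, 0 < ε → ∀ t x, ‖wε ε t x‖ ≤ C)
    (hwC : ∀ t x, ‖w t x‖ ≤ C) (hwεc : ∀ ε, 0 < ε → ∀ t, Continuous (wε ε t))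
    (hwc : ∀ t, Continuous (w t)) {δ : ℝ} (hδ : 0 < δ) {a b : ℝ} (ha : 0 ≤ a) (hab : a ≤ b)
    (hb : b ≤ T) (r : ℝ) {η : ℝ} (hη : 0 < η) :
    ∀ᶠ ε in 𝓝[>] 0, ∀ x : Rd d, ‖x‖ ≤ r →
      ‖∫ s in a..b, (mollify δ (wε ε s) x - mollify δ (w s) x)‖ ≤ η := by
  set Λ : ℝ≥0 := kernelVariation d δ * C
  set ρ : ℝ := η / (2 * ((b - a) * (2 * Λ) + 1)) with hρ
  have hba : 0 ≤ b - a := by linarith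
  have hρ0 : 0 < ρ := by positivity
  obtain ⟨S, hSsub, hSfin, hS⟩ := (isCompact_closedBall (0 : Rd d) r).finite_cover_balls hρ0
  have hintg : ∀ (f : ℝ → Rd d → Rd d), Measurable (Function.uncurry f) → (∀ t x, ‖f t x‖ ≤ C) →
      (∀ t, Continuous (f t)) → ∀ x, IntervalIntegrable (fun s => mollify δ (f s) x) volume a b := by
    intro f hf hfC hfc x
    rw [intervalIntegrable_iff_integrableOn_Ioc_of_le hab]
    refine Integrable.mono' (integrable_const (C : ℝ)) ?_ (ae_of_all _ fun s => ?_)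
    · exact ((stronglyMeasurable_mollify hf).comp_measurable
        (measurable_id.prodMk measurable_const)).aestronglyMeasurable
    · exact norm_mollify_le hδ (hfc s) fun z _ => hfC s _
  have hpt : ∀ x : Rd d, Tendsto (fun ε => ∫ s in a..b, mollify δ (wε ε s) x) (𝓝[>] 0)
      (𝓝 (∫ s in a..b, mollify δ (w s) x)) := by
    intro x
    simp only [intervalIntegral.integral_of_le hab, integral_Ioc_eq_integral_Ioo]
    -- Convergence is available against fixed vectors only, so the vector is rebuilt from its
    -- coordinates.
    have e : ∀ y : Rd d, y = WithLp.toLp 2 (fun i => inner ℝ (EuclideanSpace.single i (1 : ℝ)) y) := by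
      intro y
      ext i
      simp [EuclideanSpace.inner_single_left]
    have h2 : Tendsto (fun ε => WithLp.toLp 2 (fun i : Fin d => inner ℝ (EuclideanSpace.single i (1 : ℝ))
        (∫ s in Ioo a b, mollify δ (wε ε s) x))) (𝓝[>] 0)
        (𝓝 (WithLp.toLp 2 (fun i : Fin d => inner ℝ (EuclideanSpace.single i (1 : ℝ))
          (∫ s in Ioo a b, mollify δ (w s) x)))) :=
      ((PiLp.continuous_toLp 2 _).tendsto _).comp
        (tendsto_pi_nhds.2 fun i => tendsto_inner_mollify h hδ x _ ha hb)
    simpa only [← e] using h2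
  have hev : ∀ᶠ ε in 𝓝[>] (0 : ℝ), ∀ x ∈ S,
      ‖(∫ s in a..b, mollify δ (wε ε s) x) - ∫ s in a..b, mollify δ (w s) x‖ < η / 2 := by
    rw [hSfin.eventually_all]
    intro x _
    have := (tendsto_iff_norm_sub_tendsto_zero.1 (hpt x)).eventually (gt_mem_nhds (half_pos hη))
    exact this
  filter_upwards [hev, self_mem_nhdsWithin] with ε hε hε0 x hx
  have hε0 : 0 < ε := hε0
  obtain ⟨y, hyS, hxy⟩ := mem_iUnion₂.1 (hS (by simpa using hx : x ∈ Metric.closedBall 0 r))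
  have h1 := hε y hyS
  rw [← intervalIntegral.integral_sub (hintg _ (hwε ε hε0) (hwεC ε hε0) (hwεc ε hε0) y)
    (hintg w hw hwC hwc y)] at h1
  have hlip : ∀ f : Rd d → Rd d, Continuous f → (∀ x, ‖f x‖ ≤ C) →
      ‖mollify δ f x - mollify δ f y‖ ≤ Λ * ρ := by
    intro f hf hfC
    refine ((lipschitzWith_mollify_of_bounded hδ hf hfC).norm_sub_le x y).trans ?_
    rw [Metric.mem_ball, dist_eq_norm] at hxy
    gcongr
  have hi1 : ∀ z, IntervalIntegrable (fun s => mollify δ (wε ε s) z - mollify δ (w s) z)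
      volume a b := fun z =>
    (hintg _ (hwε ε hε0) (hwεC ε hε0) (hwεc ε hε0) z).sub (hintg w hw hwC hwc z)
  have h2 : ‖(∫ s in a..b, (mollify δ (wε ε s) x - mollify δ (w s) x))
      - ∫ s in a..b, (mollify δ (wε ε s) y - mollify δ (w s) y)‖ ≤ (2 * (Λ * ρ)) * |b - a| := by
    rw [← intervalIntegral.integral_sub (hi1 x) (hi1 y)]
    refine intervalIntegral.norm_integral_le_of_norm_le_const fun s _ => ?_
    rw [sub_sub_sub_comm]
    refine (norm_sub_le _ _).trans ?_
    linarith [hlip _ (hwεc ε hε0 s) (hwεC ε hε0 s), hlip _ (hwc s) (hwC s)]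
  rw [abs_of_nonneg hba] at h2
  have h3 : (2 * (Λ * ρ)) * (b - a) ≤ η / 2 := by
    have : (2 * (Λ * ρ)) * (b - a) = ((b - a) * (2 * Λ)) * ρ := by ring
    rw [this]
    calc ((b - a) * (2 * Λ)) * ρ ≤ ((b - a) * (2 * Λ) + 1) * ρ := by gcongr; linarith
      _ = η / 2 := by rw [hρ]; field_simp
  have h4 := norm_add_le (∫ s in a..b, (mollify δ (wε ε s) y - mollify δ (w s) y))
    ((∫ s in a..b, (mollify δ (wε ε s) x - mollify δ (w s) x))
      - ∫ s in a..b, (mollify δ (wε ε s) y - mollify δ (w s) y))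
  rw [add_sub_cancel] at h4
  linarith

/-- The rate is `n s = C ‖v^ε(s)‖` in the Sobolev norm. Its time integral is bounded for small `ε`
because weakly convergent families are eventually bounded in `L²`. This stands in for a uniform
Lipschitz bound on the controls. -/
lemma exists_mollify_sub_bound (hT : 0 < T) {wε : ℝ → ℝ → Rd d → Rd d} {w : ℝ → Rd d → Rd d}
    (hp : p = ENNReal.ofReal (2 * d + 2)) (h : WeakConvergence T p wε w)
    (hwεc : ∀ ε, 0 < ε → ∀ t, Continuous (wε ε t)) {R : ℝ} (hR : 0 < R) :
    ∃ N : ℝ, 0 ≤ N ∧ ∀ᶠ ε in 𝓝[>] 0, ∃ n : ℝ → ℝ, IntegrableOn n (Ioo 0 T) ∧ (∀ s, 0 ≤ n s) ∧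
      ∫ s in Ioo 0 T, n s ≤ N ∧ ∀ᵐ s ∂(volume.restrict (Ioo 0 T)), ∀ (x : Rd d) (δ : ℝ), 0 < δ →
        δ ≤ 1 → ‖x‖ + δ < R → ‖mollify δ (wε ε s) x - wε ε s x‖ ≤ √δ * n s := by
  obtain ⟨C, hC0, hC⟩ := exists_norm_sub_mollify_le d
  refine Exists.elim (h R hR) fun vε H => Exists.elim H fun v H => ?_
  have h1 := H.1
  have h3 := H.2.2
  refine Exists.elim (exists_eventually_norm_le_of_tendsto_weak h3) fun N hN => ?_
  refine ⟨C * (√T * max N 0), by positivity, ?_⟩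
  filter_upwards [hN, self_mem_nhdsWithin] with ε hε hε0
  have hintg := integrable_norm_and_integral_le hT.le (vε ε) (hε.trans (le_max_left N 0))
  refine ⟨fun s => C * ‖vε ε s‖, hintg.1.const_mul C, fun s => mul_nonneg hC0 (norm_nonneg _), ?_, ?_⟩
  · rw [integral_const_mul]
    exact mul_le_mul_of_nonneg_left hintg.2 hC0
  · filter_upwards [h1 ε hε0] with s hs x δ hδ hδ1 hx
    refine (hC p hp R (vε ε s) (wε ε s) (hwεc ε hε0 s) hs x δ hδ hδ1 hx _ le_rfl).trans
      (le_of_eq (by ring))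

end WeakConvergence

/-! ### A quantitative class of test functions and continuity of solutions in time. -/

section TestFunctions

variable {d : ℕ} {T : ℝ}

/-- Smooth compactly supported functions with gradient bounded by `A` and `B`-Lipschitz. -/
structure IsTestFunction (A B : ℝ≥0) (ψ : Rd d → ℝ) : Prop where
  contDiff : ContDiff ℝ ∞ ψ
  hasCompactSupport : HasCompactSupport ψ
  fderiv_le : ∀ x, ‖fderiv ℝ ψ x‖ ≤ A
  lipschitz : LipschitzWith B (fderiv ℝ ψ)

lemma IsTestFunction.mono {A A' B B' : ℝ≥0} {ψ : Rd d → ℝ} (h : IsTestFunction A B ψ) (hA : A ≤ A')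
    (hB : B ≤ B') : IsTestFunction A' B' ψ :=
  ⟨h.contDiff, h.hasCompactSupport, fun x => (h.fderiv_le x).trans (by exact_mod_cast hA),
    h.lipschitz.weaken hB⟩

lemma exists_isTestFunction {ψ : Rd d → ℝ} (h : ContDiff ℝ ∞ ψ) (hc : HasCompactSupport ψ) :
    ∃ A B : ℝ≥0, IsTestFunction A B ψ := by
  have h1 : ContDiff ℝ ∞ (fderiv ℝ ψ) := h.fderiv_right (by simp)
  obtain ⟨A, hA⟩ := (hc.fderiv ℝ).exists_bound_of_continuous h1.continuous
  obtain ⟨B, hB⟩ := h1.lipschitzWith_of_hasCompactSupport (hc.fderiv ℝ) (by simp)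
  exact ⟨A.toNNReal, B, h, hc, fun x => (hA x).trans (Real.le_coe_toNNReal A), hB⟩

lemma IsTestFunction.abs_laplacian_le {A B : ℝ≥0} {ψ : Rd d → ℝ} (h : IsTestFunction A B ψ)
    (x : Rd d) : |Laplacian.laplacian ψ x| ≤ d * B :=
  VanishingViscosity.abs_laplacian_le (norm_fderiv_le_of_lipschitz ℝ h.lipschitz)

lemma IsTestFunction.continuous_fderiv {A B : ℝ≥0} {ψ : Rd d → ℝ} (h : IsTestFunction A B ψ) :
    Continuous (fderiv ℝ ψ) := h.lipschitz.continuous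

lemma IsTestFunction.integrable {A B : ℝ≥0} {ψ : Rd d → ℝ} (h : IsTestFunction A B ψ) (μ : P2 d) :
    Integrable ψ μ.meas :=
  h.contDiff.continuous.integrable_of_hasCompactSupport h.hasCompactSupport

lemma IsTestFunction.abs_apply_le {A B : ℝ≥0} {ψ : Rd d → ℝ} (h : IsTestFunction A B ψ)
    (x v : Rd d) : |fderiv ℝ ψ x v| ≤ A * ‖v‖ :=
  ((fderiv ℝ ψ x).le_opNorm v).trans (mul_le_mul_of_nonneg_right (h.fderiv_le x) (norm_nonneg _))

lemma IsTestFunction.taylor {A B : ℝ≥0} {ψ : Rd d → ℝ} (h : IsTestFunction A B ψ) (x v : Rd d) :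
    |ψ (x + v) - ψ x - fderiv ℝ ψ x v| ≤ B * ‖v‖ ^ 2 := by
  have := (convex_closedBall x ‖v‖).norm_image_sub_le_of_norm_fderiv_le' (𝕜 := ℝ) (f := ψ)
    (φ := fderiv ℝ ψ x) (C := B * ‖v‖) (x := x) (y := x + v)
    (fun y _ => h.contDiff.differentiable (by simp) y)
    (fun y hy => (h.lipschitz.norm_sub_le y x).trans (by
      gcongr
      simpa [dist_eq_norm] using hy)) (by simp) (by simp)
  rw [add_sub_cancel_left, Real.norm_eq_abs] at this
  exact this.trans (le_of_eq (by ring))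

/-- Pulling a test function back through one step `x ↦ x + V x`. The chain rule gives the constants,
and the growth of the second one involves the Lipschitz constant `m` of the derivative of `V`. -/
lemma IsTestFunction.comp_add {A B ℓ m : ℝ≥0} {ψ : Rd d → ℝ} (h : IsTestFunction A B ψ)
    {V : Rd d → Rd d} (hV : ContDiff ℝ ∞ V) (hVL : LipschitzWith ℓ V)
    (hVm : LipschitzWith m (fderiv ℝ V)) (hℓ : ℓ ≤ 1 / 2) :
    IsTestFunction (A * (1 + ℓ)) (B * (1 + ℓ) ^ 2 + A * m) (fun x => ψ (x + V x)) := by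
  have hΦ : ContDiff ℝ ∞ fun x => x + V x := contDiff_id.add hV
  have hD : ∀ x, fderiv ℝ (fun x => ψ (x + V x)) x
      = (fderiv ℝ ψ (x + V x)).comp (ContinuousLinearMap.id ℝ (Rd d) + fderiv ℝ V x) := by
    intro x
    have h1 : HasFDerivAt (fun x => x + V x) (ContinuousLinearMap.id ℝ (Rd d) + fderiv ℝ V x) x :=
      (hasFDerivAt_id x).add (hV.differentiable (by simp) x).hasFDerivAt
    exact ((h.contDiff.differentiable (by simp) (x + V x)).hasFDerivAt.comp x h1).fderiv
  have hVx : ∀ x, ‖ContinuousLinearMap.id ℝ (Rd d) + fderiv ℝ V x‖ ≤ 1 + ℓ := fun x =>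
    (norm_add_le _ _).trans (add_le_add ContinuousLinearMap.norm_id_le
      (norm_fderiv_le_of_lipschitz ℝ hVL))
  have hℓ' : (ℓ : ℝ) ≤ 1 / 2 := by exact_mod_cast hℓ
  refine ⟨h.contDiff.comp hΦ, ?_, fun x => ?_, ?_⟩
  -- The map is proper since `ℓ ≤ 1/2`: from `‖x + V x‖ ≤ R` follows `‖x‖ ≤ 2(R + ‖V 0‖)`.
  · obtain ⟨R, hR⟩ := h.hasCompactSupport.isBounded.exists_norm_le
    refine HasCompactSupport.intro (isCompact_closedBall 0 (2 * (R + ‖V 0‖))) fun x hx => ?_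
    by_contra hne
    have h1 := hR _ (subset_tsupport ψ hne)
    have h2 : 2 * (R + ‖V 0‖) < ‖x‖ := by simpa using hx
    have h3 := hVL.norm_sub_le x 0
    rw [sub_zero] at h3
    have h4 : ‖x‖ ≤ ‖x + V x‖ + (‖V x - V 0‖ + ‖V 0‖) := by
      calc ‖x‖ = ‖(x + V x) - ((V x - V 0) + V 0)‖ := by congr 1; abel
        _ ≤ _ := (norm_sub_le _ _).trans (by gcongr; exact norm_add_le _ _)
    nlinarith [norm_nonneg x]
  · rw [hD, NNReal.coe_mul]
    exact (ContinuousLinearMap.opNorm_comp_le _ _).trans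
      (mul_le_mul (h.fderiv_le _) (by simpa using hVx x) (norm_nonneg _) A.2)
  · refine LipschitzWith.of_dist_le_mul fun x y => ?_
    rw [dist_eq_norm, dist_eq_norm, hD, hD]
    set P := fderiv ℝ ψ (x + V x)
    set Q := fderiv ℝ ψ (y + V y)
    have e : P.comp (ContinuousLinearMap.id ℝ (Rd d) + fderiv ℝ V x)
        - Q.comp (ContinuousLinearMap.id ℝ (Rd d) + fderiv ℝ V y)
        = (P - Q).comp (ContinuousLinearMap.id ℝ (Rd d) + fderiv ℝ V x)
          + Q.comp (fderiv ℝ V x - fderiv ℝ V y) := by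
      ext z
      simp
      ring
    have h1 : ‖P - Q‖ ≤ B * ((1 + ℓ) * ‖x - y‖) := by
      refine (h.lipschitz.norm_sub_le _ _).trans ?_
      gcongr
      calc ‖x + V x - (y + V y)‖ = ‖(x - y) + (V x - V y)‖ := by congr 1; abel
        _ ≤ ‖x - y‖ + ℓ * ‖x - y‖ := (norm_add_le _ _).trans (by gcongr; exact hVL.norm_sub_le x y)
        _ = _ := by ring
    rw [e]
    refine (norm_add_le _ _).trans ?_
    calc _ ≤ ‖P - Q‖ * ‖ContinuousLinearMap.id ℝ (Rd d) + fderiv ℝ V x‖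
          + ‖Q‖ * ‖fderiv ℝ V x - fderiv ℝ V y‖ :=
          add_le_add (ContinuousLinearMap.opNorm_comp_le _ _) (ContinuousLinearMap.opNorm_comp_le _ _)
      _ ≤ (B * ((1 + ℓ) * ‖x - y‖)) * (1 + ℓ) + A * (m * ‖x - y‖) :=
          add_le_add (mul_le_mul h1 (hVx x) (norm_nonneg _) (by positivity))
            (mul_le_mul (h.fderiv_le _) (hVm.norm_sub_le x y) (norm_nonneg _) A.2)
      _ = _ := by push_cast; ring

lemma integrable_of_norm_le_linear (μ : P2 d) {G : Type*} [NormedAddCommGroup G] {f : Rd d → G}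
    (hf : AEStronglyMeasurable f μ.meas) {c : ℝ} (h : ∀ x, ‖f x‖ ≤ c * (1 + ‖x‖)) :
    Integrable f μ.meas :=
  Integrable.mono' (((integrable_const 1).add (integrable_norm μ)).const_mul c) hf (ae_of_all _ h)

lemma integral_linear_le {μ : P2 d} {K : ℝ≥0} (hK : ∫⁻ x, ‖x‖ₑ ^ 4 ∂μ.meas ≤ K) :
    ∫ x, (1 + ‖x‖) ∂μ.meas ≤ 2 + K := by
  have h4 := integrable_norm_pow_four hK
  calc ∫ x, (1 + ‖x‖) ∂μ.meas ≤ ∫ x, (2 + ‖x‖ ^ 4) ∂μ.meas := by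
        refine integral_mono ((integrable_const _).add (integrable_norm μ))
          ((integrable_const _).add h4) fun x => ?_
        change 1 + ‖x‖ ≤ 2 + ‖x‖ ^ 4
        nlinarith [sq_nonneg (‖x‖ - 1), sq_nonneg (‖x‖ ^ 2 - 1)]
    _ = 2 + ∫ x, ‖x‖ ^ 4 ∂μ.meas := by rw [integral_add (integrable_const _) h4]; simp
    _ ≤ 2 + K := by linarith [integral_norm_pow_four_le hK]

/-- Errors small only on a ball: outside, the excess `D` is paid by Markov's inequality for the
fourth moment. -/
lemma norm_integral_le_of_tail {μ : P2 d} {K : ℝ≥0} (hK : ∫⁻ x, ‖x‖ₑ ^ 4 ∂μ.meas ≤ K)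
    {f : Rd d → ℝ} {r e D : ℝ} (hr : 0 < r) (hD : 0 ≤ D)
    (h1 : ∀ x, ‖x‖ ≤ r → |f x| ≤ e) (h2 : ∀ x, |f x| ≤ e + D) :
    |∫ x, f x ∂μ.meas| ≤ e + D * K / r ^ 4 := by
  have h4 := integrable_norm_pow_four hK
  have hpt : ∀ x, ‖f x‖ ≤ e + D / r ^ 4 * ‖x‖ ^ 4 := by
    intro x
    rw [Real.norm_eq_abs]
    rcases le_total ‖x‖ r with hx | hx
    · have : 0 ≤ D / r ^ 4 * ‖x‖ ^ 4 := by positivity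
      linarith [h1 x hx]
    · refine (h2 x).trans (add_le_add le_rfl ?_)
      rw [div_mul_eq_mul_div, le_div_iff₀ (by positivity)]
      gcongr
  rw [← Real.norm_eq_abs]
  refine (norm_integral_le_of_norm_le (g := fun x => e + D / r ^ 4 * ‖x‖ ^ 4)
    ((integrable_const _).add (h4.const_mul _)) (ae_of_all _ hpt)).trans ?_
  rw [integral_add (integrable_const _) (h4.const_mul _), integral_const_mul]
  simp only [integral_const, probReal_univ, smul_eq_mul, one_mul]
  have := integral_norm_pow_four_le hK
  rw [mul_div_right_comm]
  gcongr

/-- Modulus of continuity in time of the integrals of a test function. -/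
lemma IsRegularSolution.abs_integral_sub_le {κ : ℝ} {L C K : ℝ≥0} {β w : ℝ → Rd d → Rd d}
    {μ : ℝ → P2 d} (h : IsRegularSolution T κ L C K β w μ) (hκ : |κ| ≤ 1) {A B : ℝ≥0}
    {ψ : Rd d → ℝ} (hψ : IsTestFunction A B ψ) {s t : ℝ} (hs : 0 ≤ s) (hst : s ≤ t) (ht : t ≤ T) :
    |∫ x, ψ x ∂(μ t).meas - ∫ x, ψ x ∂(μ s).meas| ≤ (A * (2 * C) * (2 + K) + d * B) * (t - s) := by
  refine (h.sol.abs_sub_le hψ.contDiff hψ.hasCompactSupport hs hst ht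
    (G := fun _ => A * (2 * C) * (2 + K) + d * B) intervalIntegrable_const ?_).trans
    (le_of_eq (by rw [intervalIntegral.integral_const, smul_eq_mul, mul_comm]))
  filter_upwards [ae_restrict_mem measurableSet_Ioo] with r hr
  have hrT : r ∈ Icc 0 T := ⟨hs.trans hr.1.le, hr.2.le.trans ht⟩
  have hpt : ∀ x, ‖generator κ ψ (β r x + w r x) x‖ ≤ A * (2 * C) * (1 + ‖x‖) + d * B := by
    intro x
    have e1 : ‖β r x + w r x‖ ≤ 2 * C * (1 + ‖x‖) := by
      have := norm_add_le (β r x) (w r x)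
      have := h.growth r x
      have := h.bound r x
      have : 0 ≤ (C : ℝ) * ‖x‖ := by positivity
      linarith
    have e2 := hψ.abs_apply_le x (β r x + w r x)
    have e3 : |κ * Laplacian.laplacian ψ x| ≤ 1 * (d * B) := by
      rw [abs_mul]
      exact mul_le_mul hκ (hψ.abs_laplacian_le x) (abs_nonneg _) zero_le_one
    have e4 : (A : ℝ) * ‖β r x + w r x‖ ≤ A * (2 * C * (1 + ‖x‖)) := by gcongr
    rw [Real.norm_eq_abs, generator]
    refine (abs_add_le _ _).trans ?_
    linarith
  have hI : Integrable (fun x => A * (2 * C) * (1 + ‖x‖)) (μ r).meas :=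
    ((integrable_const _).add (integrable_norm _)).const_mul _
  rw [← Real.norm_eq_abs]
  refine (norm_integral_le_of_norm_le (g := fun x => A * (2 * C) * (1 + ‖x‖) + d * B)
    (hI.add (integrable_const _)) (ae_of_all _ hpt)).trans ?_
  rw [integral_add hI (integrable_const _), integral_const_mul]
  simp only [integral_const, probReal_univ, smul_eq_mul, one_mul]
  have := integral_linear_le (h.moment r hrT)
  gcongr

/-- Equicontinuity in time, for the Wasserstein distance, of the regular solutions. -/
lemma exists_W2_modulus (d : ℕ) (T : ℝ) (L C K : ℝ≥0) {θ : ℝ} (hθ : 0 < θ) :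
    ∃ τ : ℝ, 0 < τ ∧ ∀ (κ : ℝ) (β w : ℝ → Rd d → Rd d) (μ : ℝ → P2 d), |κ| ≤ 1 →
      IsRegularSolution T κ L C K β w μ → ∀ s t, 0 ≤ s → s ≤ t → t ≤ T → t - s ≤ τ →
      W2 (μ t) (μ s) < ENNReal.ofReal θ := by
  obtain ⟨n, f, ρ, hρ, hf, hfc, hW⟩ := exists_test_functions_W2_le d K
    (η := (θ / 2).toNNReal) (by simpa using hθ)
  choose A B hAB using fun i => exists_isTestFunction (hf i) (hfc i)
  set M : ℝ := ∑ i, ((A i : ℝ) * (2 * C) * (2 + K) + d * B i) with hM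
  have hM0 : 0 ≤ M := Finset.sum_nonneg fun i _ => by positivity
  refine ⟨ρ / (M + 1), by positivity, fun κ β w μ hκ h s t hs hst ht hτ => ?_⟩
  refine (hW (μ t) (μ s) (h.moment t ⟨hs.trans hst, ht⟩) (h.moment s ⟨hs, hst.trans ht⟩)
    fun i => ?_).trans_lt ?_
  · refine (h.abs_integral_sub_le hκ (hAB i) hs hst ht).trans ?_
    have h1 : (A i : ℝ) * (2 * C) * (2 + K) + d * B i ≤ M :=
      Finset.single_le_sum (f := fun i => (A i : ℝ) * (2 * C) * (2 + K) + d * B i)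
        (fun i _ => by positivity) (Finset.mem_univ i)
    calc _ ≤ (M + 1) * (ρ / (M + 1)) := by
          refine mul_le_mul (by linarith) hτ (by linarith) (by positivity)
      _ = ρ := by field_simp
  · exact (ENNReal.ofReal_lt_ofReal_iff hθ).2 (by linarith)

end TestFunctions

/-! ### Consistency of one Euler step. -/

section EulerStep

variable {d : ℕ} {T κ δ : ℝ} {L C K : ℝ≥0} {β w u : ℝ → Rd d → Rd d} {μ : ℝ → P2 d}

/-- Bounds on a velocity field `β + u` used in the Euler scheme. -/
structure IsEulerVelocity (L C : ℝ≥0) (β u : ℝ → Rd d → Rd d) : Prop where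
  measurable_β : Measurable (Function.uncurry β)
  measurable_u : Measurable (Function.uncurry u)
  lipschitz : ∀ t, LipschitzWith L (β t)
  growth : ∀ t x, ‖β t x‖ ≤ C * (1 + ‖x‖)
  bound : ∀ t x, ‖u t x‖ ≤ C
  continuous_u : ∀ t, Continuous (u t)

lemma IsRegularSolution.isEulerVelocity (h : IsRegularSolution T κ L C K β w μ) :
    IsEulerVelocity L C β w :=
  ⟨h.measurable_β, h.measurable_w, h.lipschitz, h.growth, h.bound, h.continuous_w⟩

/-- The mollified velocity field. -/
def mollVelocity (δ : ℝ) (β u : ℝ → Rd d → Rd d) (s : ℝ) (x : Rd d) : Rd d :=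
  mollify δ (β s) x + mollify δ (u s) x

/-- The displacement over a time step of the Euler scheme. -/
def displacement (δ : ℝ) (β u : ℝ → Rd d → Rd d) (a b : ℝ) : Rd d → Rd d :=
  mollify δ fun y => ∫ s in a..b, (β s y + u s y)

namespace IsEulerVelocity

lemma norm_mollVelocity_le (h : IsEulerVelocity L C β u) (hδ : 0 < δ) (hδ1 : δ ≤ 1) (s : ℝ)
    (x : Rd d) : ‖mollVelocity δ β u s x‖ ≤ 3 * C * (1 + ‖x‖) := by
  have h1 : ‖mollify δ (β s) x‖ ≤ C * (1 + ‖x‖ + 1) := by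
    refine norm_mollify_le hδ (h.lipschitz s).continuous fun z hz => (h.growth s _).trans ?_
    exact mul_le_mul_of_nonneg_left (by linarith [norm_sub_le x z]) C.coe_nonneg
  have h2 : ‖mollify δ (u s) x‖ ≤ C :=
    norm_mollify_le hδ (h.continuous_u s) fun z _ => h.bound s _
  have h3 : 0 ≤ (C : ℝ) * ‖x‖ := by positivity
  refine (norm_add_le _ _).trans ?_
  linarith

lemma norm_mollVelocity_sub_le (h : IsEulerVelocity L C β u) (hδ : 0 < δ) (s : ℝ) (x y : Rd d) :
    ‖mollVelocity δ β u s x - mollVelocity δ β u s y‖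
      ≤ (L + kernelVariation d δ * C) * ‖x - y‖ := by
  have h1 := (lipschitzWith_mollify hδ (h.lipschitz s)).norm_sub_le x y
  have h2 := (lipschitzWith_mollify_of_bounded hδ (h.continuous_u s) (h.bound s)).norm_sub_le x y
  rw [mollVelocity, mollVelocity, add_sub_add_comm, add_mul]
  refine (norm_add_le _ _).trans (add_le_add h1 ?_)
  simpa using h2

lemma stronglyMeasurable_mollVelocity (h : IsEulerVelocity L C β u) :
    StronglyMeasurable (Function.uncurry (mollVelocity δ β u)) :=
  (stronglyMeasurable_mollify h.measurable_β).add (stronglyMeasurable_mollify h.measurable_u)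

lemma continuous_mollVelocity (h : IsEulerVelocity L C β u) (hδ : 0 < δ) (s : ℝ) :
    Continuous (mollVelocity δ β u s) :=
  (contDiff_mollify hδ (h.lipschitz s).continuous).continuous.add
    (contDiff_mollify hδ (h.continuous_u s)).continuous

lemma displacement_eq (h : IsEulerVelocity L C β u) (hδ : 0 < δ) (a b : ℝ) (x : Rd d) :
    displacement δ β u a b x = ∫ s in a..b, mollVelocity δ β u s x := by
  rw [displacement, mollify_intervalIntegral hδ (h.measurable_β.add h.measurable_u) (C := 2 * C)]
  · congr 1 with s : 1
    exact mollify_add hδ (h.lipschitz s).continuous (h.continuous_u s) x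
  · intro t y
    have h1 := norm_add_le (β t y) (u t y)
    have h2 := h.growth t y
    have h3 := h.bound t y
    have h4 : 0 ≤ (C : ℝ) * ‖y‖ := by positivity
    linarith

lemma intervalIntegrable_mollVelocity (h : IsEulerVelocity L C β u) (hδ : 0 < δ) (hδ1 : δ ≤ 1)
    (a b : ℝ) (x : Rd d) : IntervalIntegrable (fun s => mollVelocity δ β u s x) volume a b := by
  refine (intervalIntegrable_const (c := 3 * (C : ℝ) * (1 + ‖x‖))).mono_fun ?_
    (ae_of_all _ fun s => ?_)
  · exact (h.stronglyMeasurable_mollVelocity.comp_measurable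
      (measurable_id.prodMk measurable_const)).aestronglyMeasurable
  · rw [Real.norm_of_nonneg (by positivity)]
    exact h.norm_mollVelocity_le hδ hδ1 s x

lemma norm_displacement_le (h : IsEulerVelocity L C β u) (hδ : 0 < δ) (hδ1 : δ ≤ 1) {a b : ℝ}
    (hab : a ≤ b) (x : Rd d) :
    ‖displacement δ β u a b x‖ ≤ 3 * C * (1 + ‖x‖) * (b - a) := by
  rw [h.displacement_eq hδ]
  refine (intervalIntegral.norm_integral_le_of_norm_le_const
    fun s _ => h.norm_mollVelocity_le hδ hδ1 s x).trans ?_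
  rw [abs_of_nonneg (by linarith)]

lemma continuous_displacement (h : IsEulerVelocity L C β u) (hδ : 0 < δ) (hδ1 : δ ≤ 1) (a b : ℝ) :
    Continuous (displacement δ β u a b) := by
  refine LipschitzWith.continuous (K := (L + kernelVariation d δ * C) * ‖b - a‖₊)
    (LipschitzWith.of_dist_le_mul fun x y => ?_)
  rw [dist_eq_norm, dist_eq_norm, h.displacement_eq hδ, h.displacement_eq hδ,
    ← intervalIntegral.integral_sub (h.intervalIntegrable_mollVelocity hδ hδ1 a b x)
      (h.intervalIntegrable_mollVelocity hδ hδ1 a b y)]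
  refine (intervalIntegral.norm_integral_le_of_norm_le_const
    fun s _ => h.norm_mollVelocity_sub_le hδ s x y).trans (le_of_eq ?_)
  push_cast
  rw [Real.norm_eq_abs]
  ring

end IsEulerVelocity

/-- Exactly the form of Lipschitz bound required to replace `μ_s` by `μ_a` within a step at a cost
proportional to their `W2` distance. The constant depends on `δ` but not on the Lipschitz constant
of the control. -/
lemma IsTestFunction.abs_mollVelocity_sub_le {A B : ℝ≥0} {ψ : Rd d → ℝ} (hψ : IsTestFunction A B ψ)
    (h : IsEulerVelocity L C β u) (hδ : 0 < δ) (hδ1 : δ ≤ 1) (s : ℝ) (x y : Rd d) :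
    |fderiv ℝ ψ x (mollVelocity δ β u s x) - fderiv ℝ ψ y (mollVelocity δ β u s y)|
      ≤ (3 * C * B + A * (L + kernelVariation d δ * C)) * (1 + ‖x‖) * ‖x - y‖ := by
  set g := mollVelocity δ β u s
  have e : fderiv ℝ ψ x (g x) - fderiv ℝ ψ y (g y)
      = (fderiv ℝ ψ x - fderiv ℝ ψ y) (g x) + fderiv ℝ ψ y (g x - g y) := by
    simp
  have h1 : |(fderiv ℝ ψ x - fderiv ℝ ψ y) (g x)| ≤ B * ‖x - y‖ * (3 * C * (1 + ‖x‖)) :=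
    ((fderiv ℝ ψ x - fderiv ℝ ψ y).le_opNorm _).trans
      (mul_le_mul (hψ.lipschitz.norm_sub_le x y) (h.norm_mollVelocity_le hδ hδ1 s x)
        (norm_nonneg _) (by positivity))
  have h2 : |fderiv ℝ ψ y (g x - g y)| ≤ A * ((L + kernelVariation d δ * C) * ‖x - y‖) :=
    (hψ.abs_apply_le _ _).trans
      (mul_le_mul_of_nonneg_left (h.norm_mollVelocity_sub_le hδ s x y) A.coe_nonneg)
  rw [e]
  refine (abs_add_le _ _).trans ((add_le_add h1 h2).trans ?_)
  have h3 : 0 ≤ (A : ℝ) * (L + kernelVariation d δ * C) * ‖x‖ * ‖x - y‖ := by positivity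
  linarith

lemma IsTestFunction.integrable_mollVelocity {A B : ℝ≥0} {ψ : Rd d → ℝ}
    (hψ : IsTestFunction A B ψ) (h : IsEulerVelocity L C β u) (hδ : 0 < δ) (hδ1 : δ ≤ 1) (s : ℝ)
    (ν : P2 d) : Integrable (fun x => fderiv ℝ ψ x (mollVelocity δ β u s x)) ν.meas := by
  refine integrable_of_norm_le_linear ν
    (hψ.continuous_fderiv.clm_apply (h.continuous_mollVelocity hδ s)).aestronglyMeasurable
    (c := A * (3 * C)) fun x => ?_
  refine (hψ.abs_apply_le _ _).trans ?_
  rw [mul_assoc]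
  exact mul_le_mul_of_nonneg_left (h.norm_mollVelocity_le hδ hδ1 s x) A.coe_nonneg

/-- Three errors: the viscous term, the mollification of the Lipschitz part, costing `L δ`, and that
of the control, which is small only on the ball and leaves a tail. -/
lemma IsRegularSolution.abs_generator_sub_le (h : IsRegularSolution T κ L C K β w μ) {A B : ℝ≥0}
    {ψ : Rd d → ℝ} (hψ : IsTestFunction A B ψ) (hδ : 0 < δ) (hδ1 : δ ≤ 1) {r n : ℝ} (hr : 0 < r)
    (hn : 0 ≤ n) {s : ℝ} (hs : s ∈ Icc 0 T)
    (hintg : Integrable (fun x => generator κ ψ (β s x + w s x) x) (μ s).meas)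
    (hw : ∀ x, ‖x‖ ≤ r → ‖mollify δ (w s) x - w s x‖ ≤ n) :
    |∫ x, generator κ ψ (β s x + w s x) x ∂(μ s).meas
        - ∫ x, fderiv ℝ ψ x (mollVelocity δ β w s x) ∂(μ s).meas|
      ≤ (|κ| * (d * B) + A * (L * δ + n)) + A * (2 * C) * K / r ^ 4 := by
  rw [← integral_sub hintg (hψ.integrable_mollVelocity h.isEulerVelocity hδ hδ1 s _)]
  have hpt : ∀ x, |generator κ ψ (β s x + w s x) x - fderiv ℝ ψ x (mollVelocity δ β w s x)|
      ≤ |κ| * (d * B) + A * (L * δ + ‖mollify δ (w s) x - w s x‖) := by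
    intro x
    have e : generator κ ψ (β s x + w s x) x - fderiv ℝ ψ x (mollVelocity δ β w s x)
        = κ * Laplacian.laplacian ψ x
          - fderiv ℝ ψ x ((mollify δ (β s) x - β s x) + (mollify δ (w s) x - w s x)) := by
      simp only [generator, mollVelocity, map_add, map_sub]
      ring
    rw [e]
    refine (abs_sub _ _).trans (add_le_add ?_ ((hψ.abs_apply_le _ _).trans ?_))
    · rw [abs_mul]
      exact mul_le_mul_of_nonneg_left (hψ.abs_laplacian_le x) (abs_nonneg _)
    · refine mul_le_mul_of_nonneg_left ((norm_add_le _ _).trans (add_le_add ?_ le_rfl)) A.coe_nonneg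
      exact norm_mollify_sub_self_le hδ (h.lipschitz s) x
  refine norm_integral_le_of_tail (h.moment s hs) hr (by positivity)
    (fun x hx => (hpt x).trans ?_) fun x => (hpt x).trans ?_
  · have := hw x hx
    gcongr
  · have h1 : ‖mollify δ (w s) x - w s x‖ ≤ 2 * C := by
      have := norm_mollify_le hδ (h.continuous_w s) (x := x) fun z _ => h.bound s _
      linarith [norm_sub_le (mollify δ (w s) x) (w s x), h.bound s x]
    have h2 : (A : ℝ) * ‖mollify δ (w s) x - w s x‖ ≤ A * (2 * C) := by gcongr
    have h3 : 0 ≤ (A : ℝ) * n := by positivity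
    linarith

lemma IsTestFunction.abs_integral_comp_add_sub_le {A B : ℝ≥0} {ψ : Rd d → ℝ}
    (hψ : IsTestFunction A B ψ) {ν : P2 d} (hν : ∫⁻ x, ‖x‖ₑ ^ 4 ∂ν.meas ≤ K) {V : Rd d → Rd d}
    (hV : Continuous V) {c : ℝ} (hVc : ∀ x, ‖V x‖ ≤ c * (1 + ‖x‖))
    (hi : Integrable (fun x => ψ (x + V x)) ν.meas) :
    |∫ x, ψ (x + V x) ∂ν.meas - ∫ x, ψ x ∂ν.meas - ∫ x, fderiv ℝ ψ x (V x) ∂ν.meas|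
      ≤ B * c ^ 2 * (4 * (1 + K)) := by
  have h4 := integrable_norm_pow_four hν
  have hi2 : Integrable (fun x => fderiv ℝ ψ x (V x)) ν.meas := by
    refine integrable_of_norm_le_linear ν (hψ.continuous_fderiv.clm_apply hV).aestronglyMeasurable
      (c := A * c) fun x => (hψ.abs_apply_le _ _).trans ?_
    rw [mul_assoc]
    exact mul_le_mul_of_nonneg_left (hVc x) A.coe_nonneg
  have hi3 : Integrable (fun x => ψ (x + V x) - ψ x) ν.meas := hi.sub (hψ.integrable ν)
  rw [← integral_sub hi (hψ.integrable ν), ← integral_sub hi3 hi2, ← Real.norm_eq_abs]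
  have hpt : ∀ x, ‖ψ (x + V x) - ψ x - fderiv ℝ ψ x (V x)‖
      ≤ B * c ^ 2 * (4 * (1 + ‖x‖ ^ 4)) := by
    intro x
    refine (hψ.taylor x (V x)).trans ?_
    rw [mul_assoc]
    refine mul_le_mul_of_nonneg_left ?_ B.coe_nonneg
    calc ‖V x‖ ^ 2 ≤ (c * (1 + ‖x‖)) ^ 2 := by gcongr; exact hVc x
      _ = c ^ 2 * (1 + ‖x‖) ^ 2 := by ring
      _ ≤ c ^ 2 * (4 * (1 + ‖x‖ ^ 4)) := by
          gcongr
          nlinarith [sq_nonneg (‖x‖ - 1), sq_nonneg (‖x‖ ^ 2 - 1)]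
  have hI : Integrable (fun x : Rd d => 1 + ‖x‖ ^ 4) ν.meas := (integrable_const _).add h4
  refine (norm_integral_le_of_norm_le ((hI.const_mul 4).const_mul (B * c ^ 2))
    (ae_of_all _ hpt)).trans ?_
  rw [integral_const_mul, integral_const_mul, integral_add (integrable_const _) h4]
  simp only [integral_const, probReal_univ, smul_eq_mul, one_mul]
  have := integral_norm_pow_four_le hν
  gcongr

lemma IsTestFunction.stronglyMeasurable_mollVelocity {A B : ℝ≥0} {ψ : Rd d → ℝ}
    (hψ : IsTestFunction A B ψ) (h : IsEulerVelocity L C β u) :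
    StronglyMeasurable fun p : ℝ × Rd d => fderiv ℝ ψ p.2 (mollVelocity δ β u p.1 p.2) := by
  have h1 : Continuous fun q : (Rd d →L[ℝ] ℝ) × Rd d => q.1 q.2 := isBoundedBilinearMap_apply.continuous
  exact h1.comp_stronglyMeasurable
    ((hψ.continuous_fderiv.comp_stronglyMeasurable measurable_snd.stronglyMeasurable).prodMk
      h.stronglyMeasurable_mollVelocity)

lemma IsTestFunction.intervalIntegral_integral_mollVelocity {A B : ℝ≥0} {ψ : Rd d → ℝ}
    (hψ : IsTestFunction A B ψ) (h : IsEulerVelocity L C β u) (hδ : 0 < δ) (hδ1 : δ ≤ 1)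
    (a b : ℝ) (ν : P2 d) :
    ∫ s in a..b, ∫ x, fderiv ℝ ψ x (mollVelocity δ β u s x) ∂ν.meas
      = ∫ x, fderiv ℝ ψ x (displacement δ β u a b x) ∂ν.meas := by
  have hm := hψ.stronglyMeasurable_mollVelocity h (δ := δ)
  rw [intervalIntegral_integral_swap]
  · congr 1 with x
    rw [h.displacement_eq hδ]
    exact (fderiv ℝ ψ x).intervalIntegral_comp_comm (h.intervalIntegrable_mollVelocity hδ hδ1 a b x)
  · have : IsFiniteMeasure (volume.restrict (uIoc a b)) := ⟨by simp [uIoc]⟩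
    have hI : Integrable (fun x : Rd d => A * (3 * C * (1 + ‖x‖))) ν.meas :=
      (((integrable_const _).add (integrable_norm ν)).const_mul _).const_mul _
    refine Integrable.mono' (hI.comp_snd (volume.restrict (uIoc a b))) hm.aestronglyMeasurable
      (ae_of_all _ fun p => ?_)
    exact (hψ.abs_apply_le _ _).trans
      (mul_le_mul_of_nonneg_left (h.norm_mollVelocity_le hδ hδ1 p.1 p.2) A.coe_nonneg)

/-- Consistency of one step of the Euler scheme. -/
lemma IsRegularSolution.abs_euler_step_le (h : IsRegularSolution T κ L C K β w μ)
    (hu : IsEulerVelocity L C β u) {A B : ℝ≥0} {ψ : Rd d → ℝ} (hψ : IsTestFunction A B ψ)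
    (hδ : 0 < δ) (hδ1 : δ ≤ 1) {a b : ℝ} (ha : 0 ≤ a) (hab : a ≤ b) (hb : b ≤ T) {θ r ζ : ℝ}
    (hθ : 0 < θ) (hr : 0 < r) (hζ : 0 ≤ ζ) {n : ℝ → ℝ} (hn : IntegrableOn n (Ioo 0 T))
    (hn0 : ∀ s, 0 ≤ n s)
    (hw : ∀ᵐ s ∂(volume.restrict (Ioo 0 T)), ∀ x, ‖x‖ ≤ r → ‖mollify δ (w s) x - w s x‖ ≤ n s)
    (hWθ : ∀ s ∈ Icc a b, W2 (μ s) (μ a) < ENNReal.ofReal θ)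
    (hZ : ∀ x, ‖x‖ ≤ r → ‖∫ s in a..b, (mollify δ (w s) x - mollify δ (u s) x)‖ ≤ ζ)
    (hcomp : Integrable (fun x => ψ (x + displacement δ β u a b x)) (μ a).meas) :
    |∫ x, ψ x ∂(μ b).meas - ∫ x, ψ (x + displacement δ β u a b x) ∂(μ a).meas|
      ≤ A * (∫ s in a..b, n s) + A * ζ + (b - a) * (|κ| * (d * B) + A * (L * δ)
        + A * (4 * C) * K / r ^ 4
        + (3 * C * B + A * (L + kernelVariation d δ * C)) * θ * (4 + K)
        + B * (3 * C) ^ 2 * (4 * (1 + K)) * (b - a)) := by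
  have haT : a ∈ Icc 0 T := ⟨ha, hab.trans hb⟩
  -- Error per unit of time caused by viscosity, mollification, tails and freezing the measure at
  -- time `a`.
  set c₁ : ℝ := |κ| * (d * B) + A * (L * δ) + A * (2 * C) * K / r ^ 4
        + (3 * C * B + A * (L + kernelVariation d δ * C)) * θ * (4 + K) with hc₁
  have hn' : IntervalIntegrable n volume a b := by
    rw [intervalIntegrable_iff_integrableOn_Ioo_of_le hab]
    exact hn.mono_set (Ioo_subset_Ioo ha hb)
  -- the increment of the solution against the frozen mollified velocity
  have h1 : |(∫ x, ψ x ∂(μ b).meas - ∫ x, ψ x ∂(μ a).meas)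
      - ∫ x, fderiv ℝ ψ x (displacement δ β w a b x) ∂(μ a).meas|
      ≤ A * (∫ s in a..b, n s) + (b - a) * c₁ := by
    have hGi : IntervalIntegrable (fun s => ∫ x, generator κ ψ (β s x + w s x) x ∂(μ s).meas)
        volume a b :=
      (h.sol.intervalIntegrable ψ hψ.contDiff hψ.hasCompactSupport).mono_set
        (by rw [uIcc_of_le hab, uIcc_of_le (haT.1.trans haT.2)]; exact Icc_subset_Icc ha hb)
    have hHi : IntervalIntegrable (fun s => ∫ x, fderiv ℝ ψ x (mollVelocity δ β w s x) ∂(μ a).meas)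
        volume a b := by
      have hm := hψ.stronglyMeasurable_mollVelocity h.isEulerVelocity (δ := δ)
      refine (intervalIntegrable_const (c := A * (3 * (C : ℝ)) * (2 + K))).mono_fun
        hm.integral_prod_right.aestronglyMeasurable (ae_of_all _ fun s => ?_)
      rw [Real.norm_of_nonneg (r := A * (3 * (C : ℝ)) * (2 + K)) (by positivity)]
      have hI : Integrable (fun x : Rd d => A * (3 * (C : ℝ)) * (1 + ‖x‖)) (μ a).meas :=
        ((integrable_const _).add (integrable_norm _)).const_mul _
      refine (norm_integral_le_of_norm_le hI (ae_of_all _ fun x => ?_)).trans ?_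
      · refine (hψ.abs_apply_le _ _).trans ?_
        rw [mul_assoc]
        exact mul_le_mul_of_nonneg_left (h.isEulerVelocity.norm_mollVelocity_le hδ hδ1 s x) A.coe_nonneg
      · rw [integral_const_mul]
        exact mul_le_mul_of_nonneg_left (integral_linear_le (h.moment a haT)) (by positivity)
    rw [h.sol.eq ψ hψ.contDiff hψ.hasCompactSupport a haT b ⟨ha.trans hab, hb⟩,
      ← hψ.intervalIntegral_integral_mollVelocity h.isEulerVelocity hδ hδ1,
      ← intervalIntegral.integral_sub hGi hHi, ← Real.norm_eq_abs]
    have hei : IntervalIntegrable (fun s => A * n s + c₁) volume a b :=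
      (hn'.const_mul _).add intervalIntegrable_const
    refine (intervalIntegral.norm_integral_le_of_norm_le hab ?_ hei).trans (le_of_eq ?_)
    · rw [← ae_restrict_iff' measurableSet_Ioc, ← restrict_Ioo_eq_restrict_Ioc]
      filter_upwards [ae_restrict_Ioo_mono hw ha hb, ae_restrict_mem measurableSet_Ioo,
        ae_restrict_Ioo_mono (h.sol.integrable ψ hψ.contDiff hψ.hasCompactSupport) ha hb]
        with s hs hsab hsi
      have hsT : s ∈ Icc 0 T := ⟨ha.trans hsab.1.le, hsab.2.le.trans hb⟩
      have e1 := h.abs_generator_sub_le hψ hδ hδ1 hr (hn0 s) hsT hsi hs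
      have e2 := abs_integral_sub_le_of_W2_lt (h.moment s hsT) hθ
        (hWθ s (Ioo_subset_Icc_self hsab)) (by positivity)
        (hψ.integrable_mollVelocity h.isEulerVelocity hδ hδ1 s (μ s))
        (hψ.integrable_mollVelocity h.isEulerVelocity hδ hδ1 s (μ a))
        (hψ.abs_mollVelocity_sub_le h.isEulerVelocity hδ hδ1 s)
      rw [Real.norm_eq_abs]
      refine (abs_sub_le _ _ _).trans ((add_le_add e1 e2).trans (le_of_eq ?_))
      rw [hc₁]
      ring
    · rw [intervalIntegral.integral_add (hn'.const_mul _) intervalIntegrable_const,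
        intervalIntegral.integral_const_mul, intervalIntegral.integral_const, smul_eq_mul]
  -- replacing the control by the limit control
  have hdc : ∀ {v : ℝ → Rd d → Rd d}, IsEulerVelocity L C β v →
      Continuous (displacement δ β v a b) ∧
      Integrable (fun x => fderiv ℝ ψ x (displacement δ β v a b x)) (μ a).meas := by
    intro v hv
    have hcont := hv.continuous_displacement hδ hδ1 a b
    refine ⟨hcont, ?_⟩
    refine integrable_of_norm_le_linear _
      (hψ.continuous_fderiv.clm_apply hcont).aestronglyMeasurable
      (c := A * (3 * C * (b - a))) fun x => (hψ.abs_apply_le _ _).trans ?_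
    have := mul_le_mul_of_nonneg_left (hv.norm_displacement_le hδ hδ1 hab x) A.coe_nonneg
    calc _ ≤ _ := this
      _ = _ := by ring
  have h2 : |∫ x, fderiv ℝ ψ x (displacement δ β w a b x) ∂(μ a).meas
      - ∫ x, fderiv ℝ ψ x (displacement δ β u a b x) ∂(μ a).meas|
      ≤ A * ζ + A * (2 * C * (b - a)) * K / r ^ 4 := by
    rw [← integral_sub (hdc h.isEulerVelocity).2 (hdc hu).2]
    have hpt : ∀ x, |fderiv ℝ ψ x (displacement δ β w a b x)
        - fderiv ℝ ψ x (displacement δ β u a b x)|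
        ≤ A * ‖∫ s in a..b, (mollify δ (w s) x - mollify δ (u s) x)‖ := by
      intro x
      rw [← map_sub, h.isEulerVelocity.displacement_eq hδ, hu.displacement_eq hδ,
        ← intervalIntegral.integral_sub
          (h.isEulerVelocity.intervalIntegrable_mollVelocity hδ hδ1 a b x)
          (hu.intervalIntegrable_mollVelocity hδ hδ1 a b x)]
      simp only [mollVelocity, add_sub_add_left_eq_sub]
      exact hψ.abs_apply_le _ _
    refine norm_integral_le_of_tail (h.moment a haT) hr
      (mul_nonneg A.coe_nonneg (mul_nonneg (by positivity) (by linarith)))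
      (fun x hx => (hpt x).trans (mul_le_mul_of_nonneg_left (hZ x hx) A.coe_nonneg))
      fun x => (hpt x).trans ?_
    have h5 : ‖∫ s in a..b, (mollify δ (w s) x - mollify δ (u s) x)‖ ≤ 2 * C * (b - a) := by
      refine (intervalIntegral.norm_integral_le_of_norm_le_const (C := 2 * C)
        fun s _ => ?_).trans (by rw [abs_of_nonneg (by linarith)])
      have e1 := norm_mollify_le hδ (h.continuous_w s) (x := x) fun z _ => h.bound s _
      have e2 := norm_mollify_le hδ (hu.continuous_u s) (x := x) fun z _ => hu.bound s _
      linarith [norm_sub_le (mollify δ (w s) x) (mollify δ (u s) x)]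
    have h6 := mul_le_mul_of_nonneg_left h5 A.coe_nonneg
    have h7 : 0 ≤ (A : ℝ) * ζ := by positivity
    linarith
  have h3 := hψ.abs_integral_comp_add_sub_le (h.moment a haT) (hdc hu).1
    (c := 3 * C * (b - a))
    (fun x => (hu.norm_displacement_le hδ hδ1 hab x).trans (le_of_eq (by ring))) hcomp
  set P := ∫ x, ψ x ∂(μ b).meas
  set Q := ∫ x, ψ x ∂(μ a).meas
  set X := ∫ x, fderiv ℝ ψ x (displacement δ β w a b x) ∂(μ a).meas
  set Y := ∫ x, fderiv ℝ ψ x (displacement δ β u a b x) ∂(μ a).meas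
  set Z := ∫ x, ψ (x + displacement δ β u a b x) ∂(μ a).meas
  -- Weak formulation with frozen data, exchange of the control, then Taylor expansion of `ψ` at the
  -- displaced point. The constant `4 C` collects the two tails `2 C` of the first two differences.
  have e : P - Z = (P - Q - X) + (X - Y) - (Z - Q - Y) := by ring
  calc |P - Z| ≤ |P - Q - X| + |X - Y| + |Z - Q - Y| := by
        rw [e]
        exact (abs_sub _ _).trans (add_le_add (abs_add_le _ _) le_rfl)
    _ ≤ _ := (add_le_add (add_le_add h1 h2) h3).trans (le_of_eq (by rw [hc₁]; ring))

end EulerStep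

/-! ### Iterating the scheme: consistency over many steps and stability. -/

section EulerScheme

variable {d : ℕ} {T κ δ : ℝ} {L C K Cu : ℝ≥0} {β β' w u : ℝ → Rd d → Rd d} {μ : ℝ → P2 d}

lemma IsEulerVelocity.lipschitzWith_integral (h : IsEulerVelocity L C β u)
    (huL : ∀ t, LipschitzWith Cu (u t)) {a b : ℝ} {τ : ℝ≥0} (hτ : b - a = τ) :
    LipschitzWith ((L + Cu) * τ) fun y => ∫ s in a..b, (β s y + u s y) := by
  have hintg : ∀ y, IntervalIntegrable (fun s => β s y + u s y) volume a b := by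
    intro y
    refine (intervalIntegrable_const (c := C * (1 + ‖y‖) + C)).mono_fun ?_ (ae_of_all _ fun s => ?_)
    · exact ((h.measurable_β.add h.measurable_u).comp
        (measurable_id.prodMk measurable_const)).aestronglyMeasurable
    · rw [Real.norm_of_nonneg (r := C * (1 + ‖y‖) + C) (by positivity)]
      exact (norm_add_le _ _).trans (add_le_add (h.growth s y) (h.bound s y))
  refine LipschitzWith.of_dist_le_mul fun x y => ?_
  rw [dist_eq_norm, dist_eq_norm, ← intervalIntegral.integral_sub (hintg x) (hintg y)]
  refine (intervalIntegral.norm_integral_le_of_norm_le_const (C := (L + Cu) * ‖x - y‖)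
    fun s _ => ?_).trans (le_of_eq ?_)
  · rw [add_sub_add_comm, add_mul]
    exact (norm_add_le _ _).trans
      (add_le_add ((h.lipschitz s).norm_sub_le x y) ((huL s).norm_sub_le x y))
  · rw [hτ, abs_of_nonneg τ.coe_nonneg]
    push_cast
    ring

/-- The Euler scheme with time step `τ`. -/
def eulerFlow (δ : ℝ) (β u : ℝ → Rd d → Rd d) (τ : ℝ) : ℕ → Rd d → Rd d
  | 0 => id
  | k + 1 => fun x => eulerFlow δ β u τ k x
      + displacement δ β u (k * τ) ((k + 1 : ℕ) * τ) (eulerFlow δ β u τ k x)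

lemma step_sub (k : ℕ) (τ : ℝ≥0) : ((k + 1 : ℕ) : ℝ) * τ - k * τ = τ := by
  push_cast
  ring

lemma step_le (k : ℕ) (τ : ℝ≥0) : (k : ℝ) * τ ≤ ((k + 1 : ℕ) : ℝ) * τ := by
  have := step_sub k τ
  linarith [τ.coe_nonneg]

lemma IsEulerVelocity.continuous_eulerFlow (h : IsEulerVelocity L C β u) (hδ : 0 < δ) (hδ1 : δ ≤ 1)
    (τ : ℝ) (k : ℕ) : Continuous (eulerFlow δ β u τ k) := by
  induction k with
  | zero => exact continuous_id
  | succ k ih => exact ih.add ((h.continuous_displacement hδ hδ1 _ _).comp ih)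

lemma IsEulerVelocity.norm_eulerFlow_le (h : IsEulerVelocity L C β u) (hδ : 0 < δ) (hδ1 : δ ≤ 1)
    (τ : ℝ≥0) (k : ℕ) (x : Rd d) :
    1 + ‖eulerFlow δ β u τ k x‖ ≤ (1 + 3 * C * τ) ^ k * (1 + ‖x‖) := by
  induction k with
  | zero => simp [eulerFlow]
  | succ k ih =>
    have h1 := h.norm_displacement_le hδ hδ1 (step_le k τ) (eulerFlow δ β u τ k x)
    rw [step_sub] at h1
    have h2 := norm_add_le (eulerFlow δ β u τ k x)
      (displacement δ β u (k * τ) ((k + 1 : ℕ) * τ) (eulerFlow δ β u τ k x))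
    calc 1 + ‖eulerFlow δ β u τ (k + 1) x‖
        ≤ (1 + 3 * C * τ) * (1 + ‖eulerFlow δ β u τ k x‖) := by
          rw [eulerFlow]
          linarith
      _ ≤ (1 + 3 * C * τ) * ((1 + 3 * C * τ) ^ k * (1 + ‖x‖)) := by gcongr
      _ = _ := by ring

/-- Consistency of the Euler scheme with a regular solution. -/
lemma IsRegularSolution.abs_eulerFlow_le (h : IsRegularSolution T κ L C K β w μ)
    (hu : IsEulerVelocity L C β u) (huL : ∀ t, LipschitzWith Cu (u t)) (hδ : 0 < δ) (hδ1 : δ ≤ 1)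
    {τ : ℝ≥0} {N : ℕ} (hN : (N : ℝ) * τ ≤ T) {ℓ : ℝ≥0} (hℓ : ℓ = (L + Cu) * τ) (hℓ2 : ℓ ≤ 1 / 2)
    {θ r ζ : ℝ} (hθ : 0 < θ) (hr : 0 < r) (hζ : 0 ≤ ζ) {n : ℝ → ℝ} (hn : IntegrableOn n (Ioo 0 T))
    (hn0 : ∀ s, 0 ≤ n s)
    (hw : ∀ᵐ s ∂(volume.restrict (Ioo 0 T)), ∀ x, ‖x‖ ≤ r → ‖mollify δ (w s) x - w s x‖ ≤ n s)
    (hWθ : ∀ k < N, ∀ s ∈ Icc ((k : ℝ) * τ) ((k + 1 : ℕ) * τ),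
      W2 (μ s) (μ (k * τ)) < ENNReal.ofReal θ)
    (hZ : ∀ k < N, ∀ x, ‖x‖ ≤ r →
      ‖∫ s in ((k : ℝ) * τ)..((k + 1 : ℕ) * τ), (mollify δ (w s) x - mollify δ (u s) x)‖ ≤ ζ)
    {A' B' : ℝ≥0} {k : ℕ} (hk : k ≤ N) {A B : ℝ≥0} {ψ : Rd d → ℝ} (hψ : IsTestFunction A B ψ)
    (hA : A * (1 + ℓ) ^ k ≤ A')
    (hB : (1 + ℓ) ^ (2 * k) * (B + k * A' * (kernelVariation d δ * ℓ)) ≤ B') :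
    |∫ x, ψ x ∂(μ (k * τ)).meas - ∫ x, ψ (eulerFlow δ β u τ k x) ∂(μ 0).meas|
      ≤ A' * (∫ s in (0 : ℝ)..(k * τ), n s) + k * (A' * ζ) + k * τ * (|κ| * (d * B')
        + A' * (L * δ) + A' * (4 * C) * K / r ^ 4
        + (3 * C * B' + A' * (L + kernelVariation d δ * C)) * θ * (4 + K)
        + B' * (3 * C) ^ 2 * (4 * (1 + K)) * τ) := by
  -- The last step is peeled off: `ψ` is tested at the end of it, and its pullback through that step
  -- is tested at the previous time. The test function therefore changes along the induction, while
  -- `A'` and `B'` bound all its pullbacks.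
  induction k generalizing A B ψ with
  | zero => simp [eulerFlow]
  | succ k ih =>
    set E : ℝ := |κ| * (d * B')
        + A' * (L * δ) + A' * (4 * C) * K / r ^ 4
        + (3 * C * B' + A' * (L + kernelVariation d δ * C)) * θ * (4 + K)
        + B' * (3 * C) ^ 2 * (4 * (1 + K)) * τ
    have h1ℓ : ∀ j : ℕ, 1 ≤ (1 + ℓ) ^ j := fun j => one_le_pow₀ le_self_add
    have hAA' : A ≤ A' := le_trans (le_mul_of_one_le_right' (h1ℓ _)) hA
    have hBB' : B ≤ B' := by
      refine le_trans ?_ hB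
      exact le_trans le_self_add (le_mul_of_one_le_left' (h1ℓ _))
    -- The step is a mollified map with Lipschitz constant `ℓ`, so each pullback multiplies the
    -- gradient bound by `1 + ℓ` and changes the second bound `B` into `B (1 + ℓ)² + A *
    -- kernelVariation * ℓ`.
    have hW := hu.lipschitzWith_integral huL (step_sub k τ)
    rw [← hℓ] at hW
    have hcomp := hψ.comp_add (contDiff_mollify hδ hW.continuous) (lipschitzWith_mollify hδ hW)
      (lipschitzWith_fderiv_mollify hδ hW) hℓ2
    have hkN : k < N := hk
    have hkT : ((k + 1 : ℕ) : ℝ) * τ ≤ T := by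
      refine le_trans ?_ hN
      gcongr
    have hstep := h.abs_euler_step_le hu (hψ.mono hAA' hBB') hδ hδ1 (a := k * τ)
      (b := (k + 1 : ℕ) * τ) (by positivity) (step_le k τ) hkT hθ hr hζ hn hn0 hw (hWθ k hkN)
      (hZ k hkN) (hcomp.integrable _)
    rw [step_sub] at hstep
    have hrec := ih hkN.le hcomp (by
      refine le_trans (le_of_eq ?_) hA
      ring) (by
      refine le_trans ?_ hB
      calc (1 + ℓ) ^ (2 * k) * (B * (1 + ℓ) ^ 2 + A * (kernelVariation d δ * ℓ)
            + k * A' * (kernelVariation d δ * ℓ))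
          ≤ (1 + ℓ) ^ (2 * k) * (B * (1 + ℓ) ^ 2 + (A' * (kernelVariation d δ * ℓ)) * (1 + ℓ) ^ 2
            + (k * A' * (kernelVariation d δ * ℓ)) * (1 + ℓ) ^ 2) := by
            refine mul_le_mul_right (add_le_add (add_le_add le_rfl ?_) ?_) _
            · exact le_trans (by gcongr) (le_mul_of_one_le_right' (h1ℓ 2))
            · exact le_mul_of_one_le_right' (h1ℓ 2)
        _ = _ := by push_cast; ring)
    have hnI : ∀ {a b : ℝ}, 0 ≤ a → a ≤ b → b ≤ T → IntervalIntegrable n volume a b := by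
      intro a b ha hab hb
      rw [intervalIntegrable_iff_integrableOn_Ioo_of_le hab]
      exact hn.mono_set (Ioo_subset_Ioo ha hb)
    have hadd := intervalIntegral.integral_add_adjacent_intervals
      (hnI le_rfl (by positivity) ((step_le k τ).trans hkT) :
        IntervalIntegrable n volume 0 (k * τ))
      (hnI (by positivity) (step_le k τ) hkT)
    refine (abs_sub_le _ _ _).trans ((add_le_add hstep hrec).trans (le_of_eq ?_))
    rw [← hadd]
    push_cast
    ring

/-- Stability of the Euler scheme with respect to the velocity. -/
lemma IsEulerVelocity.norm_eulerFlow_sub_le (h : IsEulerVelocity L C β u)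
    (h' : IsEulerVelocity L C β' u) (huL : ∀ t, LipschitzWith Cu (u t)) (hδ : 0 < δ) (hδ1 : δ ≤ 1)
    {τ : ℝ≥0} {N : ℕ} (hN : (N : ℝ) * τ ≤ T) {M lam : ℝ} (hM : 0 ≤ M) (hlam : 0 < lam)
    (hβ : ∀ᵐ s ∂(volume.restrict (Ioo 0 T)), ∀ x, ‖β s x - β' s x‖ ≤ M * (lam * Real.exp (lam * s)))
    {k : ℕ} (hk : k ≤ N) (x : Rd d) :
    ‖eulerFlow δ β u τ k x - eulerFlow δ β' u τ k x‖
      ≤ (1 + (L + Cu) * τ) ^ k * (M * Real.exp (lam * (k * τ))) := by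
  induction k with
  | zero => simpa [eulerFlow] using hM
  | succ k ih =>
    have hkN : k < N := hk
    have ih := ih hkN.le
    have hkT : ((k + 1 : ℕ) : ℝ) * τ ≤ T := by
      refine le_trans ?_ hN
      gcongr
    set y := eulerFlow δ β u τ k x
    set y' := eulerFlow δ β' u τ k x
    set a : ℝ := k * τ
    set b : ℝ := (k + 1 : ℕ) * τ
    have hab : a ≤ b := step_le k τ
    have h1 : ‖displacement δ β' u a b y - displacement δ β' u a b y'‖
        ≤ (L + Cu) * τ * ‖y - y'‖ := by
      have := (lipschitzWith_mollify hδ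
        (h'.lipschitzWith_integral huL (step_sub k τ))).norm_sub_le y y'
      rwa [NNReal.coe_mul, NNReal.coe_add] at this
    -- The assumed bound is the derivative of `M exp(lam s)`, so the contributions of the steps
    -- telescope.
    have h2 : ‖displacement δ β u a b y - displacement δ β' u a b y‖
        ≤ M * Real.exp (lam * b) - M * Real.exp (lam * a) := by
      have hder : ∀ s ∈ uIcc a b, HasDerivAt (fun s => M * Real.exp (lam * s))
          (M * (lam * Real.exp (lam * s))) s := by
        intro s _
        have := ((hasDerivAt_id s).const_mul lam).exp.const_mul M
        simpa [mul_comm] using this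
      have hcont : IntervalIntegrable (fun s => M * (lam * Real.exp (lam * s))) volume a b :=
        Continuous.intervalIntegrable (by fun_prop) _ _
      rw [h.displacement_eq hδ, h'.displacement_eq hδ, ← intervalIntegral.integral_sub
        (h.intervalIntegrable_mollVelocity hδ hδ1 a b y)
        (h'.intervalIntegrable_mollVelocity hδ hδ1 a b y),
        ← intervalIntegral.integral_eq_sub_of_hasDerivAt hder hcont]
      refine intervalIntegral.norm_integral_le_of_norm_le hab ?_ hcont
      rw [← ae_restrict_iff' measurableSet_Ioc, ← restrict_Ioo_eq_restrict_Ioc]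
      filter_upwards [ae_restrict_Ioo_mono hβ (by positivity : 0 ≤ a) hkT] with s hs
      rw [mollVelocity, mollVelocity, add_sub_add_right_eq_sub,
        ← mollify_sub hδ (h.lipschitz s).continuous (h'.lipschitz s).continuous]
      exact norm_mollify_le hδ ((h.lipschitz s).continuous.sub (h'.lipschitz s).continuous)
        fun z _ => hs _
    have e : eulerFlow δ β u τ (k + 1) x - eulerFlow δ β' u τ (k + 1) x
        = (y - y') + (displacement δ β' u a b y - displacement δ β' u a b y')
          + (displacement δ β u a b y - displacement δ β' u a b y) := by
      simp only [eulerFlow]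
      abel
    have hexp : M * Real.exp (lam * a) ≤ M * Real.exp (lam * b) := by gcongr
    set q : ℝ := 1 + (L + Cu) * τ with hq
    have hq1 : 1 ≤ q := by
      have : 0 ≤ (L + Cu : ℝ) * τ := by positivity
      linarith
    have hqk : 1 ≤ q ^ (k + 1) := one_le_pow₀ hq1
    rw [e]
    calc _ ≤ ‖y - y'‖ + (L + Cu) * τ * ‖y - y'‖
          + (M * Real.exp (lam * b) - M * Real.exp (lam * a)) :=
          (norm_add_le _ _).trans (add_le_add ((norm_add_le _ _).trans (add_le_add le_rfl h1)) h2)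
      _ = q * ‖y - y'‖ + (M * Real.exp (lam * b) - M * Real.exp (lam * a)) := by rw [hq]; ring
      _ ≤ q * (q ^ k * (M * Real.exp (lam * a)))
          + q ^ (k + 1) * (M * Real.exp (lam * b) - M * Real.exp (lam * a)) := by
          gcongr
          exact le_mul_of_one_le_left (by linarith) hqk
      _ = _ := by ring

lemma one_add_pow_le_exp {c τ T : ℝ} (hc : 0 ≤ c) (hτ : 0 ≤ τ) {k : ℕ} (hk : k * τ ≤ T) :
    (1 + c * τ) ^ k ≤ Real.exp (c * T) := by
  calc (1 + c * τ) ^ k ≤ Real.exp (c * τ) ^ k := by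
        gcongr
        linarith [Real.add_one_le_exp (c * τ)]
    _ = Real.exp (c * (k * τ)) := by rw [← Real.exp_nat_mul]; ring_nf
    _ ≤ _ := by gcongr

lemma lintegral_pow_four_map_le {μ : P2 d} (hK : ∫⁻ x, ‖x‖ₑ ^ 4 ∂μ.meas ≤ K) {f : Rd d → Rd d}
    (hf : Measurable f) {c : ℝ≥0} (h : ∀ x, ‖f x‖ ≤ c * (1 + ‖x‖)) :
    ∫⁻ x, ‖x‖ₑ ^ 4 ∂(P2.map μ f hf c h).meas ≤ ((c ^ 4 * (8 * (1 + K)) : ℝ≥0) : ℝ≥0∞) := by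
  rw [P2.meas_map, lintegral_map (by fun_prop) hf]
  have hle : ∀ x, ‖f x‖ₑ ^ 4 ≤ (c : ℝ≥0∞) ^ 4 * (8 * (1 + ‖x‖ₑ ^ 4)) := by
    intro x
    have h1 : ‖f x‖₊ ≤ c * (1 + ‖x‖₊) := by exact_mod_cast h x
    have h2 : ‖f x‖₊ ^ 4 ≤ c ^ 4 * (8 * (1 + ‖x‖₊ ^ 4)) := by
      calc ‖f x‖₊ ^ 4 ≤ (c * (1 + ‖x‖₊)) ^ 4 := by gcongr
        _ = c ^ 4 * (1 + ‖x‖₊) ^ 4 := by ring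
        _ ≤ c ^ 4 * (2 ^ (4 - 1) * (1 ^ 4 + ‖x‖₊ ^ 4)) := by
            gcongr
            exact add_pow_le zero_le zero_le 4
        _ = _ := by norm_num
    have h3 : ((‖f x‖₊ ^ 4 : ℝ≥0) : ℝ≥0∞) ≤ ((c ^ 4 * (8 * (1 + ‖x‖₊ ^ 4)) : ℝ≥0) : ℝ≥0∞) := by
      exact_mod_cast h2
    simpa [enorm_eq_nnnorm] using h3
  calc ∫⁻ x, ‖f x‖ₑ ^ 4 ∂μ.meas ≤ ∫⁻ x, (c : ℝ≥0∞) ^ 4 * (8 * (1 + ‖x‖ₑ ^ 4)) ∂μ.meas :=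
        lintegral_mono hle
    _ = (c : ℝ≥0∞) ^ 4 * (8 * (1 + ∫⁻ x, ‖x‖ₑ ^ 4 ∂μ.meas)) := by
        rw [lintegral_const_mul _ (by fun_prop), lintegral_const_mul _ (by fun_prop),
          lintegral_add_left (by fun_prop)]
        simp
    _ ≤ _ := by
        push_cast
        gcongr

end EulerScheme

/-! ### Choice of the parameters of the scheme. -/

section EulerApproximation

variable {d : ℕ}

/-- Each of six error terms below receives the share `ρ/8`; adding `1` in the denominator covers a
vanishing coefficient. -/
lemma mul_div_eight_le {ρ y : ℝ} (hρ : 0 < ρ) (hy : 0 ≤ y) : y * (ρ / (8 * (y + 1))) ≤ ρ / 8 := by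
  rw [mul_div_assoc', div_le_div_iff₀ (by positivity) (by norm_num)]
  nlinarith

lemma mul_le_of_le_div_eight {ρ y z : ℝ} (hρ : 0 < ρ) (hy : 0 ≤ y) (hz : z ≤ ρ / (8 * (y + 1))) :
    y * z ≤ ρ / 8 :=
  (mul_le_mul_of_nonneg_left hz hy).trans (mul_div_eight_le hρ hy)

/-- Pullbacks through the whole scheme are test functions, so they may be used to exchange `μ 0` for
`μ₀`. -/
lemma IsTestFunction.comp_eulerFlow {A B L C Cu : ℝ≥0} {ψ : Rd d → ℝ} (hψ : IsTestFunction A B ψ)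
    {β u : ℝ → Rd d → Rd d} (hu : IsEulerVelocity L C β u) (huL : ∀ t, LipschitzWith Cu (u t))
    {δ : ℝ} (hδ : 0 < δ) {τ : ℝ≥0} (hτ : (L + Cu) * τ ≤ 1 / 2) (k : ℕ) :
    ∃ A' B', IsTestFunction A' B' fun x => ψ (eulerFlow δ β u τ k x) := by
  induction k generalizing A B ψ with
  | zero => exact ⟨A, B, hψ⟩
  | succ k ih =>
    have hW := hu.lipschitzWith_integral huL (step_sub k τ)
    exact ih (hψ.comp_add (contDiff_mollify hδ hW.continuous) (lipschitzWith_mollify hδ hW)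
      (lipschitzWith_fderiv_mollify hδ hW) hτ)

/-- The parameters of the Euler scheme can be chosen, depending only on bounds on the data, such
that the scheme approximates every regular solution within `η`. -/
lemma exists_euler_parameters (d : ℕ) {T : ℝ} (hT : 0 < T) (L C K Cu : ℝ≥0) {Nf : ℝ → ℝ}
    (hNf : ∀ r, 0 ≤ Nf r) {η : ℝ} (hη : 0 < η) :
    ∃ (r δ : ℝ) (τ : ℝ≥0) (N : ℕ) (κ₀ ζ : ℝ), 0 < r ∧ 0 < δ ∧ δ ≤ 1 ∧ (N : ℝ) * τ = T ∧ 0 < κ₀ ∧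
      0 < ζ ∧
      (∀ (κ : ℝ) (β w : ℝ → Rd d → Rd d) (μ : ℝ → P2 d), |κ| ≤ 1 →
        IsRegularSolution T κ L C K β w μ → ∀ s t, 0 ≤ s → s ≤ t → t ≤ T → t - s ≤ τ →
        W2 (μ t) (μ s) ≤ ENNReal.ofReal η) ∧
      ∀ (κ : ℝ) (β w u : ℝ → Rd d → Rd d) (μ : ℝ → P2 d) (μ₀ : P2 d), |κ| ≤ 1 → |κ| ≤ κ₀ →
        IsRegularSolution T κ L C K β w μ → IsEulerVelocity L C β u →
        (∀ t, LipschitzWith Cu (u t)) →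
        (∀ ψ : Rd d → ℝ, ContDiff ℝ ∞ ψ → HasCompactSupport ψ →
          ∫ x, ψ x ∂(μ 0).meas = ∫ x, ψ x ∂μ₀.meas) →
        ∫⁻ x, ‖x‖ₑ ^ 4 ∂μ₀.meas ≤ K →
        (∃ n : ℝ → ℝ, IntegrableOn n (Ioo 0 T) ∧ (∀ s, 0 ≤ n s) ∧ ∫ s in Ioo 0 T, n s ≤ Nf r ∧
          ∀ᵐ s ∂(volume.restrict (Ioo 0 T)), ∀ x, ‖x‖ ≤ r →
            ‖mollify δ (w s) x - w s x‖ ≤ √δ * n s) →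
        (∀ k < N, ∀ x, ‖x‖ ≤ r → ‖∫ s in ((k : ℝ) * τ)..((k + 1 : ℕ) * τ),
          (mollify δ (w s) x - mollify δ (u s) x)‖ ≤ ζ) →
        ∀ k ≤ N, ∃ ν : P2 d, ν.meas = μ₀.meas.map (eulerFlow δ β u τ k) ∧
          W2 (μ (k * τ)) ν ≤ ENNReal.ofReal η := by
  obtain ⟨c, hc⟩ : ∃ c : ℝ≥0, (c : ℝ) = Real.exp (3 * C * T) := ⟨⟨_, (Real.exp_pos _).le⟩, rfl⟩
  obtain ⟨n₀, f, ρ, hρ, hf, hfc, hW⟩ := exists_test_functions_W2_le d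
    (max K (c ^ 4 * (8 * (1 + K)))) (η := η.toNNReal) (by simpa using hη)
  choose A₁ B₁ hAB using fun i => exists_isTestFunction (hf i) (hfc i)
  obtain ⟨A₀, hA₀⟩ : ∃ A₀, ∀ i, A₁ i ≤ A₀ :=
    ⟨∑ i, A₁ i, fun i => Finset.single_le_sum (fun _ _ => zero_le) (Finset.mem_univ i)⟩
  obtain ⟨B₀, hB₀⟩ : ∃ B₀, ∀ i, B₁ i ≤ B₀ :=
    ⟨∑ i, B₁ i, fun i => Finset.single_le_sum (fun _ _ => zero_le) (Finset.mem_univ i)⟩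
  obtain ⟨X, hX⟩ : ∃ X : ℝ≥0, (X : ℝ) = Real.exp ((L + Cu) * T) := ⟨⟨_, (Real.exp_pos _).le⟩, rfl⟩
  obtain ⟨T', hT'⟩ : ∃ T' : ℝ≥0, (T' : ℝ) = T := ⟨⟨T, hT.le⟩, rfl⟩
  -- The gradient bound `A` of all pullbacks depends on neither `δ` nor `τ`, so it may fix the
  -- radius `r` and then `δ`. The second-order bound `B` involves the variation of the kernel and is
  -- fixed after `δ`. Then follow the freezing tolerance `θ`, the time step `τ`, and last the
  -- viscosity and control tolerances.
  obtain ⟨A, hA⟩ : ∃ A, A = A₀ * X := ⟨_, rfl⟩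
  have hA0 : (0 : ℝ) ≤ A := A.coe_nonneg
  obtain ⟨r, hrdef⟩ : ∃ r : ℝ, r = 8 * (T * (A * (4 * C) * K)) / ρ + 1 := ⟨_, rfl⟩
  have hr1 : 1 ≤ r := by
    have : 0 ≤ 8 * (T * (A * (4 * C) * K)) / ρ := by positivity
    linarith
  have hr0 : 0 < r := by linarith
  have htail : T * (A * (4 * C) * K / r ^ 4) ≤ ρ / 8 := by
    have h1 : 8 * (T * (A * (4 * C) * K)) ≤ r * ρ := by
      rw [hrdef, add_mul, div_mul_cancel₀ _ hρ.ne']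
      linarith
    have h2 : r ≤ r ^ 4 := le_self_pow₀ hr1 (by norm_num)
    rw [mul_div_assoc', div_le_div_iff₀ (by positivity) (by norm_num)]
    nlinarith
  obtain ⟨σ, hσ⟩ : ∃ σ : ℝ, σ = min 1 (ρ / (8 * (A * Nf r + T * (A * L) + 1))) := ⟨_, rfl⟩
  have hNr := hNf r
  have hσ0 : 0 < σ := hσ ▸ lt_min one_pos (by positivity)
  have hσ1 : σ ≤ 1 := hσ ▸ min_le_left _ _
  have hσ2 : (A * Nf r + T * (A * L)) * σ ≤ ρ / 8 :=
    mul_le_of_le_div_eight hρ (by positivity) (hσ ▸ min_le_right _ _)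
  -- With `δ = σ²` the Morrey error `√δ` is `σ`, and `δ ≤ σ` treats the Lipschitz part at the same
  -- rate.
  obtain ⟨δ, hδdef⟩ : ∃ δ : ℝ, δ = σ ^ 2 := ⟨_, rfl⟩
  have hδ0 : 0 < δ := hδdef ▸ by positivity
  have hδσ : δ ≤ σ := by rw [hδdef]; nlinarith
  have hδ1 : δ ≤ 1 := hδσ.trans hσ1
  have hsq : √δ = σ := by rw [hδdef, Real.sqrt_sq hσ0.le]
  obtain ⟨kv, hkv⟩ : ∃ kv, kv = kernelVariation d δ := ⟨_, rfl⟩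
  obtain ⟨B, hB⟩ : ∃ B, B = X ^ 2 * (B₀ + A * (kv * ((L + Cu) * T'))) := ⟨_, rfl⟩
  obtain ⟨θ, hθ⟩ : ∃ θ : ℝ, θ = min η (ρ / (8 * (T * ((3 * C * B + A * (L + kv * C)) * (4 + K))
    + 1))) := ⟨_, rfl⟩
  have hθ0 : 0 < θ := hθ ▸ lt_min hη (by positivity)
  have hθη : θ ≤ η := hθ ▸ min_le_left _ _
  have hθ2 : T * ((3 * C * B + A * (L + kv * C)) * (4 + K)) * θ ≤ ρ / 8 :=
    mul_le_of_le_div_eight hρ (by positivity) (hθ ▸ min_le_right _ _)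
  obtain ⟨τ₀, hτ₀, hmod⟩ := exists_W2_modulus d T L C K hθ0
  obtain ⟨Q, hQ⟩ : ∃ Q : ℝ, Q = T * (B * (3 * C) ^ 2 * (4 * (1 + K))) := ⟨_, rfl⟩
  have hQ0 : 0 ≤ Q := hQ ▸ by positivity
  obtain ⟨τ₁, hτ₁⟩ : ∃ τ₁ : ℝ, τ₁ = min τ₀ (min (1 / (2 * ((L + Cu : ℝ) + 1)))
    (ρ / (8 * (Q + 1)))) := ⟨_, rfl⟩
  have hτ₁0 : 0 < τ₁ := hτ₁ ▸ lt_min hτ₀ (lt_min (by positivity) (by positivity))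
  obtain ⟨N, hNdef⟩ : ∃ N : ℕ, N = ⌈T / τ₁⌉₊ + 1 := ⟨_, rfl⟩
  have hN0 : (0 : ℝ) < N := by rw [hNdef]; positivity
  obtain ⟨τ, hτ⟩ : ∃ τ : ℝ≥0, (τ : ℝ) = T / N := ⟨⟨T / N, by positivity⟩, rfl⟩
  have hNτ : (N : ℝ) * τ = T := by rw [hτ]; field_simp
  have hττ₁ : (τ : ℝ) ≤ τ₁ := by
    rw [hτ, div_le_iff₀ hN0, ← div_le_iff₀' hτ₁0, hNdef]
    push_cast
    linarith [Nat.le_ceil (T / τ₁)]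
  have hττ₀ : (τ : ℝ) ≤ τ₀ := hττ₁.trans (hτ₁ ▸ min_le_left _ _)
  have hτℓ : (τ : ℝ) ≤ 1 / (2 * ((L + Cu : ℝ) + 1)) :=
    hττ₁.trans (hτ₁ ▸ (min_le_right _ _).trans (min_le_left _ _))
  have hτQ : Q * τ ≤ ρ / 8 := mul_le_of_le_div_eight hρ hQ0
    (hττ₁.trans (hτ₁ ▸ (min_le_right _ _).trans (min_le_right _ _)))
  obtain ⟨κ₀, hκ₀⟩ : ∃ κ₀ : ℝ, κ₀ = ρ / (8 * (T * (d * B) + 1)) := ⟨_, rfl⟩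
  obtain ⟨ζ, hζ⟩ : ∃ ζ : ℝ, ζ = ρ / (8 * (N * A + 1)) := ⟨_, rfl⟩
  have hζ0 : 0 < ζ := hζ ▸ by positivity
  refine ⟨r, δ, τ, N, κ₀, ζ, hr0, hδ0, hδ1, hNτ, hκ₀ ▸ by positivity, hζ0, ?_, ?_⟩
  · intro κ β w μ hκ h s t hs hst ht hts
    exact (hmod κ β w μ hκ h s t hs hst ht (hts.trans hττ₀)).le.trans
      (ENNReal.ofReal_le_ofReal hθη)
  intro κ β w u μ μ₀ hκ hκκ₀ h hu huL hstart hμ₀ ⟨n, hn, hn0, hnN, hw⟩ hZ k hk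
  have hkτ : (k : ℝ) * τ ≤ T := by
    rw [← hNτ]
    gcongr
  have hgrow : ∀ x, ‖eulerFlow δ β u τ k x‖ ≤ c * (1 + ‖x‖) := by
    intro x
    have h1 := hu.norm_eulerFlow_le hδ0 hδ1 τ k x
    have h2 := one_add_pow_le_exp (c := 3 * C) (by positivity) τ.coe_nonneg hkτ
    rw [← hc] at h2
    have h3 : (1 + 3 * C * τ : ℝ) ^ k * (1 + ‖x‖) ≤ c * (1 + ‖x‖) := by gcongr
    linarith
  have hmeas := (hu.continuous_eulerFlow hδ0 hδ1 τ k).measurable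
  refine ⟨P2.map μ₀ _ hmeas c hgrow, P2.meas_map .., ?_⟩
  have hℓ2 : (L + Cu) * τ ≤ 1 / 2 := by
    rw [← NNReal.coe_le_coe]
    push_cast
    have : (L + Cu : ℝ) * τ ≤ (L + Cu + 1) * (1 / (2 * ((L + Cu : ℝ) + 1))) := by
      exact mul_le_mul (by linarith) hτℓ τ.coe_nonneg (by positivity)
    refine this.trans (le_of_eq ?_)
    field_simp
  have hpow : (1 + (L + Cu) * τ) ^ k ≤ X := by
    rw [← NNReal.coe_le_coe]
    push_cast
    rw [hX]
    exact one_add_pow_le_exp (by positivity) τ.coe_nonneg hkτ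
  refine (hW _ _ ((h.moment _ ⟨by positivity, hkτ⟩).trans (by exact_mod_cast le_max_left _ _))
    ((lintegral_pow_four_map_le hμ₀ hmeas hgrow).trans (by exact_mod_cast le_max_right _ _))
    fun i => ?_).trans le_rfl
  -- The parameters `A` and `B` dominate the constants of all pullbacks because `(1 + (L + Cu) τ)^k
  -- ≤ X` and `k τ ≤ T`.
  have hmain := h.abs_eulerFlow_le hu huL hδ0 hδ1 hNτ.le rfl hℓ2 hθ0 hr0 hζ0.le
    (hn.const_mul √δ) (fun s => mul_nonneg (Real.sqrt_nonneg _) (hn0 s)) hw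
    (fun k hk s hs => hmod κ β w μ hκ h _ _ (by positivity) hs.1 (hs.2.trans (by
      rw [← hNτ]
      have : k + 1 ≤ N := hk
      gcongr)) (by linarith [step_sub k τ, hs.2])) hZ (A' := A) (B' := B) hk (hAB i) (by
      rw [hA]
      exact mul_le_mul' (hA₀ i) hpow) (by
      rw [hB, mul_comm 2 k, pow_mul, ← hkv]
      have hkT' : (k : ℝ≥0) * τ ≤ T' := by
        rw [← NNReal.coe_le_coe]
        push_cast
        rw [hT']
        exact hkτ
      refine mul_le_mul' (by gcongr) (add_le_add (hB₀ i) ?_)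
      calc (k : ℝ≥0) * A * (kv * ((L + Cu) * τ)) = A * (kv * ((L + Cu) * (k * τ))) := by ring
        _ ≤ _ := by gcongr)
  rw [P2.meas_map, integral_map hmeas.aemeasurable (hf i).continuous.aestronglyMeasurable]
  have hcs : ∫ x, f i (eulerFlow δ β u τ k x) ∂(μ 0).meas
      = ∫ x, f i (eulerFlow δ β u τ k x) ∂μ₀.meas := by
    obtain ⟨A', B', h'⟩ := (hAB i).comp_eulerFlow hu huL hδ0 hℓ2 k
    exact hstart _ h'.contDiff h'.hasCompactSupport
  rw [hcs] at hmain
  refine hmain.trans ?_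
  have hI : ∫ s in (0 : ℝ)..(k * τ), √δ * n s ≤ σ * Nf r := by
    rw [intervalIntegral.integral_const_mul, hsq]
    refine mul_le_mul_of_nonneg_left (le_trans ?_ hnN) hσ0.le
    rw [intervalIntegral.integral_of_le (by positivity), ← integral_Ioc_eq_integral_Ioo]
    exact setIntegral_mono_set ((integrableOn_Ioc_iff_integrableOn_Ioo).2 hn)
      (ae_of_all _ hn0) (Ioc_subset_Ioc_right hkτ).eventuallyLE
  have hκB : T * (d * B) * |κ| ≤ ρ / 8 :=
    mul_le_of_le_div_eight hρ (by positivity) (hκκ₀.trans hκ₀.le)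
  have hζN : N * A * ζ ≤ ρ / 8 := mul_le_of_le_div_eight hρ (by positivity) hζ.le
  rw [← hkv]
  calc _ ≤ A * (σ * Nf r) + N * (A * ζ) + T * (|κ| * (d * B) + A * (L * σ) + A * (4 * C) * K / r ^ 4
        + (3 * C * B + A * (L + kv * C)) * θ * (4 + K) + B * (3 * C) ^ 2 * (4 * (1 + K)) * τ) := by
        gcongr
    _ = (A * Nf r + T * (A * L)) * σ + N * A * ζ + T * (d * B) * |κ|
        + T * (A * (4 * C) * K / r ^ 4) + T * ((3 * C * B + A * (L + kv * C)) * (4 + K)) * θ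
        + Q * τ := by
        rw [hQ]
        ring
    _ ≤ ρ := by linarith

end EulerApproximation

/-! ### Grönwall argument for two solutions approximated with the same control. -/

section Stability

variable {d : ℕ} {T : ℝ}

lemma lintegral_sq_le_of_pow_four {μ : P2 d} {K : ℝ≥0} (h : ∫⁻ x, ‖x‖ₑ ^ 4 ∂μ.meas ≤ K) :
    ∫⁻ x, ‖x‖ₑ ^ 2 ∂μ.meas ≤ 1 + K := by
  have : IsProbabilityMeasure μ.meas := μ.1.2
  calc ∫⁻ x, ‖x‖ₑ ^ 2 ∂μ.meas ≤ ∫⁻ x, (1 + ‖x‖ₑ ^ 4) ∂μ.meas := by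
        refine lintegral_mono fun x => ?_
        rcases le_total ‖x‖ₑ 1 with hx | hx
        · exact (pow_le_one₀ (zero_le) hx).trans le_self_add
        · exact (pow_le_pow_right₀ hx (by norm_num)).trans le_add_self
    _ = 1 + ∫⁻ x, ‖x‖ₑ ^ 4 ∂μ.meas := by
        rw [lintegral_add_left measurable_const]
        simp
    _ ≤ 1 + K := by gcongr

/-- The product plan gives a crude finite bound, needed to absorb a supremum of distances into
itself. -/
lemma W2_le_of_moment {μ ν : P2 d} {K : ℝ≥0} (hμ : ∫⁻ x, ‖x‖ₑ ^ 4 ∂μ.meas ≤ K)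
    (hν : ∫⁻ x, ‖x‖ₑ ^ 4 ∂ν.meas ≤ K) :
    W2 μ ν ≤ (2 * ((1 + K : ℝ≥0∞) + (1 + K))) ^ (1 / 2 : ℝ) := by
  have h1 : IsProbabilityMeasure μ.meas := μ.1.2
  have h2 : IsProbabilityMeasure ν.meas := ν.1.2
  have hplan : μ.meas.prod ν.meas ∈ transportPlans μ ν := by
    constructor <;> simp
  have h := lintegral_prod_dist_sq_le (m₁ := μ.meas) (m₂ := ν.meas) (by simp)
  rw [measure_univ, inv_one, one_mul] at h
  refine (W2_le_of_mem_transportPlans hplan).trans (ENNReal.rpow_le_rpow (h.trans ?_) (by norm_num))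
  gcongr
  · exact lintegral_sq_le_of_pow_four hμ
  · exact lintegral_sq_le_of_pow_four hν

/-- Two solutions that are both approximated within `η` by Euler schemes with the same control
stay close. -/
lemma W2_le_of_eulerFlow_approx (hT : 0 < T) {L C K Cu : ℝ≥0} {β β' u : ℝ → Rd d → Rd d}
    {μ μ' : ℝ → P2 d} {μ₀ : P2 d} (hu : IsEulerVelocity L C β u) (hu' : IsEulerVelocity L C β' u)
    (huL : ∀ t, LipschitzWith Cu (u t)) {δ η : ℝ} (hδ : 0 < δ) (hδ1 : δ ≤ 1) (hη : 0 ≤ η) {τ : ℝ≥0}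
    {N : ℕ} (hN : (N : ℝ) * τ = T)
    (hK : ∀ t ∈ Icc 0 T, ∫⁻ x, ‖x‖ₑ ^ 4 ∂(μ t).meas ≤ K)
    (hK' : ∀ t ∈ Icc 0 T, ∫⁻ x, ‖x‖ₑ ^ 4 ∂(μ' t).meas ≤ K)
    (hβ : ∀ᵐ s ∂(volume.restrict (Ioo 0 T)), ∀ x, ‖β s x - β' s x‖ₑ ≤ L * W2 (μ s) (μ' s))
    (hmod : ∀ s t, 0 ≤ s → s ≤ t → t ≤ T → t - s ≤ τ → W2 (μ t) (μ s) ≤ ENNReal.ofReal η)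
    (hmod' : ∀ s t, 0 ≤ s → s ≤ t → t ≤ T → t - s ≤ τ → W2 (μ' t) (μ' s) ≤ ENNReal.ofReal η)
    (happ : ∀ k ≤ N, ∃ ν : P2 d, ν.meas = μ₀.meas.map (eulerFlow δ β u τ k) ∧
      W2 (μ (k * τ)) ν ≤ ENNReal.ofReal η)
    (happ' : ∀ k ≤ N, ∃ ν : P2 d, ν.meas = μ₀.meas.map (eulerFlow δ β' u τ k) ∧
      W2 (μ' (k * τ)) ν ≤ ENNReal.ofReal η) {t : ℝ} (ht : t ∈ Icc 0 T) :
    W2 (μ t) (μ' t)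
      ≤ ENNReal.ofReal (8 * η * Real.exp ((2 * Real.exp ((L + Cu) * T) * L + 1) * T)) := by
  obtain ⟨X, hX⟩ : ∃ X, X = Real.exp ((L + Cu) * T) := ⟨_, rfl⟩
  have hX0 : 0 < X := hX ▸ Real.exp_pos _
  rw [← hX]
  -- The rate is chosen so that `X L / lam ≤ 1/2`: in the supremum weighted by `exp(-lam t)` the
  -- feedback of the nonlocal velocity is a contraction.
  obtain ⟨lam, hlam⟩ : ∃ lam : ℝ, lam = 2 * X * L + 1 := ⟨_, rfl⟩
  rw [← hlam]
  have hlam0 : 0 < lam := hlam ▸ by positivity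
  obtain ⟨S, hS⟩ : ∃ S, S = ⨆ t ∈ Icc (0 : ℝ) T, ENNReal.ofReal (Real.exp (-(lam * t))) *
    W2 (μ t) (μ' t) := ⟨_, rfl⟩
  have hS_ne : S ≠ ⊤ := by
    refine ne_top_of_le_ne_top (b := (2 * ((1 + K : ℝ≥0∞) + (1 + K))) ^ (1 / 2 : ℝ)) ?_ ?_
    · exact ENNReal.rpow_ne_top_of_nonneg (by norm_num) (by finiteness)
    · rw [hS]
      refine iSup₂_le fun t ht => ?_
      refine (mul_le_of_le_one_left zero_le ?_).trans (W2_le_of_moment (hK t ht) (hK' t ht))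
      rw [ENNReal.ofReal_le_one, Real.exp_le_one_iff]
      have := mul_nonneg hlam0.le ht.1
      linarith
  obtain ⟨s, hs⟩ : ∃ s, s = S.toReal := ⟨_, rfl⟩
  have hs0 : 0 ≤ s := hs ▸ ENNReal.toReal_nonneg
  have hSs : S = ENNReal.ofReal s := by rw [hs, ENNReal.ofReal_toReal hS_ne]
  have hexp : ∀ t, Real.exp (lam * t) * Real.exp (-(lam * t)) = 1 := fun t => by
    rw [← Real.exp_add, add_neg_cancel, Real.exp_zero]
  have hbound : ∀ t ∈ Icc 0 T, W2 (μ t) (μ' t) ≤ ENNReal.ofReal (s * Real.exp (lam * t)) := by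
    intro t ht
    have h1 : ENNReal.ofReal (Real.exp (-(lam * t))) * W2 (μ t) (μ' t) ≤ S :=
      hS ▸ le_iSup₂ (f := fun t (_ : t ∈ Icc (0 : ℝ) T) =>
        ENNReal.ofReal (Real.exp (-(lam * t))) * W2 (μ t) (μ' t)) t ht
    calc W2 (μ t) (μ' t) = ENNReal.ofReal (Real.exp (lam * t)) *
          (ENNReal.ofReal (Real.exp (-(lam * t))) * W2 (μ t) (μ' t)) := by
          rw [← mul_assoc, ← ENNReal.ofReal_mul (Real.exp_pos _).le, hexp, ENNReal.ofReal_one,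
            one_mul]
      _ ≤ ENNReal.ofReal (Real.exp (lam * t)) * ENNReal.ofReal s := by
          rw [← hSs]
          gcongr
      _ = _ := by rw [← ENNReal.ofReal_mul (Real.exp_pos _).le, mul_comm]
  have hτ0 : (0 : ℝ) < τ := by
    rcases τ.coe_nonneg.eq_or_lt with h | h
    · rw [← h, mul_zero] at hN
      exact absurd hN hT.ne
    · exact h
  have hflow : ∀ k ≤ N, ∀ x, ‖eulerFlow δ β u τ k x - eulerFlow δ β' u τ k x‖
      ≤ s / 2 * Real.exp (lam * (k * τ)) := by
    intro k hk x
    have hkτ : (k : ℝ) * τ ≤ T := by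
      rw [← hN]
      gcongr
    refine (hu.norm_eulerFlow_sub_le hu' huL hδ hδ1 hN.le (M := L * s / lam) (by positivity) hlam0
      ?_ hk x).trans ?_
    · filter_upwards [hβ, ae_restrict_mem measurableSet_Ioo] with r hr hrT x
      have h1 : ‖β r x - β' r x‖ₑ ≤ ENNReal.ofReal (L * (s * Real.exp (lam * r))) := by
        rw [ENNReal.ofReal_mul L.coe_nonneg, ENNReal.ofReal_coe_nnreal]
        refine (hr x).trans ?_
        gcongr
        exact hbound r ⟨hrT.1.le, hrT.2.le⟩
      rw [← ofReal_norm, ENNReal.ofReal_le_ofReal_iff (by positivity)] at h1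
      refine h1.trans (le_of_eq ?_)
      field_simp
    · have h1 : (1 + (L + Cu) * τ : ℝ) ^ k ≤ X :=
        hX ▸ one_add_pow_le_exp (by positivity) τ.coe_nonneg hkτ
      have h2 : X * (L * s / lam) ≤ s / 2 := by
        rw [mul_div_assoc', div_le_div_iff₀ hlam0 two_pos, hlam]
        nlinarith
      calc _ ≤ X * (L * s / lam * Real.exp (lam * (k * τ))) := by gcongr
        _ = X * (L * s / lam) * Real.exp (lam * (k * τ)) := by ring
        _ ≤ _ := by gcongr
  -- Between the two solutions at time `t` lie the grid time before `t` and the two schemes. The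
  -- four errors `η` are a time shift and an Euler error for each solution.
  have hstep : ∀ t ∈ Icc 0 T, W2 (μ t) (μ' t)
      ≤ ENNReal.ofReal (4 * η + s / 2 * Real.exp (lam * t)) := by
    intro t ht
    obtain ⟨k, hk⟩ : ∃ k, k = ⌊t / τ⌋₊ := ⟨_, rfl⟩
    have hkt : (k : ℝ) * τ ≤ t := by
      rw [← le_div_iff₀ hτ0, hk]
      exact Nat.floor_le (div_nonneg ht.1 hτ0.le)
    have htk : t - k * τ ≤ τ := by
      have := Nat.lt_floor_add_one (t / τ)
      rw [← hk, div_lt_iff₀ hτ0] at this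
      linarith
    have hkN : k ≤ N := by
      have : (k : ℝ) * τ ≤ N * τ := by rw [hN]; exact hkt.trans ht.2
      exact_mod_cast le_of_mul_le_mul_right this hτ0
    have hk0 : (0 : ℝ) ≤ k * τ := by positivity
    obtain ⟨ν, hν, hνη⟩ := happ k hkN
    obtain ⟨ν', hν', hνη'⟩ := happ' k hkN
    have hνν' : W2 ν ν' ≤ ENNReal.ofReal (s / 2 * Real.exp (lam * t)) := by
      have : IsProbabilityMeasure μ₀.meas := μ₀.1.2
      refine (W2_le_of_map_eq (hu.continuous_eulerFlow hδ hδ1 τ k).measurable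
        (hu'.continuous_eulerFlow hδ hδ1 τ k).measurable hν.symm hν'.symm).trans ?_
      calc _ ≤ (∫⁻ _, ENNReal.ofReal (s / 2 * Real.exp (lam * t)) ^ 2 ∂μ₀.meas) ^ (1 / 2 : ℝ) := by
            refine ENNReal.rpow_le_rpow (lintegral_mono fun x => ?_) (by norm_num)
            refine pow_le_pow_left' ?_ 2
            rw [← ofReal_norm]
            refine ENNReal.ofReal_le_ofReal ((hflow k hkN x).trans ?_)
            gcongr
        _ = _ := by
            rw [lintegral_const, measure_univ, mul_one, ← ENNReal.rpow_natCast, ← ENNReal.rpow_mul]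
            norm_num
    have h1 := hmod _ t hk0 hkt ht.2 htk
    have h2 := hmod' _ t hk0 hkt ht.2 htk
    rw [W2_comm] at h2 hνη'
    calc W2 (μ t) (μ' t) ≤ W2 (μ t) (μ (k * τ)) + (W2 (μ (k * τ)) ν + (W2 ν ν'
          + (W2 ν' (μ' (k * τ)) + W2 (μ' (k * τ)) (μ' t)))) := by
          refine (W2_triangle _ (μ (k * τ)) _).trans (add_le_add le_rfl ?_)
          refine (W2_triangle _ ν _).trans (add_le_add le_rfl ?_)
          refine (W2_triangle _ ν' _).trans (add_le_add le_rfl ?_)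
          exact W2_triangle _ _ _
      _ ≤ ENNReal.ofReal η + (ENNReal.ofReal η + (ENNReal.ofReal (s / 2 * Real.exp (lam * t))
          + (ENNReal.ofReal η + ENNReal.ofReal η))) := by gcongr
      _ = _ := by
          rw [← ENNReal.ofReal_add hη hη, ← ENNReal.ofReal_add (by positivity) (by positivity),
            ← ENNReal.ofReal_add (by positivity) (by positivity),
            ← ENNReal.ofReal_add (by positivity) (by positivity)]
          congr 1
          ring
  -- The weighted supremum satisfies `s ≤ 4η + s/2`, and it is finite.
  have hs8 : s ≤ 8 * η := by
    have h1 : S ≤ ENNReal.ofReal (4 * η + s / 2) := by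
      rw [hS]
      refine iSup₂_le fun t ht => ?_
      refine (mul_le_mul_right (hstep t ht) _).trans ?_
      rw [← ENNReal.ofReal_mul (Real.exp_pos _).le]
      refine ENNReal.ofReal_le_ofReal ?_
      have h2 : Real.exp (-(lam * t)) ≤ 1 := by
        rw [Real.exp_le_one_iff]
        have := mul_nonneg hlam0.le ht.1
        linarith
      have h3 : Real.exp (-(lam * t)) * (4 * η) ≤ 4 * η := mul_le_of_le_one_left (by positivity) h2
      calc _ = Real.exp (-(lam * t)) * (4 * η)
            + s / 2 * (Real.exp (lam * t) * Real.exp (-(lam * t))) := by ring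
        _ ≤ _ := by
            rw [hexp]
            linarith
    rw [hSs, ENNReal.ofReal_le_ofReal_iff (by positivity)] at h1
    linarith
  refine (hbound t ht).trans (ENNReal.ofReal_le_ofReal ?_)
  have := ht.2
  gcongr

end Stability

/-! ### Reparametrisation of the viscosity and the conclusion. -/

section Conclusion

variable {d : ℕ} {T : ℝ}

/-- Used with `ε ↦ min ε 1`, so that the bounds valid for viscosity at most `1` hold for every
positive `ε` without changing the limit. -/
lemma WeakConvergence.comp {p : ℝ≥0∞} [Fact (1 ≤ p)] {uε : ℝ → ℝ → Rd d → Rd d}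
    {u : ℝ → Rd d → Rd d} (h : WeakConvergence T p uε u) {g : ℝ → ℝ}
    (hg : Tendsto g (𝓝[>] 0) (𝓝[>] 0)) (hg0 : ∀ ε, 0 < ε → 0 < g ε) :
    WeakConvergence T p (fun ε => uε (g ε)) u := by
  intro r hr
  refine Exists.elim (h r hr) fun vε H => Exists.elim H fun v H => ?_
  exact ⟨fun ε => vε (g ε), v, fun ε hε => H.1 (g ε) (hg0 ε hε), H.2.1, H.2.2.comp hg⟩

lemma tendsto_min_one_nhdsGT_zero : Tendsto (fun ε : ℝ => min ε 1) (𝓝[>] 0) (𝓝[>] 0) := by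
  refine tendsto_nhdsWithin_of_tendsto_nhds_of_eventually_within _ ?_ ?_
  · have : Tendsto (fun ε : ℝ => min ε 1) (𝓝 0) (𝓝 (min 0 1)) :=
      (continuous_id.min continuous_const).tendsto 0
    rw [min_eq_left zero_le_one] at this
    exact this.mono_left nhdsWithin_le_nhds
  · filter_upwards [self_mem_nhdsWithin] with ε hε
    exact lt_min (mem_Ioi.1 hε) one_pos

end Conclusion

end VanishingViscosity

end

theorem mainTheorem5 {d : ℕ} {T : ℝ} (hT : 0 < T)
    {U : Set (Rd d)} (hU_compact : IsCompact U) (hU_convex : Convex ℝ U)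
    {b : ℝ → Rd d → P2 d → Rd d} (hb : IsVelocityField T b)
    {μ₀ : P2 d} (hμ₀ : IsCompact μ₀.meas.support)
    {uε : ℝ → ℝ → Rd d → Rd d} {u : ℝ → Rd d → Rd d}
    (huε : ∀ ε, 0 < ε → IsLipschitzControl T U (uε ε))
    (hu : IsLipschitzControl T U u)
    (hconv : ∀ (p : ℝ≥0∞) [Fact (1 ≤ p)], 1 < p → p < ⊤ → WeakConvergence T p uε u)
    {με : ℝ → ℝ → P2 d} {μ : ℝ → P2 d}
    (hμε : ∀ ε, 0 < ε → IsWeakSolution T ε b (uε ε) μ₀ (με ε))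
    (hμ : IsWeakSolution T 0 b u μ₀ μ) :
    Tendsto (fun ε => ⨆ t ∈ Ioo 0 T, W2 (με ε t) (μ t)) (𝓝[>] 0) (𝓝 0) := by
  obtain ⟨L, hL⟩ := hb.lipschitz
  obtain ⟨C, K, hK, hrep⟩ := exists_regular_representation hT hU_compact hb hμ₀ hL
  obtain ⟨β, w, Cu, hR, hwL, hae, hstart⟩ := hrep 0 u μ (by simp) hu hμ
  have hmin : ∀ ε : ℝ, 0 < ε → |min ε 1| ≤ 1 := fun ε hε => by
    rw [abs_of_pos (lt_min hε one_pos)]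
    exact min_le_right _ _
  have hrepε := fun ε (hε : 0 < ε) => hrep (min ε 1) (uε (min ε 1)) (με (min ε 1)) (hmin ε hε)
    (huε _ (lt_min hε one_pos)) (hμε _ (lt_min hε one_pos))
  choose! βε wε Cε hRε hwLε haeε hstartε using hrepε
  have hp1 : 1 < ENNReal.ofReal (2 * d + 2) := by
    rw [← ENNReal.ofReal_one, ENNReal.ofReal_lt_ofReal_iff (by positivity)]
    have : (0 : ℝ) ≤ d := d.cast_nonneg
    linarith
  have : Fact (1 ≤ ENNReal.ofReal (2 * d + 2)) := ⟨hp1.le⟩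
  have hweak : WeakConvergence T (ENNReal.ofReal (2 * d + 2)) wε w :=
    ((hconv _ hp1 ENNReal.ofReal_lt_top).comp tendsto_min_one_nhdsGT_zero
      fun ε hε => lt_min hε one_pos).congr (fun ε hε => (haeε ε hε).mono fun t ht => ht.2)
      (hae.mono fun t ht => ht.2)
  -- The Sobolev ball has radius `|r| + 2`, which leaves room for `‖x‖ ≤ r` and any scale `δ ≤ 1`.
  choose Nf hNf0 hNf using fun r : ℝ => exists_mollify_sub_bound hT rfl hweak
    (fun ε hε => (hRε ε hε).continuous_w) (R := |r| + 2) (by positivity)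
  rw [ENNReal.tendsto_nhds_zero]
  intro e he
  obtain ⟨e', he'0, he'⟩ := ENNReal.lt_iff_exists_nnreal_btwn.1 he
  obtain ⟨Y, hY⟩ : ∃ Y : ℝ, Y = Real.exp ((2 * Real.exp ((L + Cu) * T) * L + 1) * T) := ⟨_, rfl⟩
  have hY0 : 0 < Y := hY ▸ Real.exp_pos _
  have he0 : (0 : ℝ) < e' := by exact_mod_cast he'0
  obtain ⟨η, hη⟩ : ∃ η : ℝ, η = e' / (8 * Y) := ⟨_, rfl⟩
  have hη0 : 0 < η := hη ▸ by positivity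
  have hηe : ENNReal.ofReal (8 * η * Y) ≤ e := by
    have h1 : 8 * η * Y = e' := by
      rw [hη]
      field_simp
    rw [h1, ENNReal.ofReal_coe_nnreal]
    exact he'.le
  -- The maximum with `Cu * T` covers the limit control, whose mollification error is at most `Cu δ
  -- ≤ √δ Cu`.
  obtain ⟨r, δ, τ, N, κ₀, ζ, hr, hδ, hδ1, hN, hκ₀, hζ, hmod, happ⟩ :=
    exists_euler_parameters d hT L C K Cu (Nf := fun r => max (Nf r) (Cu * T))
      (fun r => (hNf0 r).trans (le_max_left _ _)) hη0
  have hZ : ∀ᶠ ε in 𝓝[>] (0 : ℝ), ∀ k ∈ Finset.range N, ∀ x : Rd d, ‖x‖ ≤ r →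
      ‖∫ s in ((k : ℝ) * τ)..((k + 1 : ℕ) * τ), (mollify δ (wε ε s) x - mollify δ (w s) x)‖ ≤ ζ := by
    rw [Filter.eventually_all_finset]
    intro k hk
    have hk1 : k + 1 ≤ N := Finset.mem_range.1 hk
    refine eventually_norm_mollify_sub_le hweak (fun ε hε => (hRε ε hε).measurable_w)
      hR.measurable_w (fun ε hε => (hRε ε hε).bound) hR.bound
      (fun ε hε => (hRε ε hε).continuous_w) hR.continuous_w hδ (by positivity) (step_le k τ) ?_ r hζ
    rw [← hN]
    gcongr
  -- For the inviscid solution the control of the scheme is its own, so the error of exchanging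
  -- controls is zero.
  have hlim := happ 0 β w w μ μ₀ (by simp) (by simpa using hκ₀.le) hR hR.isEulerVelocity hwL hstart
    hK ⟨fun _ => Cu, integrableOn_const (by simp), fun _ => Cu.coe_nonneg, by
      simp only [setIntegral_const, smul_eq_mul, Measure.real, Real.volume_Ioo, sub_zero,
        ENNReal.toReal_ofReal hT.le]
      exact (mul_comm _ _).le.trans (le_max_right _ _), ae_of_all _ fun s x _ => by
      have h1 := norm_mollify_sub_self_le hδ (hwL s) x
      have h2 : δ ≤ √δ := Real.le_sqrt_of_sq_le (by nlinarith)
      refine h1.trans ((mul_comm _ _).le.trans ?_)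
      gcongr⟩ (fun k _ x _ => by simpa using hζ.le)
  filter_upwards [hZ, hNf r, self_mem_nhdsWithin, Ioo_mem_nhdsGT (lt_min hκ₀ one_pos)]
    with ε hZε hNε hε hεκ
  have hε0 : 0 < ε := hε
  have hε1 : min ε 1 = ε := min_eq_left (hεκ.2.le.trans (min_le_right _ _))
  have hRε' := hRε ε hε0
  have hstartε' := hstartε ε hε0
  have hae' := haeε ε hε0
  have hκ1 := hmin ε hε0
  rw [hε1] at hRε' hstartε' hae' hκ1
  -- The scheme for the viscous solution keeps the nonlocal velocity of that solution but uses the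
  -- limit control, whose Lipschitz constant `Cu` does not depend on `ε`.
  have huε' : IsEulerVelocity L C (βε ε) w :=
    ⟨hRε'.measurable_β, hR.measurable_w, hRε'.lipschitz, hRε'.growth, hR.bound, hR.continuous_w⟩
  obtain ⟨n, hn, hn0, hnN, hnw⟩ := hNε
  have hvisc := happ ε (βε ε) (wε ε) w (με ε) μ₀ hκ1
    ((abs_of_pos hε0).le.trans (hεκ.2.le.trans (min_le_left _ _))) hRε' huε' hwL hstartε' hK
    ⟨n, hn, hn0, hnN.trans (le_max_left _ _), hnw.mono fun s hs x hx =>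
      hs x δ hδ hδ1 (by linarith [le_abs_self r])⟩
    (fun k hk => hZε k (Finset.mem_range.2 hk))
  refine le_trans (iSup₂_le fun t ht => ?_) hηe
  rw [hY]
  refine W2_le_of_eulerFlow_approx hT huε' hR.isEulerVelocity hwL hδ hδ1 hη0.le hN hRε'.moment
    hR.moment ?_ (hmod ε _ _ _ hκ1 hRε') (hmod 0 _ _ _ (by simp) hR) hvisc hlim ⟨ht.1.le, ht.2.le⟩
  -- With equal controls the velocities of the two schemes differ only through the measure argument
  -- of `b`.
  filter_upwards [hae, hae', ae_restrict_mem measurableSet_Ioo] with s h1 h2 hs x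
  rw [← h1.1 x, ← h2.1 x]
  simpa using hL s ⟨hs.1.le, hs.2.le⟩ x x (με ε s) (μ s)
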